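/- Consider the allocation of a set $M$ of $m$ indivisible goods to a set $N$ of $n\ge 1$ agents. Agent $i$ has a value $v_i(g)\ge 0$ for each good $g$, and values are additive: $v_i(S)=\sum_{g\in S}v_i(g)$ for $S\subseteq M$. The instance is a \emph{3-value instance} if there are real numbers $a\ge b\ge c\ge 0$ such that $v_i(g)\in\{a,b,c\}$ for all $i\in N$, $g\in M$. A complete allocation is a partition $(X_i)_{i\in N}$ of $M$ into (possibly empty) bundles; it is \emph{$2/3$-EFX} if for all agents $i\ne j$ and every good $g\in X_j$ one has $v_i(X_i)\ge \tfrac23\, v_i(X_j\setminus\{g\})$. \textbf{Theorem.} There is a polynomial-time algorithm that computes, for every 3-value instance, a complete $2/3$-EFX allocation. Precisely: there are one program and one polynomial $T$ such that, for all $n\ge1$ and $m\ge 0$ and every 3-value instance with $n$ agents and $m$ goods, the program, when given the table of the values $v_i(g)$, halts after at most $T(n+m)$ elementary steps and outputs a complete $2/3$-EFX allocation. Here programs are built from sequencing, pairing, branching and while-loops over data made of booleans, real numbers, pairs and lists; the elementary steps are the construction and decomposition of pairs and lists, the constant $0$, and the addition, subtraction and comparison of two real numbers. -/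

import Mathlib

/-!  ## Fair division of indivisible goods

Agents are the elements of `Fin n`, goods the elements of `Fin m`, and `v i g` is the value of
agent `i` for good `g`. -/

/-- The additive value of agent `i` for the bundle `S`. -/
noncomputable def bundleValue {n m : ℕ} (v : Fin n → Fin m → ℝ) (i : Fin n)
    (S : Finset (Fin m)) : ℝ :=
  ∑ g ∈ S, v i g

/-- A three-value instance: every value is one of three numbers `a ≥ b ≥ c ≥ 0`, the same
three numbers for all agents and all goods. -/
def IsThreeValue {n m : ℕ} (v : Fin n → Fin m → ℝ) : Prop :=
  ∃ a b c : ℝ, b ≤ a ∧ c ≤ b ∧ 0 ≤ c ∧ ∀ i g, v i g = a ∨ v i g = b ∨ v i g = c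

/-- A complete allocation: the bundles are pairwise disjoint and every good is allocated. -/
def IsCompleteAllocation {n m : ℕ} (X : Fin n → Finset (Fin m)) : Prop :=
  (∀ i j, i ≠ j → Disjoint (X i) (X j)) ∧ ∀ g, ∃ i, g ∈ X i

/-- `X` is `α`-EFX: after the removal of any one good from the bundle of agent `j`, agent `i`
values her own bundle at least `α` times as much as what is left. -/
def IsApproxEFX {n m : ℕ} (α : ℝ) (v : Fin n → Fin m → ℝ) (X : Fin n → Finset (Fin m)) : Prop :=
  ∀ i j, i ≠ j → ∀ g ∈ X j, α * bundleValue v i (X j \ {g}) ≤ bundleValue v i (X i)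

/-!  ## Algorithms and their running time

A small while-language over booleans, real numbers, pairs and lists, with one time unit for each
elementary operation. Data are immutable and are passed by reference. The only operations on real
numbers are the constant `0`, addition, subtraction and comparison. A program is a finite piece of
syntax that contains no real numbers, and one and the same program is run on inputs of all sizes.
-/

/-- The data types of the language. -/
inductive Ty : Type
  | bool : Ty
  | real : Ty
  | prod : Ty → Ty → Ty
  | list : Ty → Ty

/-- The data of a given type. -/
abbrev Ty.Data : Ty → Type
  | .bool => Bool
  | .real => ℝ
  | .prod A B => A.Data × B.Data
  | .list A => List A.Data

/-- Programs with input type `A` and output type `B`. -/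
inductive Prog : Ty → Ty → Type
  /-- return the input -/
  | skip {A : Ty} : Prog A A
  /-- run `p`, then run `q` on its output -/
  | seq {A B C : Ty} (p : Prog A B) (q : Prog B C) : Prog A C
  /-- run `p` and `q` on the same input and pair their outputs -/
  | fork {A B C : Ty} (p : Prog A B) (q : Prog A C) : Prog A (.prod B C)
  | fst {A B : Ty} : Prog (.prod A B) A
  | snd {A B : Ty} : Prog (.prod A B) B
  | const {A : Ty} (x : Bool) : Prog A .bool
  /-- run the test `c`, then `p` if it returned `true` and `q` if it returned `false` -/
  | ite {A B : Ty} (c : Prog A .bool) (p q : Prog A B) : Prog A B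
  | nil {A B : Ty} : Prog A (.list B)
  | cons {A : Ty} : Prog (.prod A (.list A)) (.list A)
  /-- case distinction on the list in the first component of the input -/
  | listCase {A B C : Ty} (p : Prog A C) (q : Prog (.prod (.prod B (.list B)) A) C) :
      Prog (.prod (.list B) A) C
  | zero {A : Ty} : Prog A .real
  | add : Prog (.prod .real .real) .real
  | sub : Prog (.prod .real .real) .real
  | le : Prog (.prod .real .real) .bool
  /-- as long as the test `c` returns `true`, replace the current data by the output of `p` -/
  | loop {A : Ty} (c : Prog A .bool) (p : Prog A A) : Prog A A

/-- `Prog.Runs p x y t`: on input `x` the program `p` halts with output `y` after `t` steps. -/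
inductive Prog.Runs : {A B : Ty} → Prog A B → A.Data → B.Data → ℕ → Prop
  | skip {A : Ty} (x : A.Data) : Runs (Prog.skip (A := A)) x x 1
  | seq {A B C : Ty} {p : Prog A B} {q : Prog B C} {x : A.Data} {y : B.Data} {z : C.Data}
      {s t : ℕ} (hp : Runs p x y s) (hq : Runs q y z t) : Runs (Prog.seq p q) x z (s + t + 1)
  | fork {A B C : Ty} {p : Prog A B} {q : Prog A C} {x : A.Data} {y : B.Data} {z : C.Data}
      {s t : ℕ} (hp : Runs p x y s) (hq : Runs q x z t) :
      Runs (Prog.fork p q) x (y, z) (s + t + 1)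
  | fst {A B : Ty} (x : A.Data) (y : B.Data) : Runs (Prog.fst (A := A) (B := B)) (x, y) x 1
  | snd {A B : Ty} (x : A.Data) (y : B.Data) : Runs (Prog.snd (A := A) (B := B)) (x, y) y 1
  | const {A : Ty} (b : Bool) (x : A.Data) : Runs (Prog.const (A := A) b) x b 1
  | ite_true {A B : Ty} {c : Prog A .bool} {p q : Prog A B} {x : A.Data} {y : B.Data} {s t : ℕ}
      (hc : Runs c x true s) (hp : Runs p x y t) : Runs (Prog.ite c p q) x y (s + t + 1)
  | ite_false {A B : Ty} {c : Prog A .bool} {p q : Prog A B} {x : A.Data} {y : B.Data} {s t : ℕ}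
      (hc : Runs c x false s) (hq : Runs q x y t) : Runs (Prog.ite c p q) x y (s + t + 1)
  | nil {A B : Ty} (x : A.Data) : Runs (Prog.nil (A := A) (B := B)) x [] 1
  | cons {A : Ty} (x : A.Data) (l : List A.Data) : Runs (Prog.cons (A := A)) (x, l) (x :: l) 1
  | listCase_nil {A B C : Ty} {p : Prog A C} {q : Prog (.prod (.prod B (.list B)) A) C}
      {x : A.Data} {z : C.Data} {t : ℕ} (hp : Runs p x z t) :
      Runs (Prog.listCase p q) ([], x) z (t + 1)
  | listCase_cons {A B C : Ty} {p : Prog A C} {q : Prog (.prod (.prod B (.list B)) A) C}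
      {y : B.Data} {l : List B.Data} {x : A.Data} {z : C.Data} {t : ℕ}
      (hq : Runs q ((y, l), x) z t) : Runs (Prog.listCase p q) (y :: l, x) z (t + 1)
  | zero {A : Ty} (x : A.Data) : Runs (Prog.zero (A := A)) x (0 : ℝ) 1
  | add (x y : ℝ) : Runs Prog.add (x, y) (x + y) 1
  | sub (x y : ℝ) : Runs Prog.sub (x, y) (x - y) 1
  | le_true {x y : ℝ} (h : x ≤ y) : Runs Prog.le (x, y) true 1
  | le_false {x y : ℝ} (h : y < x) : Runs Prog.le (x, y) false 1
  | loop_done {A : Ty} {c : Prog A .bool} {p : Prog A A} {x : A.Data} {s : ℕ}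
      (hc : Runs c x false s) : Runs (Prog.loop c p) x x (s + 1)
  | loop_step {A : Ty} {c : Prog A .bool} {p : Prog A A} {x y z : A.Data} {s t r : ℕ}
      (hc : Runs c x true s) (hp : Runs p x y t) (hr : Runs (Prog.loop c p) y z r) :
      Runs (Prog.loop c p) x z (s + t + r + 1)

/-- The semantics is deterministic: output and number of steps are determined by the input. -/
theorem Prog.Runs.deterministic {A B : Ty} {p : Prog A B} {x : A.Data} {y y' : B.Data} {t t' : ℕ}
    (h : Prog.Runs p x y t) (h' : Prog.Runs p x y' t') : y = y' ∧ t = t' := by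
  induction h generalizing t' with
  | skip | fst | snd | const | nil | cons | zero | add | sub => cases h'; exact ⟨rfl, rfl⟩
  | seq _ _ ihp ihq =>
    cases h' with
    | seq hp hq =>
      obtain ⟨rfl, rfl⟩ := ihp hp
      obtain ⟨rfl, rfl⟩ := ihq hq
      exact ⟨rfl, rfl⟩
  | fork _ _ ihp ihq =>
    cases h' with
    | fork hp hq =>
      obtain ⟨rfl, rfl⟩ := ihp hp
      obtain ⟨rfl, rfl⟩ := ihq hq
      exact ⟨rfl, rfl⟩
  | ite_true _ _ ihc ihp | ite_false _ _ ihc ihp =>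
    cases h' with
    | ite_true hc hp | ite_false hc hp =>
      obtain ⟨h1, rfl⟩ := ihc hc
      first
        | exact absurd h1 (by decide)
        | (obtain ⟨rfl, rfl⟩ := ihp hp
           exact ⟨rfl, rfl⟩)
  | listCase_nil _ ih =>
    cases h' with
    | listCase_nil hp =>
      obtain ⟨rfl, rfl⟩ := ih hp
      exact ⟨rfl, rfl⟩
  | listCase_cons _ ih =>
    cases h' with
    | listCase_cons hp =>
      obtain ⟨rfl, rfl⟩ := ih hp
      exact ⟨rfl, rfl⟩
  | le_true h | le_false h =>
    cases h' with
    | le_true h2 | le_false h2 => first | exact ⟨rfl, rfl⟩ | exact absurd h (by linarith)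
  | loop_done _ ihc =>
    cases h' with
    | loop_done hc =>
      obtain ⟨-, rfl⟩ := ihc hc
      exact ⟨rfl, rfl⟩
    | loop_step hc _ _ => exact absurd (ihc hc).1 (by decide)
  | loop_step _ _ _ ihc ihp ihr =>
    cases h' with
    | loop_done hc => exact absurd (ihc hc).1 (by decide)
    | loop_step hc hp hr =>
      obtain ⟨-, rfl⟩ := ihc hc
      obtain ⟨rfl, rfl⟩ := ihp hp
      obtain ⟨rfl, rfl⟩ := ihr hr
      exact ⟨rfl, rfl⟩

/-- The input handed to a program: the table of values, one row for each agent. -/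
def encodeValues {n m : ℕ} (v : Fin n → Fin m → ℝ) : (Ty.list (Ty.list Ty.real)).Data :=
  List.ofFn fun i => List.ofFn fun g => v i g

/-- The output expected from a program: the table that tells which agent receives which goods,
one row for each agent. -/
def encodeAllocation {n m : ℕ} (X : Fin n → Finset (Fin m)) :
    (Ty.list (Ty.list Ty.bool)).Data :=
  List.ofFn fun i => List.ofFn fun g => decide (g ∈ X i)

/-!
The algorithm is a local search in two phases, started from the allocation that leaves all goods
in a pool.

In the first phase (`Inst.LocalOpt`) partial allocations are improved with respect to the
potential `Inst.pot`, which counts, in lexicographic order, how far the agents are above the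
thresholds `a / 2` and `2 a / 3`, how many agents hold a good worth `a` or a bundle worth `2 a`,
and the total value. The invariant `Inst.Valid` is `2/3`-EFX with some slack: an agent who owns no
more than `a` values no other bundle at more than `a` after the removal of a good, and similarly
for `2 a`. This slack lets her give up a good worth `a` for a bundle worth `2 a / 3`, at the end
of a chain of exchanges (`Chain`) through which some agent below `2 a / 3` moves up. The outcome
is `Inst.LocalOpt.critical`: in a local optimum with nonempty pool, the only agents for whom
adding a pool good to an unenvied bundle might violate `2/3`-EFX are the critical ones
(`Inst.Critical`). Such an agent holds a single good, of value `a`; moreover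
`a / 2 + c < b < 2 a / 3`, the whole pool is worth less than `2 a / 3` to her, and she values no
good in a bundle of several goods of another agent at `a`.

In the second phase (`Inst.ExchangeOpt`) the moves are to add a pool good to a bundle, to exchange
what an agent has got from the initial pool for another pool good, and to exchange bundles along a
cycle of weak envy. They only have to preserve `2/3`-EFX, without slack. The restrictive
description of critical agents, together with an agent who is minimal with respect to weak envy
and hence unenvied, shows that the search can only stop at a complete allocation
(`Inst.ExchangeOpt.pool_eq_empty`).

Both phases end after polynomially many steps, because the potential takes polynomially many
values: values of bundles are combinations of `a`, `b`, `c` with coefficients up to `m`. The moves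
tried in each step are polynomially many as well; in particular, a set of pool goods matters to
its new owner only through the numbers of goods of each value, so one set is tried for each triple
of numbers (`Inst.classSet`), and chains are found by breadth-first search (`search`).

For the running time, `PolyFun` packages a function with a program that computes it in polynomial
time and a polynomial bound on the size of the result. This class is closed under the usual
operations on lists, in particular under folds with bounded intermediate results
(`PolyFun.foldl`); both phases are such folds, over a list that is at least as long as the number
of steps needed (`PolyFun.climb`). Since the language has no numbers other than the input values,
agents and goods are named by the multiples of the greatest value `a`, if it is positive. Names
ending in `P` denote programs, and lemmas with the suffix `_f` give their values on encodings.
-/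

open Finset Relation

/-! ### Partial allocations -/

/-- A partial allocation: each good is owned by an agent or lies in the pool (`none`). -/
abbrev Alloc (n m : ℕ) := Fin m → Option (Fin n)

variable {n m : ℕ}

/-- The bundle of agent `i`. -/
def bun (σ : Alloc n m) (i : Fin n) : Finset (Fin m) := {g | σ g = some i}

/-- The unallocated goods. -/
def pool (σ : Alloc n m) : Finset (Fin m) := {g | σ g = none}

/-- Agent `j` returns all her goods to the pool. -/
def dropAll (σ : Alloc n m) (j : Fin n) : Alloc n m :=
  fun g => if σ g = some j then none else σ g

/-- Agent `i` hands all her goods to agent `l`. -/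
def handOver (σ : Alloc n m) (i l : Fin n) : Alloc n m :=
  fun g => if σ g = some i then some l else σ g

/-- Agent `u` receives the goods of `Z`, from wherever they are. -/
def give (σ : Alloc n m) (u : Fin n) (Z : Finset (Fin m)) : Alloc n m :=
  fun g => if g ∈ Z then some u else σ g

@[simp] lemma mem_bun {σ : Alloc n m} {i : Fin n} {g : Fin m} : g ∈ bun σ i ↔ σ g = some i := by
  simp [bun]

@[simp] lemma mem_pool {σ : Alloc n m} {g : Fin m} : g ∈ pool σ ↔ σ g = none := by
  simp [pool]

lemma disjoint_bun (σ : Alloc n m) {i j : Fin n} (h : i ≠ j) : Disjoint (bun σ i) (bun σ j) := by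
  rw [Finset.disjoint_left]
  intro g h1 h2
  simp only [mem_bun] at h1 h2
  exact h (by simpa using h1.symm.trans h2)

lemma disjoint_bun_pool (σ : Alloc n m) (i : Fin n) : Disjoint (bun σ i) (pool σ) := by
  rw [Finset.disjoint_left]
  intro g h1 h2
  simp_all

lemma bun_dropAll_self (σ : Alloc n m) (j : Fin n) : bun (dropAll σ j) j = ∅ := by
  ext g
  simp only [mem_bun, dropAll]
  split_ifs with h <;> simp [h]

lemma bun_dropAll_of_ne (σ : Alloc n m) {j k : Fin n} (h : k ≠ j) :
    bun (dropAll σ j) k = bun σ k := by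
  ext g
  simp only [mem_bun, dropAll]
  split_ifs with h' <;> simp [h', h.symm]

lemma pool_dropAll (σ : Alloc n m) (j : Fin n) : pool (dropAll σ j) = pool σ ∪ bun σ j := by
  ext g
  simp only [mem_pool, dropAll, mem_union, mem_bun]
  split_ifs with h' <;> simp [h']

lemma bun_handOver_source (σ : Alloc n m) {i l : Fin n} (h : i ≠ l) :
    bun (handOver σ i l) i = ∅ := by
  ext g
  simp only [mem_bun, handOver]
  split_ifs with h' <;> simp [h', h.symm]

lemma bun_handOver_target (σ : Alloc n m) (i l : Fin n) :
    bun (handOver σ i l) l = bun σ l ∪ bun σ i := by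
  ext g
  simp only [mem_bun, handOver, mem_union]
  split_ifs with h' <;> simp [h']

lemma bun_handOver_of_ne (σ : Alloc n m) {i l k : Fin n} (hi : k ≠ i) (hl : k ≠ l) :
    bun (handOver σ i l) k = bun σ k := by
  ext g
  simp only [mem_bun, handOver]
  split_ifs with h' <;> simp [h', hi.symm, hl.symm]

lemma pool_handOver (σ : Alloc n m) (i l : Fin n) : pool (handOver σ i l) = pool σ := by
  ext g
  simp only [mem_pool, handOver]
  split_ifs with h' <;> simp [h']

lemma bun_give_self (σ : Alloc n m) (u : Fin n) (Z : Finset (Fin m)) :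
    bun (give σ u Z) u = bun σ u ∪ Z := by
  ext g
  simp only [mem_bun, give, mem_union]
  split_ifs with h' <;> simp [h']

lemma bun_give_of_ne (σ : Alloc n m) {u k : Fin n} {Z : Finset (Fin m)} (h : k ≠ u)
    (hZ : Disjoint (bun σ k) Z) : bun (give σ u Z) k = bun σ k := by
  ext g
  simp only [mem_bun, give]
  split_ifs with h'
  · have : g ∉ bun σ k := fun hg => (Finset.disjoint_left.1 hZ) hg h'
    simp only [mem_bun] at this
    simp [this, h.symm]
  · rfl

lemma bun_give_of_subset_pool (σ : Alloc n m) {u k : Fin n} {Z : Finset (Fin m)} (h : k ≠ u)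
    (hZ : Z ⊆ pool σ) : bun (give σ u Z) k = bun σ k :=
  bun_give_of_ne σ h ((disjoint_bun_pool σ k).mono_right hZ)

lemma pool_give (σ : Alloc n m) (u : Fin n) (Z : Finset (Fin m)) :
    pool (give σ u Z) = pool σ \ Z := by
  ext g
  simp only [mem_pool, give, mem_sdiff]
  split_ifs with h' <;> simp [h']

/-! ### Three-value instances -/

/-- A three-value instance together with its three values. -/
structure Inst (n m : ℕ) where
  v : Fin n → Fin m → ℝ
  a : ℝ
  b : ℝ
  c : ℝ
  hba : b ≤ a
  hcb : c ≤ b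
  hc : 0 ≤ c
  hv : ∀ i g, v i g = a ∨ v i g = b ∨ v i g = c

namespace Inst

variable (I : Inst n m)

/-- The value of bundle `S` for agent `i`. -/
noncomputable def val (i : Fin n) (S : Finset (Fin m)) : ℝ := ∑ g ∈ S, I.v i g

/-- The value of her own bundle for agent `i`. -/
noncomputable def own (σ : Alloc n m) (i : Fin n) : ℝ := I.val i (bun σ i)

lemma a_nonneg : 0 ≤ I.a := I.hc.trans (I.hcb.trans I.hba)

lemma v_le (i : Fin n) (g : Fin m) : I.v i g ≤ I.a := by
  have := I.hba; have := I.hcb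
  rcases I.hv i g with h | h | h <;> linarith

lemma le_v (i : Fin n) (g : Fin m) : I.c ≤ I.v i g := by
  have := I.hba; have := I.hcb
  rcases I.hv i g with h | h | h <;> linarith

lemma v_nonneg (i : Fin n) (g : Fin m) : 0 ≤ I.v i g := I.hc.trans (I.le_v i g)

lemma val_nonneg (i : Fin n) (S : Finset (Fin m)) : 0 ≤ I.val i S :=
  Finset.sum_nonneg fun g _ => I.v_nonneg i g

lemma own_nonneg (σ : Alloc n m) (i : Fin n) : 0 ≤ I.own σ i := I.val_nonneg _ _

@[simp] lemma val_empty (i : Fin n) : I.val i ∅ = 0 := by simp [val]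

@[simp] lemma val_singleton (i : Fin n) (g : Fin m) : I.val i {g} = I.v i g := by simp [val]

lemma val_mono (i : Fin n) {S T : Finset (Fin m)} (h : S ⊆ T) : I.val i S ≤ I.val i T :=
  Finset.sum_le_sum_of_subset_of_nonneg h fun g _ _ => I.v_nonneg i g

lemma v_le_val (i : Fin n) {g : Fin m} {S : Finset (Fin m)} (h : g ∈ S) : I.v i g ≤ I.val i S := by
  rw [← I.val_singleton]
  exact I.val_mono i (by simpa using h)

lemma val_union (i : Fin n) {S T : Finset (Fin m)} (h : Disjoint S T) :
    I.val i (S ∪ T) = I.val i S + I.val i T := Finset.sum_union h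

lemma val_pair (i : Fin n) {g h : Fin m} (hgh : g ≠ h) :
    I.val i {g, h} = I.v i g + I.v i h := Finset.sum_pair hgh

lemma val_insert (i : Fin n) {g : Fin m} {S : Finset (Fin m)} (h : g ∉ S) :
    I.val i (insert g S) = I.v i g + I.val i S := Finset.sum_insert h

lemma val_erase_add (i : Fin n) {g : Fin m} {S : Finset (Fin m)} (h : g ∈ S) :
    I.val i (S.erase g) + I.v i g = I.val i S := Finset.sum_erase_add _ _ h

lemma val_le_card_mul (i : Fin n) {S : Finset (Fin m)} {w : ℝ} (h : ∀ g ∈ S, I.v i g ≤ w) :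
    I.val i S ≤ S.card * w := by
  rw [← nsmul_eq_mul]
  exact Finset.sum_le_card_nsmul S (I.v i) w h

/-! ### Validity of a partial allocation in the first phase -/

/-- Some value `w` of the table satisfies `a / 2 + c < w < 2 a / 3`. It must be `b`. -/
def Narrow : Prop := ∃ i g, 3 * I.v i g < 2 * I.a ∧ I.a < 2 * (I.v i g - I.c)

lemma Narrow.b_lt {I : Inst n m} (h : I.Narrow) : 3 * I.b < 2 * I.a ∧ I.a < 2 * (I.b - I.c) := by
  obtain ⟨i, g, h1, h2⟩ := h
  have := I.a_nonneg
  rcases I.hv i g with h | h | h <;> rw [h] at h1 h2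
  · linarith
  · exact ⟨h1, h2⟩
  · linarith

/-- A bundle of value `x` is acceptable to its owner in the presence of a bundle that is worth
`y` to her after the removal of a good. The clauses on `a` and `2 a` are stronger than `2/3`-EFX:
they let the owner swap a bundle worth `a` for one worth `2 a / 3`, and one worth at most `2 a`
for one worth `4 a / 3`. -/
def Acc (x y : ℝ) : Prop := 2 * y ≤ 3 * x ∧ (x ≤ I.a → y ≤ I.a) ∧ (x ≤ 2 * I.a → y ≤ 2 * I.a)

/-- Agent `l` values her bundle below `2 a / 3`. -/
def Low (σ : Alloc n m) (l : Fin n) : Prop := 3 * I.own σ l < 2 * I.a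

/-- Agent `l` would accept good `p` in exchange for her bundle, with a gain by a factor over
`3 / 2` if she is low. -/
def Sees (σ : Alloc n m) (l : Fin n) (p : Fin m) : Prop :=
  3 * I.own σ l < 2 * I.v l p ∨ (2 * I.a ≤ 3 * I.own σ l ∧ I.own σ l ≤ I.v l p)

/-- Agent `l` sees a good of agent `i`. -/
def SeesAgent (σ : Alloc n m) (l i : Fin n) : Prop := ∃ p ∈ bun σ i, I.Sees σ l p

/-- The contested agents: those that can be reached from a low agent along `SeesAgent`. -/
def Contested (σ : Alloc n m) (i : Fin n) : Prop :=
  ∃ j, I.Low σ j ∧ ReflTransGen (I.SeesAgent σ) j i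

/-- The bundles that contested agents see a good of are single goods. -/
def SeenSingle (σ : Alloc n m) : Prop :=
  ∀ l k, I.Contested σ l → k ≠ l → ∀ p ∈ bun σ k, I.Sees σ l p → (bun σ k).card = 1

/-- The bound on the size of a bundle in the first phase. -/
def SizeOK (S : Finset (Fin m)) : Prop :=
  S.card ≤ 2 ∨ (I.Narrow ∧ 6 * (((S.card : ℝ) - 1) * I.c) ≤ I.a)

/-- The invariant of the first phase. -/
structure Valid (σ : Alloc n m) : Prop where
  acc : ∀ i k, i ≠ k → ∀ g ∈ bun σ k, I.Acc (I.own σ i) (I.val i ((bun σ k).erase g))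
  size : ∀ k, I.SizeOK (bun σ k)
  seen : I.SeenSingle σ

variable {I}

lemma Acc.mono_left {x x' y : ℝ} (h : I.Acc x y) (hx : x ≤ x') : I.Acc x' y :=
  ⟨by linarith [h.1], fun h' => h.2.1 (hx.trans h'), fun h' => h.2.2 (hx.trans h')⟩

lemma Acc.mono_right {x y y' : ℝ} (h : I.Acc x y) (hy : y' ≤ y) : I.Acc x y' :=
  ⟨by linarith [h.1], fun h' => hy.trans (h.2.1 h'), fun h' => hy.trans (h.2.2 h')⟩

lemma acc_of_le {x y : ℝ} (hx : 0 ≤ x) (h : y ≤ x) : I.Acc x y :=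
  ⟨by linarith, fun h' => h.trans h', fun h' => h.trans h'⟩

lemma acc_zero {x : ℝ} (hx : 0 ≤ x) : I.Acc x 0 := acc_of_le hx hx

/-- An owner of value at most `a` may go down to `2 a / 3`. -/
lemma Acc.of_le_a {x x' y : ℝ} (h : I.Acc x y) (hx : x ≤ I.a) (hx' : 2 * I.a ≤ 3 * x') :
    I.Acc x' y := by
  have := h.2.1 hx
  have := I.a_nonneg
  exact ⟨by linarith, fun _ => by linarith, fun _ => by linarith⟩

lemma acc_v_of_le {x : ℝ} {i : Fin n} {p : Fin m} (h : 2 * I.v i p ≤ 3 * x) :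
    I.Acc x (I.v i p) :=
  ⟨h, fun _ => I.v_le i p, fun _ => by linarith [I.v_le i p, I.a_nonneg]⟩

lemma Low.contested {σ : Alloc n m} {i : Fin n} (h : I.Low σ i) : I.Contested σ i :=
  ⟨i, h, .refl⟩

lemma Contested.step {σ : Alloc n m} {l i : Fin n} (h : I.Contested σ l)
    (h' : I.SeesAgent σ l i) : I.Contested σ i := by
  obtain ⟨j, hj, hr⟩ := h
  exact ⟨j, hj, hr.tail h'⟩

lemma Sees.le {σ : Alloc n m} {l : Fin n} {p : Fin m} (h : I.Sees σ l p) :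
    I.own σ l ≤ I.v l p := by
  have := I.own_nonneg σ l
  rcases h with h | h
  · linarith
  · exact h.2

lemma Sees.lt_of_low {σ : Alloc n m} {l : Fin n} {p : Fin m} (h : I.Sees σ l p)
    (hl : I.Low σ l) : 3 * I.own σ l < 2 * I.v l p := by
  rcases h with h | h
  · exact h
  · exact absurd hl (not_lt.2 h.1)

/-- An agent whose bundle becomes a good that she saw sees no more goods than before. -/
lemma Sees.of_shift {σ σ' : Alloc n m} {l : Fin n} {p q : Fin m} (hq : I.Sees σ l q)
    (h' : I.own σ' l = I.v l q) (hp : I.Sees σ' l p) : I.Sees σ l p := by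
  have h0 := I.own_nonneg σ l
  have hle := hq.le
  rcases hp with hp | ⟨hp1, hp2⟩
  · left; linarith
  · rcases hq with hq | ⟨hq1, hq2⟩
    · left; linarith
    · right; exact ⟨hq1, by linarith⟩

lemma sees_congr {σ σ' : Alloc n m} {l : Fin n} (h : I.own σ' l = I.own σ l) (p : Fin m) :
    I.Sees σ' l p ↔ I.Sees σ l p := by
  unfold Sees; rw [h]

/-- A set that contains the low agents, is closed under `SeesAgent`, and whose members see goods
of single-good bundles only, certifies `SeenSingle`. -/
lemma seenSingle_of_closed {σ : Alloc n m} (B : Fin n → Prop) (h1 : ∀ k, I.Low σ k → B k)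
    (h2 : ∀ k k', B k → k' ≠ k → ∀ p ∈ bun σ k', I.Sees σ k p → B k' ∧ (bun σ k').card = 1) :
    I.SeenSingle σ := by
  have key : ∀ i, I.Contested σ i → B i := by
    rintro i ⟨j, hj, hr⟩
    induction hr with
    | refl => exact h1 j hj
    | @tail l i _ hE ih =>
      obtain ⟨p, hp, hs⟩ := hE
      by_cases hil : i = l
      · exact hil ▸ ih
      · exact (h2 l i ih hil p hp hs).1
  intro l k hl hk p hp hs
  exact (h2 l k (key l hl) hk p hp hs).2

/-! ### The potential of the first phase -/

variable (I)

open Classical in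
/-- The level of a bundle of value `x`. -/
noncomputable def lev (x : ℝ) : ℝ := 
  if 2 * I.a ≤ 3 * x then 2 * I.a else if I.a < 2 * x then I.a else 0

/-- Agent `i` holds a bundle worth `2 a` or a good worth `a`. -/
def Rich (σ : Alloc n m) (i : Fin n) : Prop :=
  2 * I.a ≤ I.own σ i ∨ ∃ g ∈ bun σ i, I.v i g = I.a

open Classical in
/-- The potential of the first phase: total level, number of rich agents (scaled by `a`), and
total value, in lexicographic order. -/
noncomputable def pot (σ : Alloc n m) : ℝ ×ₗ ℝ ×ₗ ℝ :=
  toLex (∑ i, I.lev (I.own σ i),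
    toLex (∑ i, (if I.Rich σ i then I.a else 0), ∑ i, I.own σ i))

variable {I}

lemma lev_mono {x y : ℝ} (h : x ≤ y) : I.lev x ≤ I.lev y := by
  have := I.a_nonneg
  unfold lev
  split_ifs <;> linarith

lemma lev_le (x : ℝ) : I.lev x ≤ 2 * I.a := by
  have := I.a_nonneg
  unfold lev
  split_ifs <;> linarith

lemma lev_eq {x : ℝ} (h : 2 * I.a ≤ 3 * x) : I.lev x = 2 * I.a := by
  simp [lev, h]

lemma pot_lt_of_lev {σ σ' : Alloc n m} (h : ∀ k, I.lev (I.own σ k) ≤ I.lev (I.own σ' k))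
    {j : Fin n} (hj : I.lev (I.own σ j) < I.lev (I.own σ' j)) : I.pot σ < I.pot σ' := by
  rw [pot, pot, Prod.Lex.toLex_lt_toLex]
  left
  exact Finset.sum_lt_sum (fun k _ => h k) ⟨j, mem_univ _, hj⟩

lemma rich_sum_le {σ σ' : Alloc n m} (hR : ∀ k, I.Rich σ k → I.Rich σ' k) (k : Fin n)
    [Decidable (I.Rich σ k)] [Decidable (I.Rich σ' k)] :
    (if I.Rich σ k then I.a else 0) ≤ (if I.Rich σ' k then I.a else 0) := by
  have := I.a_nonneg
  have := hR k
  split_ifs <;> tauto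

lemma pot_lt_of_rich {σ σ' : Alloc n m} (h : ∀ k, I.lev (I.own σ k) ≤ I.lev (I.own σ' k))
    (hR : ∀ k, I.Rich σ k → I.Rich σ' k) (ha : 0 < I.a)
    {j : Fin n} (hj : ¬ I.Rich σ j) (hj' : I.Rich σ' j) : I.pot σ < I.pot σ' := by
  classical
  rw [pot, pot, Prod.Lex.toLex_lt_toLex]
  rcases (Finset.sum_le_sum (fun k (_ : k ∈ univ) => h k)).lt_or_eq with h1 | h1
  · exact Or.inl h1
  · refine Or.inr ⟨h1, ?_⟩
    rw [Prod.Lex.toLex_lt_toLex]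
    left
    exact Finset.sum_lt_sum (fun k _ => rich_sum_le hR k) ⟨j, mem_univ _, by simp [hj, hj', ha]⟩

lemma pot_lt_of_own {σ σ' : Alloc n m} (h : ∀ k, I.own σ k ≤ I.own σ' k)
    (hR : ∀ k, I.Rich σ k → I.Rich σ' k) {j : Fin n} (hj : I.own σ j < I.own σ' j) :
    I.pot σ < I.pot σ' := by
  classical
  rw [pot, pot, Prod.Lex.toLex_lt_toLex]
  rcases (Finset.sum_le_sum (fun k (_ : k ∈ univ) => lev_mono (I := I) (h k))).lt_or_eq with h1 | h1
  · exact Or.inl h1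
  · refine Or.inr ⟨h1, ?_⟩
    rw [Prod.Lex.toLex_lt_toLex]
    rcases (Finset.sum_le_sum (fun k (_ : k ∈ univ) => rich_sum_le hR k)).lt_or_eq with h2 | h2
    · exact Or.inl h2
    · exact Or.inr ⟨h2, Finset.sum_lt_sum (fun k _ => h k) ⟨j, mem_univ _, hj⟩⟩

/-! ### Shifting goods along chains -/

end Inst

/-- Chains of exchanges. A chain begins with an agent `j` satisfying `St` who returns her bundle
to the pool; then each agent `l` with empty hands takes the bundle of an agent `i` outside the
chain with `E l i`. `Chain St E σ D u Y` says that `D` is the set of agents involved, `u` is the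
last agent (whose hands are empty), and `Y` is the resulting allocation. -/
inductive Chain (St : Fin n → Prop) (E : Fin n → Fin n → Prop) (σ : Alloc n m) :
    Finset (Fin n) → Fin n → Alloc n m → Prop
  | start (j : Fin n) (h : St j) : Chain St E σ {j} j (dropAll σ j)
  | step {D : Finset (Fin n)} {l : Fin n} {Y : Alloc n m} (i : Fin n) (h : Chain St E σ D l Y)
      (hE : E l i) (hi : i ∉ D) (hs : ¬ St i) : Chain St E σ (insert i D) i (handOver Y i l)

namespace Chain

variable {St : Fin n → Prop} {E : Fin n → Fin n → Prop} {σ Y : Alloc n m} {D : Finset (Fin n)}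
  {u : Fin n}

lemma mem (h : Chain St E σ D u Y) : u ∈ D := by cases h <;> simp

lemma bun_end (h : Chain St E σ D u Y) : bun Y u = ∅ := by
  cases h with
  | start h => exact bun_dropAll_self _ _
  | step i h hE hi hs => exact bun_handOver_source _ (fun e => hi (e ▸ h.mem))

lemma bun_of_notMem (h : Chain St E σ D u Y) {k : Fin n} (hk : k ∉ D) : bun Y k = bun σ k := by
  induction h with
  | start j h => exact bun_dropAll_of_ne _ (by simpa using hk)
  | step i h hE hi hs ih =>
    simp only [mem_insert, not_or] at hk
    rw [bun_handOver_of_ne _ hk.1 (fun e => hk.2 (e ▸ h.mem)), ih hk.2]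

lemma pool_subset (h : Chain St E σ D u Y) : pool σ ⊆ pool Y := by
  induction h with
  | start j h => rw [pool_dropAll]; exact subset_union_left
  | step i h hE hi hs ih => rwa [pool_handOver]

lemma exists_start (h : Chain St E σ D u Y) : ∃ j ∈ D, St j := by
  induction h with
  | start j h => exact ⟨j, by simp, h⟩
  | step i h hE hi hs ih =>
    obtain ⟨j, hj, h⟩ := ih
    exact ⟨j, by simp [hj], h⟩

/-- The bundle of a member of the chain that satisfies `St` is in the pool at the end. -/
lemma bun_subset_pool (h : Chain St E σ D u Y) {j : Fin n} (hj : j ∈ D) (hs : St j) :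
    bun σ j ⊆ pool Y := by
  induction h with
  | start k h =>
    simp only [mem_singleton] at hj
    rw [pool_dropAll, hj]; exact subset_union_right
  | step i h hE hi hs' ih =>
    rw [pool_handOver]
    rcases mem_insert.1 hj with rfl | hj
    · exact absurd hs hs'
    · exact ih hj

/-- All members but the last hold the bundle that another member had at the beginning. -/
lemma exists_bun_eq (h : Chain St E σ D u Y) {k : Fin n} (hk : k ∈ D) (hku : k ≠ u) :
    ∃ i ∈ D, i ≠ k ∧ E k i ∧ bun Y k = bun σ i := by
  induction h with
  | start j h => simp_all
  | @step D l Y i h hE hi hs ih =>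
    have hil : i ≠ l := fun e => hi (e ▸ h.mem)
    rcases mem_insert.1 hk with rfl | hk
    · exact absurd rfl hku
    by_cases hkl : k = l
    · subst hkl
      refine ⟨i, by simp, hil, hE, ?_⟩
      rw [bun_handOver_target, h.bun_end, h.bun_of_notMem hi, empty_union]
    · obtain ⟨i', hi', h1, h2, h3⟩ := ih hk hkl
      exact ⟨i', by simp [hi'], h1, h2, by rw [bun_handOver_of_ne _ hku hkl, h3]⟩

lemma rel (h : Chain St E σ D u Y) : ∀ k ∈ D, ∃ j, St j ∧ ReflTransGen E j k := by
  induction h with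
  | start j h => simpa using ⟨j, h, .refl⟩
  | @step D l Y i h hE hi hs ih =>
    intro k hk
    rcases mem_insert.1 hk with rfl | hk
    · obtain ⟨j, hj, hr⟩ := ih l h.mem
      exact ⟨j, hj, hr.tail hE⟩
    · exact ih k hk

end Chain

namespace Inst
variable {I : Inst n m}

/-- `σ'` arises from `σ` by giving each agent of `D`, all of them contested, a single good that
she sees, and giving a new bundle to `u`. -/
structure Shift (I : Inst n m) (σ σ' : Alloc n m) (D : Finset (Fin n)) (u : Fin n) : Prop where
  other : ∀ k, k ∉ D → k ≠ u → bun σ' k = bun σ k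
  contested : ∀ k ∈ D, I.Contested σ k
  single : ∀ k ∈ D, ∃ p, bun σ' k = {p} ∧ I.Sees σ k p

namespace Shift

variable {σ σ' : Alloc n m} {D : Finset (Fin n)} {u : Fin n}

lemma own_single (h : I.Shift σ σ' D u) {k : Fin n} (hk : k ∈ D) :
    ∃ p, bun σ' k = {p} ∧ I.own σ' k = I.v k p ∧ I.Sees σ k p := by
  obtain ⟨p, hp, hs⟩ := h.single k hk
  exact ⟨p, hp, by rw [own, hp, val_singleton], hs⟩

lemma own_other (h : I.Shift σ σ' D u) {k : Fin n} (hk : k ∉ D) (hu : k ≠ u) :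
    I.own σ' k = I.own σ k := by rw [own, h.other k hk hu, own]

lemma own_le (h : I.Shift σ σ' D u) {k : Fin n} (hu : k ≠ u) : I.own σ k ≤ I.own σ' k := by
  by_cases hk : k ∈ D
  · obtain ⟨p, -, hp, hs⟩ := h.own_single hk
    rw [hp]; exact hs.le
  · rw [h.own_other hk hu]

lemma own_lt_of_low (h : I.Shift σ σ' D u) {k : Fin n} (hk : k ∈ D) (hl : I.Low σ k) :
    I.own σ k < I.own σ' k := by
  obtain ⟨p, -, hp, hs⟩ := h.own_single hk
  have := hs.lt_of_low hl
  have := I.own_nonneg σ k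
  linarith

lemma sees (h : I.Shift σ σ' D u) {k : Fin n} (hu : k ≠ u) {p : Fin m} (hp : I.Sees σ' k p) :
    I.Sees σ k p := by
  by_cases hk : k ∈ D
  · obtain ⟨q, -, hq, hs⟩ := h.own_single hk
    exact hs.of_shift hq hp
  · exact (sees_congr (h.own_other hk hu) p).1 hp

lemma rich (h : I.Shift σ σ' D u) {k : Fin n} (hu : k ≠ u) (hr : I.Rich σ k) : I.Rich σ' k := by
  by_cases hk : k ∈ D
  · rcases hr with hr | ⟨g, hg, hga⟩
    · exact Or.inl (hr.trans (h.own_le hu))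
    · obtain ⟨q, hq, hq', hs⟩ := h.own_single hk
      refine Or.inr ⟨q, by simp [hq], le_antisymm (I.v_le k q) ?_⟩
      have := I.v_le_val k hg
      exact (hga ▸ this).trans hs.le
  · unfold Rich own
    rw [h.other k hk hu]; exact hr

/-- Validity after a shift, apart from `SeenSingle`. -/
lemma valid (h : I.Shift σ σ' D u) (hσ : I.Valid σ)
    (hZ : ∀ k, k ≠ u → ∀ g ∈ bun σ' u, I.Acc (I.own σ k) (I.val k ((bun σ' u).erase g)))
    (hu : ∀ y, I.Acc (I.own σ u) y → I.Acc (I.own σ' u) y)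
    (hsize : I.SizeOK (bun σ' u)) (hseen : I.SeenSingle σ') : I.Valid σ' := by
  refine ⟨fun i k hik g hg => ?_, fun k => ?_, hseen⟩
  · by_cases hku : k = u
    · subst hku
      exact (hZ i hik g hg).mono_left (h.own_le hik)
    by_cases hk : k ∈ D
    · obtain ⟨p, hp, -⟩ := h.single k hk
      rw [hp, mem_singleton] at hg
      rw [hp, hg]
      simpa using acc_zero (I.own_nonneg σ' i)
    · rw [h.other k hk hku] at hg ⊢
      have := hσ.acc i k hik g hg
      by_cases hi : i = u
      · subst hi; exact hu _ this
      · exact this.mono_left (h.own_le hi)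
  · by_cases hku : k = u
    · subst hku; exact hsize
    by_cases hk : k ∈ D
    · obtain ⟨p, hp, -⟩ := h.single k hk
      rw [hp]; left; simp
    · rw [h.other k hk hku]; exact hσ.size k

/-- If `u`, too, receives a good that she sees, then no agent sees more goods than before. -/
lemma seenSingle_of_sees (h : I.Shift σ σ' D u) (hσ : I.Valid σ) (hu : I.Contested σ u)
    {q : Fin m} (hq : bun σ' u = {q}) (hs : I.Sees σ u q) : I.SeenSingle σ' := by
  have hown : I.own σ' u = I.v u q := by rw [own, hq, val_singleton]
  have hle : ∀ k, I.own σ k ≤ I.own σ' k := fun k => by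
    by_cases hk : k = u
    · rw [hk, hown]; exact hs.le
    · exact h.own_le hk
  refine seenSingle_of_closed (I.Contested σ) (fun k hk => ?_) (fun k k' hk hkk p hp hps => ?_)
  · refine Low.contested ?_
    have := hle k
    unfold Low at *; linarith
  · have hps : I.Sees σ k p := by
      by_cases hku : k = u
      · subst hku; exact hs.of_shift hown hps
      · exact h.sees hku hps
    by_cases hku : k' = u
    · subst hku; exact ⟨hu, by simp [hq]⟩
    by_cases hkD : k' ∈ D
    · obtain ⟨q', hq', -⟩ := h.single k' hkD
      exact ⟨h.contested k' hkD, by simp [hq']⟩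
    · rw [h.other k' hkD hku] at hp ⊢
      exact ⟨hk.step ⟨p, hp, hps⟩, hσ.seen k k' hk hkk p hp hps⟩

/-- If no other contested agent sees a good of the new bundle of `u`, and `u` either gains or ends
up above the low threshold, then `SeenSingle` is preserved. In the latter case `u` need not remain
contested. -/
lemma seenSingle_of_unseen (h : I.Shift σ σ' D u) (hσ : I.Valid σ)
    (hZ : ∀ k, I.Contested σ k → k ≠ u → ∀ p ∈ bun σ' u, ¬ I.Sees σ k p)
    (hu : I.own σ u ≤ I.own σ' u ∨ 2 * I.a ≤ 3 * I.own σ' u) : I.SeenSingle σ' := by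
  by_cases hlow : 2 * I.a ≤ 3 * I.own σ' u
  · refine seenSingle_of_closed (fun k => I.Contested σ k ∧ k ≠ u) (fun k hk => ?_)
      (fun k k' hk hkk p hp hps => ?_)
    · have hku : k ≠ u := by
        rintro rfl
        exact absurd hk (not_lt.2 hlow)
      have := h.own_le hku
      refine ⟨Low.contested ?_, hku⟩
      unfold Low at *; linarith
    · have hps := h.sees hk.2 hps
      by_cases hku : k' = u
      · subst hku; exact absurd hps (hZ k hk.1 hk.2 p hp)
      by_cases hkD : k' ∈ D
      · obtain ⟨q', hq', -⟩ := h.single k' hkD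
        exact ⟨⟨h.contested k' hkD, hku⟩, by simp [hq']⟩
      · rw [h.other k' hkD hku] at hp ⊢
        exact ⟨⟨hk.1.step ⟨p, hp, hps⟩, hku⟩, hσ.seen k k' hk.1 hkk p hp hps⟩
  · have hu := hu.resolve_right hlow
    have hle : ∀ k, I.own σ k ≤ I.own σ' k := fun k => by
      by_cases hk : k = u
      · rw [hk]; exact hu
      · exact h.own_le hk
    refine seenSingle_of_closed (I.Contested σ) (fun k hk => ?_) (fun k k' hk hkk p hp hps => ?_)
    · refine Low.contested ?_
      have := hle k
      unfold Low at *; linarith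
    · have hps' : I.Sees σ k p := by
        by_cases hku : k = u
        · subst hku
          rcases hps with hps | hps
          · left; linarith
          · exact absurd hps.1 hlow
        · exact h.sees hku hps
      by_cases hku : k' = u
      · subst hku; exact absurd hps' (hZ k hk hkk.symm p hp)
      by_cases hkD : k' ∈ D
      · obtain ⟨q', hq', -⟩ := h.single k' hkD
        exact ⟨h.contested k' hkD, by simp [hq']⟩
      · rw [h.other k' hkD hku] at hp ⊢
        exact ⟨hk.step ⟨p, hp, hps'⟩, hσ.seen k k' hk hkk p hp hps'⟩

end Shift

/-- The shift in which only `u` changes her bundle. -/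
lemma shift_dropAll (I : Inst n m) (σ : Alloc n m) (u : Fin n) {Z : Finset (Fin m)}
    (hZ : Z ⊆ pool σ ∪ bun σ u) :
    I.Shift σ (give (dropAll σ u) u Z) ∅ u ∧ bun (give (dropAll σ u) u Z) u = Z := by
  refine ⟨⟨fun k _ hk => ?_, by simp, by simp⟩, ?_⟩
  · rw [bun_give_of_subset_pool _ hk (by rwa [pool_dropAll]), bun_dropAll_of_ne _ hk]
  · rw [bun_give_self, bun_dropAll_self, empty_union]

section chain
variable {σ Y : Alloc n m} {D : Finset (Fin n)} {u : Fin n}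

lemma chain_contested (h : Chain (I.Low σ) (I.SeesAgent σ) σ D u Y) {k : Fin n} (hk : k ∈ D) :
    I.Contested σ k := h.rel k hk

/-- Along a chain the agents before the last one hold single goods, by `SeenSingle`. -/
lemma chain_single (hσ : I.Valid σ) (h : Chain (I.Low σ) (I.SeesAgent σ) σ D u Y) {k : Fin n}
    (hk : k ∈ D) (hku : k ≠ u) : ∃ p, bun Y k = {p} ∧ I.Sees σ k p := by
  obtain ⟨i, -, hik, ⟨p, hp, hs⟩, hb⟩ := h.exists_bun_eq hk hku
  have := hσ.seen k i (chain_contested h hk) hik p hp hs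
  obtain ⟨q, hq⟩ := Finset.card_eq_one.1 this
  rw [hq, mem_singleton] at hp
  exact ⟨q, hb.trans hq, hp ▸ hs⟩

/-- The shift in which the last agent of a chain takes goods from the pool. -/
lemma shift_chain (hσ : I.Valid σ) (h : Chain (I.Low σ) (I.SeesAgent σ) σ D u Y)
    {Z : Finset (Fin m)} (hZ : Z ⊆ pool Y) :
    I.Shift σ (give Y u Z) (D.erase u) u ∧ bun (give Y u Z) u = Z := by
  refine ⟨⟨fun k hk hku => ?_, fun k hk => chain_contested h (mem_of_mem_erase hk),
    fun k hk => ?_⟩, ?_⟩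
  · rw [bun_give_of_subset_pool _ hku hZ, h.bun_of_notMem]
    simpa [hku] using hk
  · rw [bun_give_of_subset_pool _ (ne_of_mem_erase hk) hZ]
    exact chain_single hσ h (mem_of_mem_erase hk) (ne_of_mem_erase hk)
  · rw [bun_give_self, h.bun_end, empty_union]

/-- The shift in which the last agent of a chain takes the good of an agent outside it, who in
turn takes goods from the pool. -/
lemma shift_chain_handOver (hσ : I.Valid σ) (h : Chain (I.Low σ) (I.SeesAgent σ) σ D u Y)
    {i : Fin n} (hi : i ∉ D) {p : Fin m} (hp : bun σ i = {p}) (hs : I.Sees σ u p)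
    {Z : Finset (Fin m)} (hZ : Z ⊆ pool Y) :
    I.Shift σ (give (handOver Y i u) i Z) D i ∧ bun (give (handOver Y i u) i Z) i = Z := by
  have hiu : i ≠ u := fun e => hi (e ▸ h.mem)
  have hZ' : Z ⊆ pool (handOver Y i u) := by rwa [pool_handOver]
  refine ⟨⟨fun k hk hki => ?_, fun k hk => chain_contested h hk, fun k hk => ?_⟩, ?_⟩
  · rw [bun_give_of_subset_pool _ hki hZ', bun_handOver_of_ne _ hki, h.bun_of_notMem hk]
    rintro rfl; exact hk h.mem
  · have hki : k ≠ i := fun e => hi (e ▸ hk)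
    rw [bun_give_of_subset_pool _ hki hZ']
    by_cases hku : k = u
    · subst hku
      refine ⟨p, ?_, hs⟩
      rw [bun_handOver_target, h.bun_end, h.bun_of_notMem hi, hp, empty_union]
    · rw [bun_handOver_of_ne _ hki hku]
      exact chain_single hσ h hk hku
  · rw [bun_give_self, bun_handOver_source _ hiu, empty_union]

end chain

end Inst

namespace Inst

/-! ### Local optima of the first phase -/

/-- The allocation `σ'` is valid and has a larger potential than `σ`. -/
def Improves (I : Inst n m) (σ σ' : Alloc n m) : Prop := I.Valid σ' ∧ I.pot σ < I.pot σ'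

/-- No improvement of `σ` arises when `u` takes one or two goods in `Y`, or a set of pool goods;
for the latter, only one set is tried for each cardinality and value to `u`. -/
structure NoFill (I : Inst n m) (σ : Alloc n m) (u : Fin n) (Y : Alloc n m) : Prop where
  pair : ∀ g g', ¬ I.Improves σ (give Y u {g, g'})
  set : ∀ Z ⊆ pool σ, ∃ Z' ⊆ pool σ, Z'.card = Z.card ∧ I.val u Z' = I.val u Z ∧
    ¬ I.Improves σ (give Y u Z')

/-- The local optima of the first phase. -/
structure LocalOpt (I : Inst n m) (σ : Alloc n m) : Prop where
  valid : I.Valid σ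
  drop : ∀ i, I.NoFill σ i (dropAll σ i)
  chain : ∀ u, I.Contested σ u → ∃ D Y, Chain (I.Low σ) (I.SeesAgent σ) σ D u Y ∧
    I.NoFill σ u Y ∧ ∀ i, i ≠ u → I.NoFill σ i (handOver Y i u)

lemma NoFill.single {I : Inst n m} {σ Y : Alloc n m} {u : Fin n} (h : I.NoFill σ u Y)
    (g : Fin m) : ¬ I.Improves σ (give Y u {g}) := by
  have := h.pair g g
  rwa [pair_eq_singleton] at this

variable {I : Inst n m} {σ : Alloc n m}

lemma sizeOK_singleton (g : Fin m) : I.SizeOK {g} := Or.inl (by simp)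

lemma sizeOK_pair (g h : Fin m) : I.SizeOK {g, h} := Or.inl card_le_two

/-- At the end of a chain of a local optimum, the last agent sees no good of the pool. -/
lemma not_sees_of_chain (hσ : I.Valid σ) {D : Finset (Fin n)} {u : Fin n} {Y : Alloc n m}
    (hc : Chain (I.Low σ) (I.SeesAgent σ) σ D u Y) (hY : I.NoFill σ u Y) {g : Fin m}
    (hg : g ∈ pool Y) : ¬ I.Sees σ u g := by
  intro hs
  obtain ⟨hsh, hb⟩ := shift_chain (I := I) hσ hc (Z := {g}) (by simpa using hg)
  set σ' := give Y u {g}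
  have hu : I.own σ' u = I.v u g := by rw [own, hb, val_singleton]
  have hle : ∀ k, I.own σ k ≤ I.own σ' k := fun k => by
    by_cases hk : k = u
    · rw [hk, hu]; exact hs.le
    · exact hsh.own_le hk
  refine hY.single g ⟨hsh.valid hσ ?_ (fun y hy => hy.mono_left (hle u)) ?_ ?_, ?_⟩
  · intro k _ e he
    rw [hb, mem_singleton] at he
    rw [hb, he]
    simpa using acc_zero (I.own_nonneg σ k)
  · rw [hb]; exact sizeOK_singleton g
  · exact hsh.seenSingle_of_sees hσ (chain_contested hc hc.mem) hb hs
  · obtain ⟨j, hj, hl⟩ := hc.exists_start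
    refine pot_lt_of_own hle (fun k hk => ?_) (j := j) ?_
    · by_cases hku : k = u
      · subst hku
        rcases hk with hk | ⟨e, he, hea⟩
        · exact Or.inl (hk.trans (hle k))
        · refine Or.inr ⟨g, by rw [hb]; simp, le_antisymm (I.v_le k g) ?_⟩
          exact (hea ▸ I.v_le_val k he).trans hs.le
      · exact hsh.rich hku hk
    · by_cases hju : j = u
      · subst hju
        have := hs.lt_of_low hl
        have := I.own_nonneg σ j
        rw [hu]; linarith
      · exact hsh.own_lt_of_low (mem_erase.2 ⟨hju, hj⟩) hl

lemma LocalOpt.not_sees (h : I.LocalOpt σ) {l : Fin n} (hl : I.Contested σ l) {g : Fin m}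
    (hg : g ∈ pool σ) : ¬ I.Sees σ l g := by
  obtain ⟨D, Y, hc, hY, -⟩ := h.chain l hl
  exact not_sees_of_chain h.valid hc hY (hc.pool_subset hg)

/-- A way to show that replacing the bundle of `u` by a set of goods that no other contested
agent sees, with a gain for `u`, is an improvement. -/
lemma improves_of_drop (hσ : I.Valid σ) {u : Fin n} {Z : Finset (Fin m)}
    (hZ : Z ⊆ pool σ ∪ bun σ u)
    (hseen : ∀ k, I.Contested σ k → k ≠ u → ∀ p ∈ Z, ¬ I.Sees σ k p)
    (hacc : ∀ k, k ≠ u → ∀ g ∈ Z, I.Acc (I.own σ k) (I.val k (Z.erase g)))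
    (hsize : I.SizeOK Z) (hgain : I.own σ u < I.val u Z)
    (hrich : (∃ g ∈ bun σ u, I.v u g = I.a) → I.own σ u < 2 * I.a →
      2 * I.a ≤ I.val u Z ∨ ∃ g ∈ Z, I.v u g = I.a) :
    I.Improves σ (give (dropAll σ u) u Z) := by
  obtain ⟨hsh, hb⟩ := shift_dropAll I σ u hZ
  set σ' := give (dropAll σ u) u Z
  have hu : I.own σ' u = I.val u Z := by rw [own, hb]
  have hle : ∀ k, I.own σ k ≤ I.own σ' k := fun k => by
    by_cases hk : k = u
    · rw [hk, hu]; exact hgain.le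
    · exact hsh.own_le hk
  refine ⟨hsh.valid hσ (by rwa [hb]) (fun y hy => hy.mono_left (hle u)) (by rwa [hb])
    (hsh.seenSingle_of_unseen hσ (by rwa [hb]) (Or.inl (hle u))), ?_⟩
  refine pot_lt_of_own hle (fun k hk => ?_) (j := u) (by rwa [hu])
  by_cases hku : k = u
  · subst hku
    rcases hk with hk | hk
    · exact Or.inl (hk.trans (hle k))
    · by_cases h2 : 2 * I.a ≤ I.own σ k
      · exact Or.inl (h2.trans (hle k))
      · rcases hrich hk (not_le.1 h2) with h3 | h3
        · left; rwa [hu]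
        · right; rwa [hb]
  · exact hsh.rich hku hk

/-- No agent prefers a single good of the pool to her bundle. -/
lemma LocalOpt.v_le_own (h : I.LocalOpt σ) {g : Fin m} (hg : g ∈ pool σ) (i : Fin n) :
    I.v i g ≤ I.own σ i := by
  by_contra! hlt
  refine (h.drop i).single g (improves_of_drop h.valid ?_ ?_ ?_ (sizeOK_singleton g)
    (by simpa using hlt) ?_)
  · simpa using Or.inl (mem_pool.1 hg)
  · intro k hk _ p hp
    rw [mem_singleton] at hp
    exact hp ▸ h.not_sees hk hg
  · intro k _ e he
    rw [mem_singleton] at he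
    subst he
    simpa using acc_zero (I.own_nonneg σ k)
  · rintro ⟨e, he, hea⟩ -
    exact absurd (I.v_le_val i he) (not_le.2 (hlt.trans_le (hea ▸ I.v_le i g)))

lemma acc_of_not_sees {l : Fin n} {p : Fin m} (h : I.Contested σ l → ¬ I.Sees σ l p) :
    I.Acc (I.own σ l) (I.v l p) := by
  apply acc_v_of_le
  have := I.v_le l p
  by_cases hl : I.Low σ l
  · have := h hl.contested
    unfold Sees at this
    push Not at this
    exact this.1
  · unfold Low at hl
    linarith

lemma val_erase_pair {g h : Fin m} (hgh : g ≠ h) (k : Fin n) (e : Fin m)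
    (he : e ∈ ({h, g} : Finset (Fin m))) :
    I.val k (({h, g} : Finset (Fin m)).erase e) = I.v k g ∨
      I.val k (({h, g} : Finset (Fin m)).erase e) = I.v k h := by
  rw [mem_insert, mem_singleton] at he
  have := I.val_erase_add k (S := {h, g}) (g := e) (by simp [he])
  rw [I.val_pair k hgh.symm] at this
  rcases he with rfl | rfl
  · left; linarith
  · right; linarith

/-- If an agent has several goods, then a good of the pool together with the best of them is not
worth more than her bundle. -/
lemma LocalOpt.add_le_own (h : I.LocalOpt σ) {i : Fin n} (hi : 2 ≤ (bun σ i).card) :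
    ∃ t ∈ bun σ i, (∀ e ∈ bun σ i, I.v i e ≤ I.v i t) ∧ ∀ g ∈ pool σ,
      I.v i t + I.v i g ≤ I.own σ i ∧ 2 * (I.v i g - I.c) ≤ I.own σ i := by
  obtain ⟨t, ht, htop⟩ := Finset.exists_max_image (bun σ i) (I.v i) (card_pos.1 (by omega))
  refine ⟨t, ht, htop, fun g hg => ?_⟩
  have hgt : g ≠ t := by
    rintro rfl
    exact Finset.disjoint_left.1 (disjoint_bun_pool σ i) ht hg
  have hsub : ({t, g} : Finset (Fin m)) ⊆ pool σ ∪ bun σ i := by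
    intro e he
    rw [mem_insert, mem_singleton] at he
    rcases he with rfl | rfl
    · exact mem_union_right _ ht
    · exact mem_union_left _ hg
  have hseen : ∀ k, I.Contested σ k → k ≠ i → ∀ p ∈ ({t, g} : Finset (Fin m)),
      ¬ I.Sees σ k p := by
    intro k hk hki p hp hs
    rw [mem_insert, mem_singleton] at hp
    rcases hp with rfl | rfl
    · have := h.valid.seen k i hk hki.symm p ht hs
      omega
    · exact h.not_sees hk hg hs
  have hacc : ∀ k, k ≠ i → ∀ e ∈ ({t, g} : Finset (Fin m)),
      I.Acc (I.own σ k) (I.val k (({t, g} : Finset (Fin m)).erase e)) := by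
    intro k hki e he
    rcases val_erase_pair (I := I) hgt k e he with h1 | h1 <;> rw [h1]
    · exact acc_of_le (I.own_nonneg σ k) (h.v_le_own hg k)
    · obtain ⟨e', he', hne⟩ := Finset.exists_mem_ne (by omega : 1 < (bun σ i).card) t
      exact (h.valid.acc k i hki e' he').mono_right (I.v_le_val k (mem_erase.2 ⟨hne.symm, ht⟩))
  have hval : I.val i {t, g} = I.v i t + I.v i g := I.val_pair i hgt.symm
  have hsum : I.v i t + I.v i g ≤ I.own σ i := by
    by_contra! hlt
    refine (h.drop i).pair t g (improves_of_drop h.valid hsub hseen hacc (sizeOK_pair t g)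
      (by rwa [hval]) ?_)
    rintro ⟨e, he, hea⟩ -
    exact Or.inr ⟨t, by simp, le_antisymm (I.v_le i t) (hea ▸ htop e he)⟩
  refine ⟨hsum, ?_⟩
  by_contra! hcrit
  have hc := I.hc
  have hgt' : I.v i t < I.v i g := by
    by_contra! hle
    linarith
  rcases h.valid.size i with hsz | ⟨hN, hsz⟩
  · -- exactly two goods: the other one is worth at most `t`, hence less than `g`
    have hc1 : ((bun σ i).erase t).card = 1 := by rw [card_erase_of_mem ht]; omega
    obtain ⟨t', ht'⟩ := card_eq_one.1 hc1
    have h1 := I.val_erase_add i ht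
    rw [ht', val_singleton] at h1
    have h2 : t' ∈ bun σ i := mem_of_mem_erase (ht' ▸ mem_singleton_self t')
    have := htop t' h2
    have h3 : I.own σ i = I.val i (bun σ i) := rfl
    linarith
  · obtain ⟨hN1, hN2⟩ := hN.b_lt
    have ha := I.a_nonneg
    have hgo := h.v_le_own hg i
    rcases I.hv i t with h1 | h1 | h1
    · exact absurd (I.v_le i g) (not_le.2 (h1 ▸ hgt'))
    · have h2 : I.v i g = I.a := by
        rcases I.hv i g with h2 | h2 | h2 <;> linarith [I.hcb]
      -- now the number of rich agents goes up
      obtain ⟨hsh, hb⟩ := shift_dropAll I σ i hsub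
      set σ' := give (dropAll σ i) i {t, g} with hσ'
      have hu : I.own σ' i = I.a + I.b := by rw [own, hb, hval, h1, h2, add_comm]
      have hnr : ¬ I.Rich σ i := by
        rintro (hr | ⟨e, he, hea⟩)
        · linarith
        · have := htop e he
          linarith
      refine (h.drop i).pair t g ⟨hsh.valid h.valid (by rwa [hb]) ?_
        (by rw [hb]; exact sizeOK_pair t g)
        (hsh.seenSingle_of_unseen h.valid (by rwa [hb]) (Or.inr (by linarith))), ?_⟩
      · intro y hy
        have := hy.2.2 (by linarith)
        exact ⟨by linarith, fun h' => by linarith, fun _ => this⟩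
      · refine pot_lt_of_rich (fun k => ?_) (fun k hk => ?_) (by linarith) (j := i) hnr
          (Or.inr ⟨g, by rw [← hσ', hb]; simp, h2⟩)
        · by_cases hki : k = i
          · rw [hki, ← hσ', lev_eq (x := I.own σ' i) (by linarith)]; exact lev_le _
          · exact lev_mono (hsh.own_le hki)
        · by_cases hki : k = i
          · exact absurd (hki ▸ hk) hnr
          · exact hsh.rich hki hk
    · have h2 : I.b ≤ I.v i g := by
        rcases I.hv i g with h2 | h2 | h2 <;> linarith [I.hba]
      have h3 : I.own σ i ≤ (bun σ i).card * I.c :=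
        I.val_le_card_mul i (fun e he => h1 ▸ htop e he)
      linarith

/-- The level of a low agent rises when she gets a good that she sees. -/
lemma lev_lt_of_sees {j : Fin n} {p : Fin m} (hbc : I.a < 2 * (I.b - I.c)) (hl : I.Low σ j)
    (hs : I.Sees σ j p) (hc : I.c ≤ I.own σ j) : I.lev (I.own σ j) < I.lev (I.v j p) := by
  have h1 := hs.lt_of_low hl
  have ha := I.a_nonneg
  have hcb := I.hcb
  have hc0 := I.hc
  have hba := I.hba
  unfold Low at hl
  unfold lev
  rcases I.hv j p with h | h | h <;> rw [h] at h1 ⊢ <;> split_ifs <;> linarith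

/-- If an agent has a single good `t`, and a good of the pool has positive value to her, then some
other contested agent sees `t`: otherwise she could add the good of the pool to `t`. -/
lemma LocalOpt.contested_of_critical (h : I.LocalOpt σ) {i : Fin n} {t g : Fin m}
    (hi : bun σ i = {t}) (hg : g ∈ pool σ) (hv : 0 < I.v i g) :
    ∃ l, I.Contested σ l ∧ l ≠ i ∧ I.Sees σ l t := by
  by_contra! hno
  have ht : t ∈ bun σ i := by rw [hi]; simp
  have hgt : g ≠ t := by
    rintro rfl
    exact Finset.disjoint_left.1 (disjoint_bun_pool σ i) ht hg
  refine (h.drop i).pair t g (improves_of_drop h.valid ?_ ?_ ?_ (sizeOK_pair t g) ?_ ?_)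
  · intro e he
    rw [mem_insert, mem_singleton] at he
    rcases he with rfl | rfl
    · exact mem_union_right _ ht
    · exact mem_union_left _ hg
  · intro k hk hki p hp hs
    rw [mem_insert, mem_singleton] at hp
    rcases hp with rfl | rfl
    · exact hno k hk hki hs
    · exact h.not_sees hk hg hs
  · intro k hki e he
    rcases val_erase_pair (I := I) hgt k e he with h1 | h1 <;> rw [h1]
    · exact acc_of_le (I.own_nonneg σ k) (h.v_le_own hg k)
    · exact acc_of_not_sees fun hk => hno k hk hki
  · rw [I.val_pair i hgt.symm, own, hi, val_singleton]; linarith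
  · rintro ⟨e, he, hea⟩ -
    rw [hi, mem_singleton] at he
    exact Or.inr ⟨t, by simp, he ▸ hea⟩

/-- A good of the pool is not worth the same as the single good of an agent, unless both are
worthless: she could take it and leave her good to the contested agent who sees that good. -/
lemma LocalOpt.v_ne_of_critical (h : I.LocalOpt σ) {i : Fin n} {t g : Fin m}
    (hi : bun σ i = {t}) (hg : g ∈ pool σ) (hv : 0 < I.v i g) : I.v i g ≠ I.v i t := by
  intro heq
  obtain ⟨l, hl, hli, hs⟩ := h.contested_of_critical hi hg hv
  have ht : t ∈ bun σ i := by rw [hi]; simp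
  have hic : I.Contested σ i := hl.step ⟨t, ht, hs⟩
  have hown : I.own σ i = I.v i t := by rw [own, hi, val_singleton]
  have hlow : I.Low σ i := by
    by_contra hlow
    exact h.not_sees hic hg (Or.inr ⟨not_lt.1 hlow, by rw [hown, heq]⟩)
  obtain ⟨D, Y, hc, hY, hY'⟩ := h.chain l hl
  by_cases hiD : i ∈ D
  · -- `i` is low and therefore the start of the chain; its end can take `t`
    exact not_sees_of_chain h.valid hc hY (hc.bun_subset_pool hiD hlow ht) hs
  · -- the end of the chain takes `t`, and `i` takes `g`
    obtain ⟨hsh, hb⟩ := shift_chain_handOver h.valid hc hiD hi hs (Z := {g})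
      (by simpa using hc.pool_subset hg)
    refine (hY' i hli.symm).single g ?_
    set σ' := give (handOver Y i l) i {g}
    have hu : I.own σ' i = I.own σ i := by rw [hown, own, hb, val_singleton, heq]
    refine ⟨hsh.valid h.valid ?_ (fun y hy => hu.symm ▸ hy) ?_
      (hsh.seenSingle_of_unseen h.valid ?_ (Or.inl hu.ge)), ?_⟩
    · intro k _ e he
      rw [hb, mem_singleton] at he
      rw [hb, he]
      simpa using acc_zero (I.own_nonneg σ k)
    · rw [hb]; exact sizeOK_singleton g
    · intro k hk _ p hp
      rw [hb, mem_singleton] at hp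
      exact hp ▸ h.not_sees hk hg
    · obtain ⟨j, hj, hjl⟩ := hc.exists_start
      refine pot_lt_of_own (fun k => ?_) (fun k hk => ?_) (hsh.own_lt_of_low hj hjl)
      · by_cases hki : k = i
        · rw [hki, hu]
        · exact hsh.own_le hki
      · by_cases hki : k = i
        · subst hki
          rcases hk with hk | ⟨e, he, hea⟩
          · left; rwa [hu]
          · rw [hi, mem_singleton] at he
            exact Or.inr ⟨g, by rw [hb]; simp, by rw [heq, ← he, hea]⟩
        · exact hsh.rich hki hk

/-- It is an improvement if a contested agent `i` who owns exactly `a` trades it, at the end of a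
chain, for pool goods worth `2 a / 3`: her level stays the same, and the level of the low agent at
the start of the chain goes up. -/
lemma LocalOpt.not_trade (h : I.LocalOpt σ) (hbc : I.a < 2 * (I.b - I.c)) {i : Fin n}
    (hown : I.own σ i = I.a) {D : Finset (Fin n)} {Y : Alloc n m}
    (hc : Chain (I.Low σ) (I.SeesAgent σ) σ D i Y) {Z : Finset (Fin m)} (hZ : Z ⊆ pool σ)
    (hne : Z.Nonempty) (hZv : 2 * I.a ≤ 3 * I.val i Z) (hsize : I.SizeOK Z)
    (hacc : ∀ k, k ≠ i → ∀ g ∈ Z, I.Acc (I.own σ k) (I.val k (Z.erase g))) :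
    I.Improves σ (give Y i Z) := by
  have ha := I.a_nonneg
  obtain ⟨hsh, hb⟩ := shift_chain h.valid hc (hZ.trans hc.pool_subset)
  set σ' := give Y i Z
  have hu : I.own σ' i = I.val i Z := by rw [own, hb]
  refine ⟨hsh.valid h.valid (by rwa [hb]) (fun y hy => hy.of_le_a hown.le (by rwa [hu]))
    (by rwa [hb]) (hsh.seenSingle_of_unseen h.valid ?_ (Or.inr (by rwa [hu]))), ?_⟩
  · intro k hk _ p hp
    rw [hb] at hp
    exact h.not_sees hk (hZ hp)
  · obtain ⟨j, hj, hjl⟩ := hc.exists_start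
    have hji : j ≠ i := by
      rintro rfl
      unfold Low at hjl
      linarith
    refine pot_lt_of_lev (fun k => ?_) (j := j) ?_
    · by_cases hki : k = i
      · rw [hki, lev_eq (x := I.own σ' i) (by rwa [hu])]; exact lev_le _
      · exact lev_mono (hsh.own_le hki)
    · obtain ⟨p, -, hp, hs⟩ := hsh.own_single (mem_erase.2 ⟨hji, hj⟩)
      rw [hp]
      obtain ⟨g, hg⟩ := hne
      exact lev_lt_of_sees hbc hjl hs ((I.le_v j g).trans (h.v_le_own (hZ hg) j))

/-- If `b` exceeds `a / 2 + c`, an agent with a single good of value `a` values at most one good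
of the pool at `b`. -/
lemma LocalOpt.eq_of_eq_b (h : I.LocalOpt σ) (hbc : I.a < 2 * (I.b - I.c)) {i : Fin n}
    {t g g' : Fin m} (hi : bun σ i = {t}) (ht : I.v i t = I.a) (hg : g ∈ pool σ)
    (hg' : g' ∈ pool σ) (hgb : I.v i g = I.b) (hgb' : I.v i g' = I.b) : g' = g := by
  by_contra hne
  have ha := I.a_nonneg
  have hc := I.hc
  obtain ⟨l, hl, -, hs⟩ := h.contested_of_critical hi hg (by linarith)
  have hic : I.Contested σ i := hl.step ⟨t, by rw [hi]; simp, hs⟩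
  have hown : I.own σ i = I.a := by rw [own, hi, val_singleton, ht]
  obtain ⟨D, Y, hch, hY, -⟩ := h.chain i hic
  refine hY.pair g' g (h.not_trade hbc hown hch ?_ (by simp) ?_ (sizeOK_pair _ _) ?_)
  · intro e he
    rw [mem_insert, mem_singleton] at he
    rcases he with rfl | rfl <;> assumption
  · rw [I.val_pair i hne]; linarith
  · intro k _ e he
    rcases val_erase_pair (I := I) (Ne.symm hne) k e he with h1 | h1 <;> rw [h1]
    · exact acc_of_le (I.own_nonneg σ k) (h.v_le_own hg k)
    · exact acc_of_le (I.own_nonneg σ k) (h.v_le_own hg' k)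

/-- The situation of an agent `i` to whom a good of the pool cannot be added safely, in a local
optimum of the first phase. -/
structure Critical (I : Inst n m) (σ : Alloc n m) (i : Fin n) : Prop where
  b_lt : 3 * I.b < 2 * I.a
  lt_b : I.a < 2 * (I.b - I.c)
  own_eq : I.own σ i = I.a
  card : (bun σ i).card = 1
  pool_lt : ∀ g ∈ pool σ, I.v i g < I.a
  pool_val : 3 * I.val i (pool σ) < 2 * I.a
  other : ∀ k, k ≠ i → 2 ≤ (bun σ k).card → ∀ p ∈ bun σ k, I.v i p < I.a

lemma val_le_of_le_c {i : Fin n} {g : Fin m} {S : Finset (Fin m)} (hg : g ∈ S)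
    (hS : ∀ e ∈ S, e ≠ g → I.v i e ≤ I.c) :
    I.val i S ≤ I.v i g + ((S.card : ℝ) - 1) * I.c := by
  rw [← I.val_erase_add i hg]
  have h1 := I.val_le_card_mul i (S := S.erase g) (w := I.c)
    (fun e he => hS e (mem_of_mem_erase he) (ne_of_mem_erase he))
  rw [card_erase_of_mem hg, Nat.cast_sub (card_pos.2 ⟨g, hg⟩), Nat.cast_one] at h1
  linarith

lemma le_val_of_mem {i : Fin n} {g : Fin m} {S : Finset (Fin m)} (hg : g ∈ S) :
    I.v i g + ((S.card : ℝ) - 1) * I.c ≤ I.val i S := by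
  rw [← I.val_erase_add i hg]
  have h1 := Finset.card_nsmul_le_sum (S.erase g) (I.v i) I.c (fun e _ => I.le_v i e)
  rw [card_erase_of_mem hg, nsmul_eq_mul, Nat.cast_sub (card_pos.2 ⟨g, hg⟩), Nat.cast_one] at h1
  unfold val
  linarith

/-- Sets of at most `s + 1` pool goods, where `b + s c < 2 a / 3`, are acceptable to everyone.
Otherwise take one of minimal size: the agent who objects to it can take such a set herself. -/
lemma LocalOpt.acc_of_card_le (h : I.LocalOpt σ) (hN : I.Narrow) {s : ℕ}
    (hs : 3 * (I.b + s * I.c) < 2 * I.a) (N : ℕ) :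
    ∀ Z ⊆ pool σ, Z.card = N → Z.card ≤ s + 1 → ∀ l, I.Acc (I.own σ l) (I.val l Z) := by
  obtain ⟨-, hbc⟩ := hN.b_lt
  have ha := I.a_nonneg
  have hc := I.hc
  induction N using Nat.strong_induction_on with
  | _ N ih =>
  intro Z hZ hN' hcard l
  by_contra hover
  obtain ⟨Z', hZ', hcard', hval', hno⟩ := (h.drop l).set Z hZ
  rw [← hval'] at hover
  rw [← hcard'] at hcard hN'
  have hgain : I.own σ l < I.val l Z' := by
    by_contra! hle
    exact hover (acc_of_le (I.own_nonneg σ l) hle)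
  have hcast : (Z'.card : ℝ) ≤ s + 1 := by exact_mod_cast hcard
  refine hno (improves_of_drop h.valid (hZ'.trans subset_union_left)
    (fun k hk _ p hp => h.not_sees hk (hZ' hp)) (fun k _ e he => ?_) (Or.inr ⟨hN, ?_⟩) hgain ?_)
  · have hlt : (Z'.erase e).card < Z'.card := card_erase_lt_of_mem he
    exact ih _ (hN' ▸ hlt) _ ((erase_subset _ _).trans hZ') rfl (by omega) k
  · have : ((Z'.card : ℝ) - 1) * I.c ≤ s * I.c := by gcongr; linarith
    linarith
  · rintro ⟨e, he, hea⟩ hlt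
    -- otherwise `l` gives up a good of value `a` for goods of value `b` and `c`; the former are few
    by_contra! hpoor
    obtain ⟨hpoor1, hpoor2⟩ := hpoor
    have hae : I.a ≤ I.own σ l := hea ▸ I.v_le_val l he
    have hcard1 : 1 ≤ (bun σ l).card := card_pos.2 ⟨e, he⟩
    by_cases hb : ∃ p ∈ Z', I.v l p = I.b
    · obtain ⟨p, hp, hpb⟩ := hb
      rcases hcard1.eq_or_lt with h1 | h1
      · -- `Z'` is worth at most `b + s c`
        obtain ⟨e', he'⟩ := card_eq_one.1 h1.symm
        have hee : e = e' := by simpa [he'] using he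
        subst hee
        have h2 := val_le_of_le_c (I := I) (i := l) hp (fun q hq hqp => by
          rcases I.hv l q with h2 | h2 | h2
          · exact absurd h2 (hpoor2 q hq)
          · exact absurd (h.eq_of_eq_b hbc he' hea (hZ' hp) (hZ' hq) hpb h2) hqp
          · exact h2.le)
        have h3 : ((Z'.card : ℝ) - 1) * I.c ≤ s * I.c := by gcongr; linarith
        linarith
      · -- `l` owns at least `a + b`, so that `Z'` is acceptable to her
        obtain ⟨t, -, ht2, ht3⟩ := h.add_le_own h1
        have h2 := ht2 e he
        have h3 := (ht3 p (hZ' hp)).1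
        exact hover ⟨by linarith, fun h' => by linarith, fun _ => by linarith⟩
    · push Not at hb
      have h1 := I.val_le_card_mul l (S := Z') (w := I.c) (fun q hq => by
        rcases I.hv l q with h2 | h2 | h2
        · exact absurd h2 (hpoor2 q hq)
        · exact absurd h2 (hb q hq)
        · exact h2.le)
      have h2 : (Z'.card : ℝ) * I.c ≤ (s + 1) * I.c := by gcongr
      linarith

/-- In a local optimum of the first phase, an agent is critical as soon as adding some good of the
pool to an unenvied bundle might violate `2/3`-EFX for her. -/
theorem LocalOpt.critical (h : I.LocalOpt σ) {i : Fin n} {g : Fin m} (hg : g ∈ pool σ)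
    (hcrit : I.own σ i < 2 * (I.v i g - I.c)) : I.Critical σ i := by
  have ha := I.a_nonneg
  have hc := I.hc
  have hown0 := I.own_nonneg σ i
  have hgo := h.v_le_own hg i
  have hcard : (bun σ i).card = 1 := by
    by_contra hne
    rcases Nat.lt_or_ge (bun σ i).card 2 with h1 | h1
    · have h2 : bun σ i = ∅ := card_eq_zero.1 (by omega)
      rw [own, h2, val_empty] at hgo hcrit
      linarith
    · obtain ⟨t, -, -, ht⟩ := h.add_le_own h1
      linarith [(ht g hg).2]
  obtain ⟨t, hi⟩ := card_eq_one.1 hcard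
  have hown : I.own σ i = I.v i t := by rw [own, hi, val_singleton]
  have hv : 0 < I.v i g := by linarith
  obtain ⟨l, hl, -, hs⟩ := h.contested_of_critical hi hg hv
  have hic : I.Contested σ i := hl.step ⟨t, by rw [hi]; simp, hs⟩
  have hne := h.v_ne_of_critical hi hg hv
  have hlt : I.v i g < I.v i t := lt_of_le_of_ne (hown ▸ hgo) hne
  have hta := I.v_le i t
  have hgb : I.v i g = I.b := by
    rcases I.hv i g with h1 | h1 | h1
    · linarith
    · exact h1
    · linarith
  have hta : I.v i t = I.a := by
    rcases I.hv i t with h1 | h1 | h1 <;> linarith [I.hcb]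
  have hbc : I.a < 2 * (I.b - I.c) := by rw [← hgb, ← hta, ← hown]; exact hcrit
  have hpool : ∀ g' ∈ pool σ, I.v i g' < I.a := by
    intro g' hg'
    refine lt_of_le_of_ne (I.v_le i g') fun h1 => ?_
    exact h.v_ne_of_critical hi hg' (by linarith) (h1.trans hta.symm)
  rw [hta] at hown
  obtain ⟨D, Y, hch, hY, -⟩ := h.chain i hic
  -- otherwise `i` can trade her good for `g` alone
  have hb2 : 3 * I.b < 2 * I.a := by
    by_contra! hb2
    refine hY.single g (h.not_trade hbc hown hch (by simpa using mem_pool.1 hg) (by simp) ?_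
      (sizeOK_singleton g) ?_)
    · rw [val_singleton, hgb]; exact hb2
    · intro k _ e he
      rw [mem_singleton] at he
      subst he
      simpa using acc_zero (I.own_nonneg σ k)
  have hN : I.Narrow := ⟨i, g, by rw [hgb]; exact ⟨hb2, hbc⟩⟩
  refine ⟨hb2, hbc, hown, hcard, hpool, ?_, ?_⟩
  · -- otherwise `i` can trade her good for a minimal set of pool goods worth `2 a / 3`
    by_contra! hbig
    have hrest : ∀ g' ∈ pool σ, g' ≠ g → I.v i g' ≤ I.c := by
      intro g' hg' hgg
      rcases I.hv i g' with h1 | h1 | h1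
      · exact absurd h1 (hpool g' hg').ne
      · exact absurd (h.eq_of_eq_b hbc hi hta hg hg' hgb h1) hgg
      · exact h1.le
    have hcard1 : 1 ≤ (pool σ).card := card_pos.2 ⟨g, hg⟩
    have hex : ∃ s : ℕ, 2 * I.a ≤ 3 * (I.b + s * I.c) := by
      refine ⟨(pool σ).card - 1, ?_⟩
      have := val_le_of_le_c (I := I) hg hrest
      rw [hgb] at this
      rw [Nat.cast_sub hcard1, Nat.cast_one]
      linarith
    classical
    -- `s + 1` is the least number of pool goods that are worth `2 a / 3`
    obtain ⟨s, hs1, hs2⟩ : ∃ s : ℕ, 2 * I.a ≤ 3 * (I.b + (s + 1) * I.c) ∧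
        3 * (I.b + s * I.c) < 2 * I.a := by
      have h1 := Nat.find_spec hex
      have h2 : Nat.find hex ≠ 0 := by
        intro h0
        rw [h0, Nat.cast_zero] at h1
        linarith
      obtain ⟨s, hs⟩ := Nat.exists_eq_succ_of_ne_zero h2
      refine ⟨s, by rw [hs] at h1; exact_mod_cast h1, ?_⟩
      exact not_le.1 (Nat.find_min hex (by omega))
    have hsP : s + 2 ≤ (pool σ).card := by
      by_contra! hlt'
      have h1 := val_le_of_le_c (I := I) hg hrest
      have h2 : ((pool σ).card : ℝ) ≤ s + 1 := by exact_mod_cast (by omega : _ ≤ s + 1)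
      have h3 : (((pool σ).card : ℝ) - 1) * I.c ≤ s * I.c := by gcongr; linarith
      linarith
    obtain ⟨Z, hgZ, hZP, hZc⟩ := Finset.exists_subsuperset_card_eq (s := {g}) (t := pool σ)
      (n := s + 2) (by simpa using mem_pool.1 hg) (by simp) hsP
    obtain ⟨Z', hZ', hcard', hval', hno⟩ := hY.set Z hZP
    have hZ'c : (Z'.card : ℝ) = s + 2 := by rw [hcard', hZc]; push_cast; ring
    refine hno (h.not_trade hbc hown hch hZ' (card_pos.1 (by omega)) ?_ (Or.inr ⟨hN, ?_⟩) ?_)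
    · have h1 := le_val_of_mem (I := I) (i := i) (singleton_subset_iff.1 hgZ)
      rw [hgb, ← hcard', hZ'c] at h1
      rw [hval']
      linarith
    · rw [hZ'c]
      linarith
    · intro k _ e he
      have h1 : (Z'.erase e).card = s + 1 := by rw [card_erase_of_mem he]; omega
      exact h.acc_of_card_le hN hs2 (s + 1) _ ((erase_subset _ _).trans hZ') h1 h1.le k
  · -- a contested agent sees goods of single-good bundles only
    intro k hki hk p hp
    refine lt_of_le_of_ne (I.v_le i p) fun h1 => ?_
    have := h.valid.seen i k hic hki p hp (Or.inr ⟨by rw [hown]; linarith, by rw [hown, h1]⟩)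
    omega

end Inst

/-! ### The second phase -/

/-- Agent `i` returns her goods of `P` to the pool. -/
def shed (σ : Alloc n m) (P : Finset (Fin m)) (i : Fin n) : Alloc n m :=
  fun g => if σ g = some i ∧ g ∈ P then none else σ g

lemma bun_shed_self (σ : Alloc n m) (P : Finset (Fin m)) (i : Fin n) :
    bun (shed σ P i) i = bun σ i \ P := by
  ext g
  simp only [mem_bun, shed, mem_sdiff]
  split_ifs with h <;> simp_all

lemma bun_shed_of_ne (σ : Alloc n m) (P : Finset (Fin m)) {i k : Fin n} (h : k ≠ i) :
    bun (shed σ P i) k = bun σ k := by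
  ext g
  simp only [mem_bun, shed]
  split_ifs with h'
  · simp [h'.1, h.symm]
  · rfl

lemma pool_subset_pool_shed (σ : Alloc n m) (P : Finset (Fin m)) (i : Fin n) :
    pool σ ⊆ pool (shed σ P i) := by
  intro g hg
  simp_all [shed]

lemma pool_shed_subset (σ : Alloc n m) (P : Finset (Fin m)) (i : Fin n) :
    pool (shed σ P i) ⊆ pool σ ∪ P := by
  intro g hg
  simp only [mem_pool, shed, mem_union] at hg ⊢
  split_ifs at hg with h
  · exact Or.inr h.2
  · exact Or.inl hg

namespace Inst

/-- `σ` is `2/3`-EFX, without being complete. -/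
def EFX (I : Inst n m) (σ : Alloc n m) : Prop :=
  ∀ i k, i ≠ k → ∀ g ∈ bun σ k, 2 * I.val i ((bun σ k).erase g) ≤ 3 * I.own σ i

/-- Agent `l` finds the bundle of `i` at least as good as her own. -/
def WeakEnvy (I : Inst n m) (σ : Alloc n m) (l i : Fin n) : Prop :=
  I.own σ l ≤ I.val l (bun σ i)

/-- The allocation `σ'` is `2/3`-EFX and Pareto dominates `σ`. -/
def Better (I : Inst n m) (σ σ' : Alloc n m) : Prop :=
  I.EFX σ' ∧ (∀ k, I.own σ k ≤ I.own σ' k) ∧ ∑ k, I.own σ k < ∑ k, I.own σ' k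

/-- The invariant of the second phase, which begins with `σ₀`: apart from goods of the initial
pool the bundles are bundles of `σ₀`, and no agent has lost. -/
structure Descends (I : Inst n m) (σ₀ σ : Alloc n m) : Prop where
  core : ∀ k, ∃ k₀, bun σ k \ pool σ₀ = bun σ₀ k₀
  le : ∀ k, I.own σ₀ k ≤ I.own σ k
  pool : pool σ ⊆ pool σ₀

/-- The local optima of the second phase: no pool good can be added to a bundle, no agent profits
from exchanging her goods of the initial pool for a pool good, and no cyclic exchange along weak
envy is profitable. -/
structure ExchangeOpt (I : Inst n m) (σ₀ σ : Alloc n m) : Prop where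
  add : ∀ s, ∀ g ∈ _root_.pool σ, ¬ I.EFX (give σ s {g})
  swap : ∀ i, ∀ g ∈ _root_.pool σ,
    ¬ I.Better σ (give (shed σ (_root_.pool σ₀) i) i {g})
  cycle : ∀ s k, ReflTransGen (I.WeakEnvy σ) s k → ∃ D Y,
    Chain (· = s) (I.WeakEnvy σ) σ D k Y ∧ ¬ I.Better σ (give Y k (bun σ s))

end Inst

lemma Chain.pool_eq {E : Fin n → Fin n → Prop} {σ Y : Alloc n m} {D : Finset (Fin n)}
    {s u : Fin n} (h : Chain (· = s) E σ D u Y) : pool Y = pool σ ∪ bun σ s := by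
  induction h with
  | start j h => rw [pool_dropAll, h]
  | step i h hE hi hs ih => rw [pool_handOver, ih]

/-- The bundles after a cyclic exchange. -/
lemma Chain.bun_close {E : Fin n → Fin n → Prop} {σ Y : Alloc n m} {D : Finset (Fin n)}
    {s u : Fin n} (h : Chain (· = s) E σ D u Y) :
    bun (give Y u (bun σ s)) u = bun σ s ∧
    (∀ k, k ≠ u → bun (give Y u (bun σ s)) k = bun σ k ∨
      ∃ i, E k i ∧ bun (give Y u (bun σ s)) k = bun σ i) := by
  have hsub : bun σ s ⊆ pool Y := by rw [h.pool_eq]; exact subset_union_right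
  refine ⟨by rw [bun_give_self, h.bun_end, empty_union], fun k hk => ?_⟩
  rw [bun_give_of_subset_pool _ hk hsub]
  by_cases hD : k ∈ D
  · obtain ⟨i, -, -, hE, hb⟩ := h.exists_bun_eq hD hk
    exact Or.inr ⟨i, hE, hb⟩
  · exact Or.inl (h.bun_of_notMem hD)

namespace Inst

variable {I : Inst n m} {σ₀ σ : Alloc n m}

lemma Valid.efx (h : I.Valid σ) : I.EFX σ := fun i k hik g hg => (h.acc i k hik g hg).1

lemma Descends.refl (I : Inst n m) (σ : Alloc n m) : I.Descends σ σ :=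
  ⟨fun k => ⟨k, sdiff_eq_self_of_disjoint (disjoint_bun_pool σ k)⟩, fun _ => le_rfl, subset_rfl⟩

lemma own_le_give (s : Fin n) {g : Fin m} (hg : g ∈ pool σ) (k : Fin n) :
    I.own σ k ≤ I.own (give σ s {g}) k := by
  by_cases hks : k = s
  · rw [hks, own, own, bun_give_self]; exact I.val_mono s subset_union_left
  · rw [own, own, bun_give_of_subset_pool _ hks (by simpa using mem_pool.1 hg)]

lemma Descends.add (h : I.Descends σ₀ σ) (s : Fin n) {g : Fin m} (hg : g ∈ _root_.pool σ) :
    I.Descends σ₀ (give σ s {g}) := by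
  refine ⟨fun k => ?_, fun k => (h.le k).trans (own_le_give s hg k), ?_⟩
  · by_cases hks : k = s
    · obtain ⟨k₀, hk⟩ := h.core s
      refine ⟨k₀, ?_⟩
      rw [hks, bun_give_self, union_sdiff_distrib, hk,
        sdiff_eq_empty_iff_subset.2 (singleton_subset_iff.2 (h.pool hg)), union_empty]
    · rw [bun_give_of_subset_pool _ hks (by simpa using mem_pool.1 hg)]
      exact h.core k
  · rw [pool_give]; exact sdiff_subset.trans h.pool

lemma Descends.swap (h : I.Descends σ₀ σ) (i : Fin n) {g : Fin m} (hg : g ∈ _root_.pool σ)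
    (hle : ∀ k, I.own σ k ≤ I.own (give (shed σ (_root_.pool σ₀) i) i {g}) k) :
    I.Descends σ₀ (give (shed σ (_root_.pool σ₀) i) i {g}) := by
  have hg' : {g} ⊆ _root_.pool (shed σ (_root_.pool σ₀) i) :=
    singleton_subset_iff.2 (pool_subset_pool_shed _ _ _ hg)
  refine ⟨fun k => ?_, fun k => (h.le k).trans (hle k), ?_⟩
  · by_cases hki : k = i
    · obtain ⟨k₀, hk⟩ := h.core i
      refine ⟨k₀, ?_⟩
      rw [hki, bun_give_self, union_sdiff_distrib, bun_shed_self, Finset.sdiff_idem, hk,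
        sdiff_eq_empty_iff_subset.2 (singleton_subset_iff.2 (h.pool hg)), union_empty]
    · rw [bun_give_of_subset_pool _ hki hg', bun_shed_of_ne _ _ hki]
      exact h.core k
  · rw [pool_give]
    exact sdiff_subset.trans ((pool_shed_subset _ _ _).trans (union_subset h.pool subset_rfl))

lemma Descends.cycle (h : I.Descends σ₀ σ) {E : Fin n → Fin n → Prop} {Y : Alloc n m}
    {D : Finset (Fin n)} {s u : Fin n} (hc : Chain (· = s) E σ D u Y)
    (hle : ∀ k, I.own σ k ≤ I.own (give Y u (bun σ s)) k) :
    I.Descends σ₀ (give Y u (bun σ s)) := by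
  obtain ⟨h1, h2⟩ := hc.bun_close
  refine ⟨fun k => ?_, fun k => (h.le k).trans (hle k), ?_⟩
  · by_cases hku : k = u
    · rw [hku, h1]; exact h.core s
    · rcases h2 k hku with h2 | ⟨i, -, h2⟩ <;> rw [h2] <;> apply h.core
  · rw [pool_give, hc.pool_eq]
    intro g hg
    rw [mem_sdiff, mem_union] at hg
    exact h.pool (hg.1.resolve_right hg.2)

/-- In a local optimum, an agent is not envied if every agent with a weak envy path to her can be
reached by such a path from her. -/
lemma ExchangeOpt.unenvied (h : I.ExchangeOpt σ₀ σ) (hσ : I.EFX σ) {s : Fin n}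
    (hs : ∀ k, ReflTransGen (I.WeakEnvy σ) k s → ReflTransGen (I.WeakEnvy σ) s k) (k : Fin n) :
    I.val k (bun σ s) ≤ I.own σ k := by
  by_contra! hlt
  obtain ⟨D, Y, hc, hno⟩ := h.cycle s k (hs k (.single hlt.le))
  obtain ⟨h1, h2⟩ := hc.bun_close
  set σ' := give Y k (bun σ s)
  have hk : I.own σ k < I.own σ' k := by rw [own, own, h1]; exact hlt
  have hle : ∀ l, I.own σ l ≤ I.own σ' l := fun l => by
    by_cases hlk : l = k
    · rw [hlk]; exact hk.le
    · rcases h2 l hlk with h2 | ⟨i, hE, h2⟩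
      · rw [own, own, h2]
      · rw [own.eq_def (σ := σ'), h2]; exact hE
  have hbun : ∀ l, ∃ l', bun σ' l = bun σ l' := fun l => by
    by_cases hlk : l = k
    · exact ⟨s, by rw [hlk, h1]⟩
    · rcases h2 l hlk with h2 | ⟨i, -, h2⟩ <;> exact ⟨_, h2⟩
  refine hno ⟨fun i j _ g hg => ?_, hle, sum_lt_sum (fun l _ => hle l) ⟨k, mem_univ _, hk⟩⟩
  obtain ⟨l', hl'⟩ := hbun j
  rw [hl'] at hg ⊢
  have h3 := hle i
  by_cases hil : i = l'
  · subst hil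
    have := I.val_mono i (erase_subset g (bun σ i))
    have := I.own_nonneg σ i
    have h4 : I.own σ i = I.val i (bun σ i) := rfl
    linarith
  · linarith [hσ i l' hil g hg]

/-- The agents that obstruct adding `g` to an unenvied bundle are critical. -/
lemma exists_critical (hopt : I.LocalOpt σ₀) (hd : I.Descends σ₀ σ) (h : I.ExchangeOpt σ₀ σ)
    (hσ : I.EFX σ) {s : Fin n} (hs : ∀ k, I.val k (bun σ s) ≤ I.own σ k) {g : Fin m}
    (hg : g ∈ pool σ) : ∃ i, i ≠ s ∧ I.Critical σ₀ i ∧ I.own σ i < 2 * (I.v i g - I.c) ∧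
      ∃ e ∈ insert g (bun σ s), 3 * I.own σ i < 2 * I.val i ((insert g (bun σ s)).erase e) := by
  have hno := h.add s g hg
  unfold EFX at hno
  push Not at hno
  obtain ⟨i, k, hik, e, he, hlt⟩ := hno
  have h1 := own_le_give (I := I) s hg i
  have hks : k = s := by
    by_contra hks
    rw [bun_give_of_subset_pool _ hks (by simpa using mem_pool.1 hg)] at he hlt
    linarith [hσ i k hik e he]
  subst hks
  rw [bun_give_self, union_comm, singleton_union] at he hlt
  have hgs : g ∉ bun σ k := fun h' => disjoint_left.1 (disjoint_bun_pool σ k) h' hg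
  have h2 := I.val_erase_add i he
  rw [I.val_insert i hgs] at h2
  have h3 := I.le_v i e
  have h4 := hs i
  have h5 : I.own σ i < 2 * (I.v i g - I.c) := by linarith
  exact ⟨i, hik, hopt.critical (hd.pool hg) ((hd.le i).trans_lt h5), h5, e, he, by linarith⟩

/-- The value of the part of a bundle outside the initial pool for a critical agent, when there
is no good of value `a` in it and the agent has no more than `2 (b - c)`. -/
lemma Critical.val_core_le (hopt : I.LocalOpt σ₀) (hd : I.Descends σ₀ σ) {i k : Fin n}
    (hc : I.Critical σ₀ i) (hlt : I.val i (bun σ k) < 2 * (I.b - I.c))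
    (hno : ∀ p ∈ bun σ k, I.v i p ≠ I.a) :
    I.val i (bun σ k \ pool σ₀) ≤ I.b + I.a / 6 := by
  obtain ⟨k₀, hk₀⟩ := hd.core k
  have h1 := hc.b_lt
  have h2 := hc.lt_b
  have ha := I.a_nonneg
  have hc0 := I.hc
  set C := bun σ k \ pool σ₀ with hC
  rcases C.eq_empty_or_nonempty with h0 | h0
  · rw [h0, val_empty]; linarith [I.hcb]
  obtain ⟨t, ht, htop⟩ := Finset.exists_max_image C (I.v i) h0
  have htb : I.v i t ≤ I.b := by
    rcases I.hv i t with h | h | h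
    · exact absurd h (hno t (sdiff_subset ht))
    · exact h.le
    · linarith [I.hcb]
  have h3 := val_le_of_le_c (I := I) ht (fun e he het => by
    rcases I.hv i e with h | h | h
    · exact absurd h (hno e (sdiff_subset he))
    · exfalso
      have h4 : I.val i {e, t} ≤ I.val i (bun σ k) := I.val_mono i (by
        intro q hq
        rw [mem_insert, mem_singleton] at hq
        rcases hq with rfl | rfl
        · exact sdiff_subset he
        · exact sdiff_subset ht)
      rw [I.val_pair i het] at h4
      have := htop e he
      linarith
    · exact h.le)
  have h5 : ((C.card : ℝ) - 1) * I.c ≤ I.a / 6 := by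
    have hsz := hopt.valid.size k₀
    rw [← hk₀] at hsz
    rcases hsz with hsz | ⟨-, hsz⟩
    · have : (C.card : ℝ) ≤ 2 := by exact_mod_cast hsz
      have : ((C.card : ℝ) - 1) * I.c ≤ 1 * I.c := by gcongr; linarith
      linarith
    · linarith
  linarith

/-- A bundle that contains a good of value `a` for a critical agent consists of this good and of
goods of the initial pool. -/
lemma Critical.core_eq (hd : I.Descends σ₀ σ) {i k : Fin n} (hc : I.Critical σ₀ i) {p : Fin m}
    (hp : p ∈ bun σ k) (hpa : I.v i p = I.a) : bun σ k \ pool σ₀ = {p} := by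
  obtain ⟨k₀, hk₀⟩ := hd.core k
  have hpC : p ∈ bun σ k \ pool σ₀ :=
    mem_sdiff.2 ⟨hp, fun h => (hc.pool_lt p h).ne hpa⟩
  have hcard : (bun σ₀ k₀).card ≤ 1 := by
    by_cases hk : k₀ = i
    · rw [hk, hc.card]
    · by_contra! hlt
      exact (hc.other k₀ hk hlt p (hk₀ ▸ hpC)).ne hpa
  rw [hk₀] at hpC ⊢
  exact (eq_of_subset_of_card_le (singleton_subset_iff.2 hpC) (by simpa using hcard)).symm

/-- A relation has a minimal strongly connected class. -/
lemma exists_minimal_class (hn : 0 < n) (E : Fin n → Fin n → Prop) :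
    ∃ s, ∀ k, ReflTransGen E k s → ReflTransGen E s k := by
  classical
  obtain ⟨s, -, hs⟩ := Finset.exists_min_image (univ : Finset (Fin n))
    (fun s => (univ.filter fun k => ReflTransGen E k s).card) ⟨⟨0, hn⟩, mem_univ _⟩
  refine ⟨s, fun k hk => ?_⟩
  have hsub : (univ.filter fun l => ReflTransGen E l k) ⊆
      univ.filter fun l => ReflTransGen E l s := by
    intro l hl
    simp only [mem_filter, mem_univ, true_and] at hl ⊢
    exact hl.trans hk
  have := eq_of_subset_of_card_le hsub (hs k (mem_univ _))
  have h2 : s ∈ univ.filter fun l => ReflTransGen E l s := by simpa using ReflTransGen.refl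
  rw [← this] at h2
  simpa using h2

/-- A local optimum of the second phase is complete. -/
theorem ExchangeOpt.pool_eq_empty (h : I.ExchangeOpt σ₀ σ) (hn : 0 < n) (hopt : I.LocalOpt σ₀)
    (hd : I.Descends σ₀ σ) (hσ : I.EFX σ) : pool σ = ∅ := by
  by_contra hne
  obtain ⟨g, hg⟩ := nonempty_iff_ne_empty.2 hne
  obtain ⟨s, hs⟩ := exists_minimal_class hn (I.WeakEnvy σ)
  have hun := h.unenvied hσ hs
  obtain ⟨i, his, hc, hlt, e, he, hviol⟩ := exists_critical hopt hd h hσ hun hg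
  have hg0 := hd.pool hg
  have ha := I.a_nonneg
  have hc0 := I.hc
  have h1 := hc.b_lt
  have h2 := hc.lt_b
  have hai : I.a ≤ I.own σ i := hc.own_eq ▸ hd.le i
  have hgb : I.v i g = I.b := by
    rcases I.hv i g with h3 | h3 | h3
    · exact absurd h3 (hc.pool_lt g hg0).ne
    · exact h3
    · linarith
  rw [hgb] at hlt
  have hsplit : ∀ k l, I.val l (bun σ k) =
      I.val l (bun σ k \ pool σ₀) + I.val l (bun σ k ∩ pool σ₀) := fun k l => by
    rw [← I.val_union l (disjoint_sdiff_inter _ _), sdiff_union_inter]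
  -- the goods of the initial pool in a bundle are worth less than `2 a / 3 - b`
  have hdust : ∀ k, 3 * (I.b + I.val i (bun σ k ∩ pool σ₀)) < 2 * I.a := fun k => by
    have hgk : g ∉ bun σ k ∩ pool σ₀ := fun h' =>
      disjoint_left.1 (disjoint_bun_pool σ k) (mem_inter.1 h').1 hg
    have h3 := I.val_mono i (insert_subset hg0 (inter_subset_right (s₁ := bun σ k) (s₂ := pool σ₀)))
    rw [I.val_insert i hgk, hgb] at h3
    linarith [hc.pool_val]
  have hgs : g ∉ bun σ s := fun h' => disjoint_left.1 (disjoint_bun_pool σ s) h' hg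
  by_cases hsa : ∃ p ∈ bun σ s, I.v i p = I.a
  swap
  · -- the bundle of `s` is worth so little to `i` that `g` can be added
    push Not at hsa
    have h3 := hc.val_core_le hopt hd ((hun i).trans_lt hlt) hsa
    have h4 := I.val_mono i (erase_subset e (insert g (bun σ s)))
    rw [I.val_insert i hgs, hgb, hsplit s i] at h4
    linarith [hdust s]
  obtain ⟨p, hp, hpa⟩ := hsa
  have hcore := hc.core_eq hd hp hpa
  by_cases hia : ∃ q ∈ bun σ i, I.v i q = I.a
  swap
  · -- `i` owns less than `a`, which is impossible
    push Not at hia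
    have h3 := hc.val_core_le hopt hd hlt hia
    have h4 : I.own σ i = I.val i (bun σ i) := rfl
    rw [hsplit i i] at h4
    linarith [hdust i]
  obtain ⟨q, hq, hqa⟩ := hia
  have hcorei := hc.core_eq hd hq hqa
  have hgq : g ≠ q := fun e' => disjoint_left.1 (disjoint_bun_pool σ i) (e' ▸ hq) hg
  have hgi : ∀ k, I.v k g ≤ I.own σ k := fun k => (hopt.v_le_own hg0 k).trans (hd.le k)
  have hpair : ∀ k, I.v k q ≤ 3 / 2 * I.own σ k → ∀ e' ∈ ({q, g} : Finset (Fin m)),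
      2 * I.val k (({q, g} : Finset (Fin m)).erase e') ≤ 3 * I.own σ k := fun k hk e' he' => by
    have := I.own_nonneg σ k
    rcases val_erase_pair (I := I) hgq k e' he' with h3 | h3 <;> rw [h3]
    · linarith [hgi k]
    · linarith
  by_cases hbi : bun σ i = {q}
  · -- `i` holds a single good; she is in the class of `s`, and `g` can be added to her bundle
    have hown : I.own σ i = I.a := by rw [own, hbi, val_singleton, hqa]
    have hweak : I.WeakEnvy σ i s := by
      rw [WeakEnvy, hown, ← hpa]; exact I.v_le_val i hp
    have hcls : ∀ k, ReflTransGen (I.WeakEnvy σ) k i → ReflTransGen (I.WeakEnvy σ) i k :=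
      fun k hk => .head hweak (hs k (hk.tail hweak))
    have huni := h.unenvied hσ hcls
    refine h.add i g hg fun k l hkl e' he' => ?_
    have h3 := own_le_give (I := I) i hg k
    by_cases hli : l = i
    · subst hli
      rw [bun_give_self, hbi] at he' ⊢
      have h4 := huni k
      rw [hbi, val_singleton] at h4
      have := hpair k (by linarith [I.own_nonneg σ k]) e' he'
      exact this.trans (by linarith)
    · rw [bun_give_of_subset_pool _ hli (by simpa using mem_pool.1 hg)] at he' ⊢
      linarith [hσ k l hkl e' he']
  · -- `i` exchanges the rest of her bundle for `g`
    obtain ⟨d, hd', hdq⟩ : ∃ d ∈ bun σ i, d ≠ q := by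
      by_contra! hall
      exact hbi (eq_singleton_iff_unique_mem.2 ⟨hq, hall⟩)
    set σ' := give (shed σ (pool σ₀) i) i {g}
    have hg' : {g} ⊆ pool (shed σ (pool σ₀) i) :=
      singleton_subset_iff.2 (pool_subset_pool_shed _ _ _ hg)
    have hb1 : bun σ' i = {q, g} := by
      rw [bun_give_self, bun_shed_self, hcorei]; rfl
    have hb2 : ∀ k, k ≠ i → bun σ' k = bun σ k := fun k hk => by
      rw [bun_give_of_subset_pool _ hk hg', bun_shed_of_ne _ _ hk]
    have hlt' : I.own σ i < I.own σ' i := by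
      rw [own, own, hb1, I.val_pair i hgq.symm, hqa, hgb, hsplit i i, hcorei, val_singleton, hqa]
      linarith [hdust i]
    have hle : ∀ k, I.own σ k ≤ I.own σ' k := fun k => by
      by_cases hki : k = i
      · rw [hki]; exact hlt'.le
      · rw [own, own, hb2 k hki]
    refine h.swap i g hg ⟨fun k l hkl e' he' => ?_, hle,
      sum_lt_sum (fun k _ => hle k) ⟨i, mem_univ _, hlt'⟩⟩
    by_cases hli : l = i
    · subst hli
      rw [hb1] at he' ⊢
      have h3 := hσ k l hkl d hd'
      have h4 := I.v_le_val k (mem_erase.2 ⟨hdq.symm, hq⟩)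
      exact (hpair k (by linarith) e' he').trans (by linarith [hle k])
    · rw [hb2 l hli] at he' ⊢
      linarith [hσ k l hkl e' he', hle k]

end Inst

/-! ### Functions computed in polynomial time -/

/-- The size of a datum, as a tree. -/
def Ty.size : (A : Ty) → A.Data → ℕ
  | .bool, _ => 1
  | .real, _ => 1
  | .prod A B, x => A.size x.1 + B.size x.2 + 1
  | .list A, l => (l.map fun a => A.size a + 1).sum + 1

@[simp] lemma Ty.size_real (x : Ty.real.Data) : Ty.real.size x = 1 := rfl

@[simp] lemma Ty.size_prod {A B : Ty} (x : A.Data) (y : B.Data) :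
    (Ty.prod A B).size (x, y) = A.size x + B.size y + 1 := rfl

@[simp] lemma Ty.size_nil {A : Ty} : (Ty.list A).size [] = 1 := by simp [Ty.size]

@[simp] lemma Ty.size_cons {A : Ty} (x : A.Data) (l : List A.Data) :
    (Ty.list A).size (x :: l) = A.size x + 1 + (Ty.list A).size l := by
  simp [Ty.size, add_assoc]

lemma Ty.size_append {A : Ty} (l l' : List A.Data) :
    (Ty.list A).size (l ++ l') + 1 = (Ty.list A).size l + (Ty.list A).size l' := by
  simp only [Ty.size, List.map_append, List.sum_append]; omega

lemma Ty.size_le_of_mem {A : Ty} {x : A.Data} {l : List A.Data} (h : x ∈ l) :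
    A.size x ≤ (Ty.list A).size l := by
  induction l with
  | nil => simp at h
  | cons y l ih =>
    rw [Ty.size_cons]
    rcases List.mem_cons.1 h with rfl | h
    · omega
    · have := ih h; omega

lemma Ty.length_le_size {A : Ty} (l : List A.Data) : l.length ≤ (Ty.list A).size l := by
  induction l with
  | nil => simp
  | cons y l ih => rw [Ty.size_cons, List.length_cons]; omega

lemma Ty.size_le_of_forall {A : Ty} {l : List A.Data} {k : ℕ} (h : ∀ x ∈ l, A.size x ≤ k) :
    (Ty.list A).size l ≤ l.length * (k + 1) + 1 := by
  induction l with
  | nil => simp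
  | cons y l ih =>
    rw [Ty.size_cons, List.length_cons]
    have h1 := h y (by simp)
    have h2 := ih fun x hx => h x (by simp [hx])
    linarith [add_mul l.length 1 (k + 1)]

lemma Polynomial.eval_nat_mono (T : Polynomial ℕ) {a b : ℕ} (h : a ≤ b) : T.eval a ≤ T.eval b := by
  simp only [Polynomial.eval_eq_sum, Polynomial.sum]
  gcongr

/-- A function on data that is bounded by a polynomial in the size. -/
def PolyBdd {A : Ty} (h : A.Data → ℕ) : Prop := ∃ T : Polynomial ℕ, ∀ x, h x ≤ T.eval (A.size x)

namespace PolyBdd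

variable {A B : Ty} {h k : A.Data → ℕ}

lemma of_le (hk : PolyBdd k) (hle : ∀ x, h x ≤ k x) : PolyBdd h := by
  obtain ⟨T, hT⟩ := hk
  exact ⟨T, fun x => (hle x).trans (hT x)⟩

lemma const (c : ℕ) : PolyBdd (A := A) fun _ => c := ⟨Polynomial.C c, fun x => by simp⟩

lemma size : PolyBdd (A := A) A.size := ⟨Polynomial.X, fun x => by simp⟩

lemma add (hh : PolyBdd h) (hk : PolyBdd k) : PolyBdd fun x => h x + k x := by
  obtain ⟨T, hT⟩ := hh
  obtain ⟨S, hS⟩ := hk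
  exact ⟨T + S, fun x => by rw [Polynomial.eval_add]; exact add_le_add (hT x) (hS x)⟩

lemma mul (hh : PolyBdd h) (hk : PolyBdd k) : PolyBdd fun x => h x * k x := by
  obtain ⟨T, hT⟩ := hh
  obtain ⟨S, hS⟩ := hk
  exact ⟨T * S, fun x => by rw [Polynomial.eval_mul]; exact Nat.mul_le_mul (hT x) (hS x)⟩

lemma eval (hh : PolyBdd h) (T : Polynomial ℕ) : PolyBdd fun x => T.eval (h x) := by
  obtain ⟨S, hS⟩ := hh
  exact ⟨T.comp S, fun x => by rw [Polynomial.eval_comp]; exact T.eval_nat_mono (hS x)⟩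

lemma comp {g : B.Data → ℕ} (hg : PolyBdd g) {f : A.Data → B.Data}
    (hf : PolyBdd fun x => B.size (f x)) : PolyBdd fun x => g (f x) := by
  obtain ⟨T, hT⟩ := hg
  exact (hf.eval T).of_le fun x => hT (f x)

end PolyBdd

/-- A function on data, together with a program that computes it in polynomial time. The size of
the result is polynomially bounded, too; this does not follow from the bound on the time, as data
may share parts. -/
structure PolyFun (A B : Ty) where
  /-- The function. -/
  f : A.Data → B.Data
  /-- The program. -/
  prog : Prog A B
  runs : ∃ h : A.Data → ℕ, PolyBdd h ∧ ∀ x, ∃ t ≤ h x, prog.Runs x (f x) t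
  size : PolyBdd fun x => B.size (f x)

namespace PolyFun

variable {A B C D Γ S : Ty}

/-- The same function, described differently. -/
def congr (p : PolyFun A B) (g : A.Data → B.Data) (h : ∀ x, p.f x = g x) : PolyFun A B where
  f := g
  prog := p.prog
  runs := by
    obtain rfl : p.f = g := funext h
    exact p.runs
  size := by
    obtain rfl : p.f = g := funext h
    exact p.size

@[simp] lemma congr_f (p : PolyFun A B) (g : A.Data → B.Data) (h : ∀ x, p.f x = g x) :
    (p.congr g h).f = g := rfl

/-- The identity. -/
def id : PolyFun A A where
  f x := x
  prog := .skip
  runs := ⟨_, .const 1, fun x => ⟨1, le_rfl, .skip x⟩⟩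
  size := .size

/-- Composition. -/
def comp (q : PolyFun B C) (p : PolyFun A B) : PolyFun A C where
  f x := q.f (p.f x)
  prog := .seq p.prog q.prog
  runs := by
    obtain ⟨h, hh, hp⟩ := p.runs
    obtain ⟨k, hk, hq⟩ := q.runs
    refine ⟨_, (hh.add (hk.comp p.size)).add (.const 1), fun x => ?_⟩
    obtain ⟨s, hs, h1⟩ := hp x
    obtain ⟨t, ht, h2⟩ := hq (p.f x)
    exact ⟨s + t + 1, by omega, .seq h1 h2⟩
  size := q.size.comp p.size

/-- The pair of two results. -/
def pair (p : PolyFun A B) (q : PolyFun A C) : PolyFun A (.prod B C) where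
  f x := (p.f x, q.f x)
  prog := .fork p.prog q.prog
  runs := by
    obtain ⟨h, hh, hp⟩ := p.runs
    obtain ⟨k, hk, hq⟩ := q.runs
    refine ⟨_, (hh.add hk).add (.const 1), fun x => ?_⟩
    obtain ⟨s, hs, h1⟩ := hp x
    obtain ⟨t, ht, h2⟩ := hq x
    exact ⟨s + t + 1, by omega, .fork h1 h2⟩
  size := (p.size.add q.size).add (.const 1)

/-- The first component. -/
def fst : PolyFun (.prod A B) A where
  f x := x.1
  prog := .fst
  runs := ⟨_, .const 1, fun x => ⟨1, le_rfl, .fst x.1 x.2⟩⟩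
  size := PolyBdd.size.of_le fun x => by
    obtain ⟨x, y⟩ := x
    rw [Ty.size_prod]; dsimp only; omega

/-- The second component. -/
def snd : PolyFun (.prod A B) B where
  f x := x.2
  prog := .snd
  runs := ⟨_, .const 1, fun x => ⟨1, le_rfl, .snd x.1 x.2⟩⟩
  size := PolyBdd.size.of_le fun x => by
    obtain ⟨x, y⟩ := x
    rw [Ty.size_prod]; dsimp only; omega

/-- A boolean constant. -/
def const (b : Bool) : PolyFun A .bool where
  f _ := b
  prog := .const b
  runs := ⟨_, .const 1, fun x => ⟨1, le_rfl, .const b x⟩⟩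
  size := .const 1

/-- Branching. -/
def ite (c : PolyFun A .bool) (p q : PolyFun A B) : PolyFun A B where
  f x := if c.f x = true then p.f x else q.f x
  prog := .ite c.prog p.prog q.prog
  runs := by
    obtain ⟨l, hl, hc⟩ := c.runs
    obtain ⟨h, hh, hp⟩ := p.runs
    obtain ⟨k, hk, hq⟩ := q.runs
    refine ⟨_, ((hl.add hh).add hk).add (.const 1), fun x => ?_⟩
    obtain ⟨r, hr, h0⟩ := hc x
    obtain ⟨s, hs, h1⟩ := hp x
    obtain ⟨t, ht, h2⟩ := hq x
    by_cases hx : c.f x = true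
    · rw [if_pos hx]
      exact ⟨r + s + 1, by omega, .ite_true (hx ▸ h0) h1⟩
    · rw [if_neg hx]
      exact ⟨r + t + 1, by omega, .ite_false (Bool.eq_false_of_not_eq_true hx ▸ h0) h2⟩
  size := (p.size.add q.size).of_le fun x => by split_ifs <;> omega

/-- The empty list. -/
def nil : PolyFun A (.list B) where
  f _ := []
  prog := .nil
  runs := ⟨_, .const 1, fun x => ⟨1, le_rfl, .nil x⟩⟩
  size := (PolyBdd.const 1).of_le fun _ => by rw [Ty.size_nil]

/-- A new first element for a list. -/
def cons (p : PolyFun A B) (q : PolyFun A (.list B)) : PolyFun A (.list B) where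
  f x := p.f x :: q.f x
  prog := .seq (.fork p.prog q.prog) .cons
  runs := by
    obtain ⟨h, hh, hp⟩ := p.runs
    obtain ⟨k, hk, hq⟩ := q.runs
    refine ⟨_, (hh.add hk).add (.const 3), fun x => ?_⟩
    obtain ⟨s, hs, h1⟩ := hp x
    obtain ⟨t, ht, h2⟩ := hq x
    exact ⟨s + t + 1 + 1 + 1, by omega, .seq (.fork h1 h2) (.cons _ _)⟩
  size := ((p.size.add q.size).add (.const 1)).of_le fun x => by rw [Ty.size_cons]; omega

/-- Case distinction on a list. -/
def listCase (l : PolyFun Γ (.list B)) (p : PolyFun Γ C)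
    (q : PolyFun (.prod (.prod Γ B) (.list B)) C) : PolyFun Γ C where
  f x := match l.f x with
    | [] => p.f x
    | b :: t => q.f ((x, b), t)
  prog := .seq (.fork l.prog .skip) (.listCase p.prog
    (.seq (.fork (.fork .snd (.seq .fst .fst)) (.seq .fst .snd)) q.prog))
  runs := by
    obtain ⟨j, hj, hl⟩ := l.runs
    obtain ⟨h, hh, hp⟩ := p.runs
    obtain ⟨k, ⟨T, hT⟩, hq⟩ := q.runs
    refine ⟨_, ((hj.add hh).add (((PolyBdd.size.add l.size).add (.const 2)).eval T)).add
      (.const 20), fun x => ?_⟩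
    obtain ⟨r, hr, h0⟩ := hl x
    obtain ⟨s, hs, h1⟩ := hp x
    rcases hlx : l.f x with _ | ⟨b, t⟩
    · rw [hlx] at h0
      exact ⟨r + 1 + 1 + (s + 1) + 1, by omega,
        .seq (.fork h0 (.skip x)) (.listCase_nil h1)⟩
    · obtain ⟨u, hu, h2⟩ := hq ((x, b), t)
      rw [hlx] at h0
      refine ⟨r + 1 + 1 + ((1 + (1 + 1 + 1) + 1 + (1 + 1 + 1) + 1) + u + 1 + 1) + 1, ?_,
        .seq (.fork h0 (.skip x)) (.listCase_cons (.seq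
          (.fork (.fork (.snd _ _) (.seq (.fst _ _) (.fst _ _))) (.seq (.fst _ _) (.snd _ _))) h2))⟩
      have h3 := hT ((x, b), t)
      have h4 : (Ty.prod (.prod Γ B) (.list B)).size ((x, b), t) ≤
          Γ.size x + (Ty.list B).size (b :: t) + 2 := by
        rw [Ty.size_prod, Ty.size_prod, Ty.size_cons]; omega
      have h5 := T.eval_nat_mono h4
      omega
  size := by
    obtain ⟨T, hT⟩ := q.size
    refine (p.size.add (((PolyBdd.size.add l.size).add (.const 2)).eval T)).of_le fun x => ?_
    rcases hlx : l.f x with _ | ⟨b, t⟩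
    · dsimp only; omega
    · have h3 := hT ((x, b), t)
      have h4 : (Ty.prod (.prod Γ B) (.list B)).size ((x, b), t) ≤
          Γ.size x + (Ty.list B).size (b :: t) + 2 := by
        rw [Ty.size_prod, Ty.size_prod, Ty.size_cons]; omega
      have h5 := T.eval_nat_mono h4
      dsimp only at h3 ⊢
      omega

/-- The number `0`. -/
def zero : PolyFun A .real where
  f _ := (0 : ℝ)
  prog := .zero
  runs := ⟨_, .const 1, fun x => ⟨1, le_rfl, .zero x⟩⟩
  size := .const 1

/-- Addition. -/
def add (p q : PolyFun A .real) : PolyFun A .real where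
  f x := ((p.f x : ℝ) + (q.f x : ℝ) : ℝ)
  prog := .seq (.fork p.prog q.prog) .add
  runs := by
    obtain ⟨h, hh, hp⟩ := p.runs
    obtain ⟨k, hk, hq⟩ := q.runs
    refine ⟨_, (hh.add hk).add (.const 3), fun x => ?_⟩
    obtain ⟨s, hs, h1⟩ := hp x
    obtain ⟨t, ht, h2⟩ := hq x
    exact ⟨s + t + 1 + 1 + 1, by omega, .seq (.fork h1 h2) (.add _ _)⟩
  size := .const 1

/-- Subtraction. -/
def sub (p q : PolyFun A .real) : PolyFun A .real where
  f x := ((p.f x : ℝ) - (q.f x : ℝ) : ℝ)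
  prog := .seq (.fork p.prog q.prog) .sub
  runs := by
    obtain ⟨h, hh, hp⟩ := p.runs
    obtain ⟨k, hk, hq⟩ := q.runs
    refine ⟨_, (hh.add hk).add (.const 3), fun x => ?_⟩
    obtain ⟨s, hs, h1⟩ := hp x
    obtain ⟨t, ht, h2⟩ := hq x
    exact ⟨s + t + 1 + 1 + 1, by omega, .seq (.fork h1 h2) (.sub _ _)⟩
  size := .const 1

/-- Comparison. -/
noncomputable def le (p q : PolyFun A .real) : PolyFun A .bool where
  f x := decide ((p.f x : ℝ) ≤ (q.f x : ℝ))
  prog := .seq (.fork p.prog q.prog) .le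
  runs := by
    obtain ⟨h, hh, hp⟩ := p.runs
    obtain ⟨k, hk, hq⟩ := q.runs
    refine ⟨_, (hh.add hk).add (.const 3), fun x => ?_⟩
    obtain ⟨s, hs, h1⟩ := hp x
    obtain ⟨t, ht, h2⟩ := hq x
    refine ⟨s + t + 1 + 1 + 1, by omega, .seq (.fork h1 h2) ?_⟩
    by_cases hx : (p.f x : ℝ) ≤ (q.f x : ℝ)
    · rw [decide_eq_true hx]; exact .le_true hx
    · rw [decide_eq_false hx]; exact .le_false (not_le.1 hx)
  size := .const 1

/-! ### Folds -/

/-- The program that folds the list in the second component of its input. -/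
def foldProg (step : Prog (.prod (.prod Γ S) A) S) :
    Prog (.prod (.prod Γ S) (.list A)) (.prod (.prod Γ S) (.list A)) :=
  .loop (.seq (.fork .snd .skip) (.listCase (.const false) (.const true)))
    (.seq (.fork .snd .fst) (.listCase (.fork .skip .nil)
      (.fork (.fork (.seq .snd .fst) (.seq (.fork .snd (.seq .fst .fst)) step)) (.seq .fst .snd))))

lemma foldProg_runs {step : Prog (.prod (.prod Γ S) A) S} {F : Γ.Data → S.Data → A.Data → S.Data}
    (x : Γ.Data) (N : ℕ) (l : List A.Data) :
    ∀ s : S.Data, (∀ l₁ a l₂, l = l₁ ++ a :: l₂ → ∃ t ≤ N,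
      step.Runs ((x, l₁.foldl (F x) s), a) (F x (l₁.foldl (F x) s) a) t) →
    ∃ t ≤ l.length * (N + 40) + 40,
      (foldProg step).Runs ((x, s), l) ((x, l.foldl (F x) s), []) t := by
  induction l with
  | nil =>
    intro s _
    refine ⟨1 + 1 + 1 + (1 + 1) + 1 + 1, by omega, .loop_done (.seq (.fork (.snd _ _) (.skip _))
      (.listCase_nil (.const false _)))⟩
  | cons a l ih =>
    intro s hs
    obtain ⟨t, ht, h1⟩ := hs [] a l rfl
    obtain ⟨r, hr, h2⟩ := ih (F x s a) fun l₁ b l₂ hl => by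
      have := hs (a :: l₁) b l₂ (by rw [hl]; rfl)
      simpa using this
    refine ⟨_, ?_, .loop_step (.seq (.fork (.snd _ _) (.skip _)) (.listCase_cons (.const true _)))
      (.seq (.fork (.snd _ _) (.fst _ _)) (.listCase_cons (.fork (.fork (.seq (.snd _ _) (.fst _ _))
        (.seq (.fork (.snd _ _) (.seq (.fst _ _) (.fst _ _))) h1)) (.seq (.fst _ _) (.snd _ _)))))
      h2⟩
    rw [List.length_cons, add_mul]
    omega

/-- The left fold, for a step function that keeps the size of the intermediate results
polynomially bounded. -/
def foldl (l : PolyFun Γ (.list A)) (init : PolyFun Γ S) (step : PolyFun (.prod (.prod Γ S) A) S)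
    (hb : ∃ h : Γ.Data → ℕ, PolyBdd h ∧ ∀ x l₁ l₂, l.f x = l₁ ++ l₂ →
      S.size (l₁.foldl (fun s a => step.f ((x, s), a)) (init.f x)) ≤ h x) : PolyFun Γ S where
  f x := (l.f x).foldl (fun s a => step.f ((x, s), a)) (init.f x)
  prog := .seq (.seq (.fork (.fork .skip init.prog) l.prog) (foldProg step.prog)) (.seq .fst .snd)
  runs := by
    obtain ⟨hl, hhl, hl'⟩ := l.runs
    obtain ⟨hi, hhi, hi'⟩ := init.runs
    obtain ⟨hs, ⟨T, hT⟩, hs'⟩ := step.runs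
    obtain ⟨h, hh, hb⟩ := hb
    refine ⟨_, (((hhl.add hhi).add (l.size.mul (((((PolyBdd.size (A := Γ)).add hh).add
      (l.size.add (.const 2))).eval T).add (.const 40)))).add (.const 60)), fun x => ?_⟩
    obtain ⟨r, hr, h0⟩ := hl' x
    obtain ⟨s, hs1, h1⟩ := hi' x
    obtain ⟨t, ht, h2⟩ := foldProg_runs (step := step.prog)
      (F := fun x s a => step.f ((x, s), a)) x
      (T.eval (Γ.size x + h x + ((Ty.list A).size (l.f x) + 2))) (l.f x) (init.f x)
      (fun l₁ a l₂ hla => by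
        obtain ⟨t, ht, h3⟩ := hs' ((x, l₁.foldl (fun s a => step.f ((x, s), a)) (init.f x)), a)
        refine ⟨t, ht.trans ((hT _).trans (T.eval_nat_mono ?_)), h3⟩
        have h4 := hb x l₁ _ hla
        have h5 : A.size a ≤ (Ty.list A).size (l.f x) := Ty.size_le_of_mem (by rw [hla]; simp)
        rw [Ty.size_prod, Ty.size_prod]
        omega)
    refine ⟨_, ?_, .seq (.seq (.fork (.fork (.skip x) h1) h0) h2) (.seq (.fst _ _) (.snd _ _))⟩
    have h6 := Nat.mul_le_mul_right
      (T.eval (Γ.size x + h x + ((Ty.list A).size (l.f x) + 2)) + 40) (Ty.length_le_size (l.f x))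
    omega
  size := by
    obtain ⟨h, hh, hb⟩ := hb
    exact hh.of_le fun x => hb x (l.f x) [] (by simp)

lemma foldl_size_le {F : S.Data → A.Data → S.Data} {N : ℕ} (l : List A.Data)
    (hF : ∀ s, ∀ a ∈ l, S.size (F s a) ≤ S.size s + N) (s : S.Data) :
    S.size (l.foldl F s) ≤ S.size s + l.length * N := by
  induction l generalizing s with
  | nil => simp
  | cons a l ih =>
    have h1 := ih (fun s b hb => hF s b (by simp [hb])) (F s a)
    have h2 := hF s a (by simp)
    rw [List.foldl_cons, List.length_cons, add_mul]
    omega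

/-- The left fold, for a step function that adds to the size of the intermediate result no more
than a polynomial in the sizes of the other two arguments. -/
def foldlAdd (l : PolyFun Γ (.list A)) (init : PolyFun Γ S) (step : PolyFun (.prod (.prod Γ S) A) S)
    (hb : ∃ h : (Ty.prod Γ A).Data → ℕ, PolyBdd h ∧ ∀ x s a,
      S.size (step.f ((x, s), a)) ≤ S.size s + h (x, a)) : PolyFun Γ S :=
  foldl l init step <| by
    obtain ⟨h, ⟨T, hT⟩, hb⟩ := hb
    refine ⟨_, init.size.add (l.size.mul (((PolyBdd.size (A := Γ)).add
      (l.size.add (.const 1))).eval T)), fun x l₁ l₂ hl => ?_⟩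
    refine (foldl_size_le (N := T.eval (Γ.size x + ((Ty.list A).size (l.f x) + 1))) l₁
      (fun s a ha => ?_) _).trans ?_
    · refine (hb x s a).trans (Nat.add_le_add_left ((hT _).trans (T.eval_nat_mono ?_)) _)
      have : A.size a ≤ (Ty.list A).size (l.f x) := Ty.size_le_of_mem (by rw [hl]; simp [ha])
      rw [Ty.size_prod]; omega
    · refine Nat.add_le_add_left (Nat.mul_le_mul_right _ ?_) _
      refine le_trans ?_ (Ty.length_le_size (l.f x))
      rw [hl, List.length_append]; omega

/-! ### List functions -/

/-- Reversal. -/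
def reverse (l : PolyFun Γ (.list A)) : PolyFun Γ (.list A) :=
  (foldlAdd l nil (cons snd (comp snd fst)) ⟨fun x => A.size x.2 + 1,
    (snd.size).add (.const 1), fun x s a => by
      change (Ty.list A).size (a :: s) ≤ _
      rw [Ty.size_cons]; dsimp only; omega⟩).congr (fun x => (l.f x).reverse) fun x => by
    change (l.f x).foldl (fun s a => a :: s) [] = _
    simp

/-- Concatenation. -/
def append (l l' : PolyFun Γ (.list A)) : PolyFun Γ (.list A) :=
  (foldlAdd (reverse l) l' (cons snd (comp snd fst)) ⟨fun x => A.size x.2 + 1,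
    (snd.size).add (.const 1), fun x s a => by
      change (Ty.list A).size (a :: s) ≤ _
      rw [Ty.size_cons]; dsimp only; omega⟩).congr (fun x => l.f x ++ l'.f x) fun x => by
    change ((reverse l).f x).foldl (fun s a => a :: s) (l'.f x) = _
    simp [reverse]

/-- Concatenation of the lists obtained from the elements of a list. -/
def flatMap (l : PolyFun Γ (.list A)) (b : PolyFun (.prod Γ A) (.list B)) : PolyFun Γ (.list B) :=
  (foldlAdd l nil (append (comp snd fst) (comp b (pair (comp fst fst) snd)))
    ⟨_, b.size, fun x s a => by
      have : (append (comp snd fst) (comp b (pair (comp fst fst) snd))).f ((x, s), a) =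
        s ++ b.f (x, a) := by rw [append, congr_f]; rfl
      rw [this]
      have := Ty.size_append s (b.f (x, a))
      omega⟩).congr (fun x => (l.f x).flatMap fun a => b.f (x, a)) fun x => by
    have : ∀ s a, (append (comp snd fst) (comp b (pair (comp fst fst) snd))).f ((x, s), a) =
        s ++ b.f (x, a) := fun s a => by rw [append, congr_f]; rfl
    change (l.f x).foldl (fun s a => (append (comp snd fst)
      (comp b (pair (comp fst fst) snd))).f ((x, s), a)) [] = _
    simp only [this]
    rw [List.flatMap_eq_foldl]

/-- The images of the elements of a list. -/
def map (l : PolyFun Γ (.list A)) (b : PolyFun (.prod Γ A) B) : PolyFun Γ (.list B) :=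
  (flatMap l (cons b nil)).congr (fun x => (l.f x).map fun a => b.f (x, a)) fun x => by
    rw [flatMap, congr_f]
    change (l.f x).flatMap (fun a => [b.f (x, a)]) = _
    induction l.f x <;> simp_all

/-- The elements of a list that pass a test. -/
def filter (l : PolyFun Γ (.list A)) (b : PolyFun (.prod Γ A) .bool) : PolyFun Γ (.list A) :=
  (flatMap l (ite b (cons snd nil) nil)).congr (fun x => (l.f x).filter fun a => b.f (x, a))
    fun x => by
      rw [flatMap, congr_f]
      change (l.f x).flatMap (fun a => if b.f (x, a) = true then [a] else []) = _
      induction l.f x with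
      | nil => rfl
      | cons a l ih => rw [List.flatMap_cons, ih, List.filter_cons]; split_ifs <;> rfl

/-- The sum of a list of numbers. -/
def sum (l : PolyFun Γ (.list .real)) : PolyFun Γ .real :=
  (foldlAdd l zero (add (comp snd fst) snd) ⟨_, .const 0, fun x s a => by simp⟩).congr
    (fun x => (List.sum (α := ℝ) (l.f x) : ℝ)) fun x => by
      change List.foldl (fun s a : ℝ => s + a) (0 : ℝ) (l.f x) = _
      rw [List.sum_eq_foldl]

/-- Disjunction. -/
def or (p q : PolyFun A .bool) : PolyFun A .bool :=
  (ite p (const true) q).congr (fun x => ((p.f x : Bool) || (q.f x : Bool) : Bool)) fun x => by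
    change (if p.f x = true then true else q.f x) = _
    cases (p.f x : Bool) <;> simp

/-- Conjunction. -/
def and (p q : PolyFun A .bool) : PolyFun A .bool :=
  (ite p q (const false)).congr (fun x => ((p.f x : Bool) && (q.f x : Bool) : Bool)) fun x => by
    change (if p.f x = true then q.f x else false) = _
    cases (p.f x : Bool) <;> simp

/-- Negation. -/
def not (p : PolyFun A .bool) : PolyFun A .bool :=
  (ite p (const false) (const true)).congr (fun x => (!(p.f x : Bool) : Bool)) fun x => by
    change (if p.f x = true then false else true) = _
    cases (p.f x : Bool) <;> simp

/-- Whether some element of a list passes a test. -/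
def any (l : PolyFun Γ (.list A)) (b : PolyFun (.prod Γ A) .bool) : PolyFun Γ .bool :=
  (foldlAdd l (const false) (or (comp snd fst) (comp b (pair (comp fst fst) snd)))
    ⟨_, .const 0, fun x s a => le_rfl⟩).congr
    (fun x => ((l.f x).any fun a => b.f (x, a) : Bool)) fun x => by
      have : ∀ (s : Bool) (a : A.Data), (or (comp snd fst)
        (comp b (pair (comp fst fst) snd))).f ((x, s), a) = ((s || b.f (x, a) : Bool) : Bool) :=
        fun s a => by rw [or, congr_f]; rfl
      change (l.f x).foldl (fun (s : Bool) a => (or (comp snd fst)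
        (comp b (pair (comp fst fst) snd))).f ((x, s), a)) false = _
      simp only [this]
      have key : ∀ (l : List A.Data) (s : Bool),
          l.foldl (fun s a => s || b.f (x, a)) s = (s || l.any fun a => b.f (x, a)) := by
        intro l
        induction l with
        | nil => simp
        | cons a l ih => intro s; rw [List.foldl_cons, ih, List.any_cons, Bool.or_assoc]
      exact key _ false

/-- Whether all elements of a list pass a test. -/
def all (l : PolyFun Γ (.list A)) (b : PolyFun (.prod Γ A) .bool) : PolyFun Γ .bool :=
  (not (any l (not b))).congr (fun x => ((l.f x).all fun a => b.f (x, a) : Bool)) fun x => by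
    rw [not, congr_f, any, congr_f, not, congr_f]
    simp [List.all_eq_not_any_not]

/-- Whether a list is nonempty. -/
def nonempty (l : PolyFun Γ (.list A)) : PolyFun Γ .bool :=
  (listCase l (const false) (const true)).congr (fun x => (!(l.f x).isEmpty : Bool)) fun x => by
    change (match l.f x with | [] => false | _ :: _ => true) = _
    cases l.f x <;> rfl

/-- The list without its first element. -/
def tail (l : PolyFun Γ (.list A)) : PolyFun Γ (.list A) :=
  (listCase l nil snd).congr (fun x => (l.f x).tail) fun x => by
    change (match l.f x with | [] => [] | _ :: t => t) = _
    cases l.f x <;> rfl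

/-- The first element of a list, with a default for the empty list. -/
def headD (l : PolyFun Γ (.list A)) (d : PolyFun Γ A) : PolyFun Γ A :=
  (listCase l d (comp snd fst)).congr (fun x => (l.f x).headD (d.f x)) fun x => by
    change (match l.f x with | [] => d.f x | a :: _ => a) = _
    cases l.f x <;> rfl

end PolyFun

/-! ### Encoding of instances and allocations -/

/-- Sets of goods. -/
abbrev TSet : Ty := .list .real

/-- Rows of the table of values: pairs of a good and its value. -/
abbrev TRow : Ty := .list (.prod .real .real)

/-- Agents: the name and the row. -/
abbrev TAgent : Ty := .prod .real TRow

/-- Allocations: pairs of a good and its owner. -/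
abbrev TAlloc : Ty := .list (.prod .real .real)

/-- The agents, the numbers `a` and `c`, and the truth value of `Inst.Narrow`. -/
abbrev TEnv : Ty := .prod (.list TAgent) (.prod .real (.prod .real .bool))

/-- An instance with an allocation. -/
abbrev TState : Ty := .prod TEnv TAlloc

namespace Inst

variable (I : Inst n m)

/-- The number that serves as the name of the agent or good with index `k`. The only positive
numbers at hand are the values; multiples of `a` are distinct if `a` is positive. -/
noncomputable def tok {N : ℕ} (k : Fin N) : ℝ := ((k : ℕ) + 1) * I.a

/-- The name of an owner; `0` stands for the pool. -/
noncomputable def otok (o : Option (Fin n)) : ℝ := o.elim 0 I.tok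

/-- The encoding of the row of agent `i`. -/
noncomputable def encRow (i : Fin n) : TRow.Data :=
  (List.finRange m).map fun g => (I.tok g, I.v i g)

/-- The encoding of agent `i`. -/
noncomputable def encAgent (i : Fin n) : TAgent.Data := (I.tok i, I.encRow i)

/-- The encoding of the list of all agents. -/
noncomputable def encAgents : (Ty.list TAgent).Data := (List.finRange n).map I.encAgent

/-- The encoding of an allocation. -/
noncomputable def encAlloc (σ : Alloc n m) : TAlloc.Data :=
  (List.finRange m).map fun g => (I.tok g, I.otok (σ g))

/-- The encoding of a set of goods. -/
noncomputable def encSet (S : Finset (Fin m)) : TSet.Data :=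
  ((List.finRange m).filter (· ∈ S)).map I.tok

open Classical in
/-- The encoding of an instance. -/
noncomputable def encEnv : TEnv.Data := (I.encAgents, (I.a, (I.c, decide I.Narrow)))

/-- The encoding of an instance with an allocation. -/
noncomputable def encState (σ : Alloc n m) : TState.Data := (I.encEnv, I.encAlloc σ)

variable {I}

lemma tok_inj (ha : 0 < I.a) {N : ℕ} {k l : Fin N} : I.tok k = I.tok l ↔ k = l := by
  rw [tok, tok, mul_left_inj' ha.ne', add_left_inj, Nat.cast_inj, Fin.val_inj]

lemma tok_pos (ha : 0 < I.a) {N : ℕ} (k : Fin N) : 0 < I.tok k := by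
  rw [tok]; positivity

lemma otok_inj (ha : 0 < I.a) {o o' : Option (Fin n)} : I.otok o = I.otok o' ↔ o = o' := by
  rcases o with _ | i <;> rcases o' with _ | j
  · simp
  · simpa [otok] using (tok_pos ha j).ne
  · simpa [otok] using (tok_pos ha i).ne'
  · simpa [otok] using tok_inj ha

lemma otok_some (i : Fin n) : I.otok (some i) = I.tok i := rfl

end Inst

namespace PolyFun

variable {Γ A B C D E : Ty}

/-- The innermost variable of a context. -/
def v0 : PolyFun (.prod Γ A) A := snd

/-- The second innermost variable of a context. -/
def v1 : PolyFun (.prod (.prod Γ A) B) A := comp snd fst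

/-- The third innermost variable of a context. -/
def v2 : PolyFun (.prod (.prod (.prod Γ A) B) C) A := comp v1 fst

/-- The fourth innermost variable of a context. -/
def v3 : PolyFun (.prod (.prod (.prod (.prod Γ A) B) C) D) A := comp v2 fst

/-- The fifth innermost variable of a context. -/
def v4 : PolyFun (.prod (.prod (.prod (.prod (.prod Γ A) B) C) D) E) A := comp v3 fst

/-- The bottom of a context with one variable above it. -/
def b1 : PolyFun (.prod A B) A := fst

/-- The bottom of a context with two variables above it. -/
def b2 : PolyFun (.prod (.prod A B) C) A := comp fst fst

/-- The bottom of a context with three variables above it. -/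
def b3 : PolyFun (.prod (.prod (.prod A B) C) D) A := comp b2 fst

/-- The bottom of a context with four variables above it. -/
def b4 : PolyFun (.prod (.prod (.prod (.prod A B) C) D) E) A := comp b3 fst

/-- A function applied to two arguments. -/
def app2 (p : PolyFun (.prod A B) C) (x : PolyFun Γ A) (y : PolyFun Γ B) : PolyFun Γ C :=
  comp p (pair x y)

/-- A function applied to three arguments. -/
def app3 (p : PolyFun (.prod (.prod A B) C) D) (x : PolyFun Γ A) (y : PolyFun Γ B)
    (z : PolyFun Γ C) : PolyFun Γ D :=
  comp p (pair (pair x y) z)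

/-- The value at a pair. -/
def ap2 (p : PolyFun (.prod A B) C) (x : A.Data) (y : B.Data) : C.Data := p.f (x, y)

/-- The value at a triple. -/
def ap3 (p : PolyFun (.prod (.prod A B) C) D) (x : A.Data) (y : B.Data) (z : C.Data) : D.Data :=
  p.f ((x, y), z)

/-- Whether all elements of a list pass a test. -/
def allIn (l : (Ty.list A).Data) (F : A.Data → Bool) : Bool := List.all l F

/-- The first component of a result. -/
def fstOf (p : PolyFun Γ (.prod A B)) : PolyFun Γ A := comp fst p

/-- The second component of a result. -/
def sndOf (p : PolyFun Γ (.prod A B)) : PolyFun Γ B := comp snd p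

/-- Strict comparison. -/
noncomputable def lt (x y : PolyFun Γ .real) : PolyFun Γ .bool := not (le y x)

/-- Twice a number. -/
def dbl (x : PolyFun Γ .real) : PolyFun Γ .real := add x x

/-- Three times a number. -/
def tpl (x : PolyFun Γ .real) : PolyFun Γ .real := add (dbl x) x

/-- Equality of numbers. -/
noncomputable def eqP : PolyFun (.prod .real .real) .bool := and (le fst snd) (le snd fst)

lemma eqP_f (x y : ℝ) : eqP.ap2 x y = decide (x = y) := by
  change (decide (x ≤ y) && decide (y ≤ x)) = _
  simp [le_antisymm_iff]

/-- Whether a good belongs to a set. -/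
noncomputable def memP : PolyFun (.prod .real TSet) .bool := any snd (app2 eqP b2 v0)

/-- The set of goods of an owner in an allocation. -/
noncomputable def bunP : PolyFun (.prod TAlloc .real) TSet :=
  map (filter fst (app2 eqP (sndOf v0) v1)) (fstOf v0)

/-- The value of a set of goods. -/
noncomputable def valP : PolyFun (.prod TRow TSet) .real :=
  sum (map fst (ite (app2 memP (fstOf v0) v1) (sndOf v0) zero))

/-- The value of her bundle for an agent. -/
noncomputable def ownP : PolyFun (.prod TAgent TAlloc) .real :=
  app2 valP (sndOf b1) (app2 bunP v0 (fstOf b1))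

/-- The allocation after an agent has returned all her goods. -/
noncomputable def dropP : PolyFun (.prod TAlloc .real) TAlloc :=
  map fst (ite (app2 eqP (sndOf v0) v1) (pair (fstOf v0) zero) v0)

/-- The allocation after the first agent has handed over her goods to the second. -/
noncomputable def handP : PolyFun (.prod (.prod TAlloc .real) .real) TAlloc :=
  map b2 (ite (app2 eqP (sndOf v0) v2) (pair (fstOf v0) v1) v0)

/-- The allocation after an agent has received a set of goods. -/
noncomputable def giveP : PolyFun (.prod (.prod TAlloc .real) TSet) TAlloc :=
  map b2 (ite (app2 memP (fstOf v0) v1) (pair (fstOf v0) v2) v0)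

/-- The allocation after an agent has returned her goods of a set. -/
noncomputable def shedP : PolyFun (.prod (.prod TAlloc TSet) .real) TAlloc :=
  map b2 (ite (and (app2 eqP (sndOf v0) v1) (app2 memP (fstOf v0) v2)) (pair (fstOf v0) zero) v0)

end PolyFun

namespace Inst
open PolyFun

variable {I : Inst n m}

lemma memP_f (ha : 0 < I.a) (g : Fin m) (S : Finset (Fin m)) :
    memP.ap2 (I.tok g) (I.encSet S) = decide (g ∈ S) := by
  change (I.encSet S).any (fun t => eqP.ap2 (I.tok g) t) = _
  rw [Bool.eq_iff_iff]
  simp [encSet, eqP_f, tok_inj ha]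

lemma bunP_f' (ha : 0 < I.a) (σ : Alloc n m) (o : Option (Fin n)) :
    bunP.ap2 (I.encAlloc σ) (I.otok o) = I.encSet {g | σ g = o} := by
  change ((I.encAlloc σ).filter (fun p => eqP.ap2 p.2 (I.otok o))).map (fun p => p.1) = _
  simp [encAlloc, List.filter_map, Function.comp_def, eqP_f, otok_inj ha, encSet]

lemma bunP_f (ha : 0 < I.a) (σ : Alloc n m) (i : Fin n) :
    bunP.ap2 (I.encAlloc σ) (I.tok i) = I.encSet (bun σ i) := bunP_f' ha σ (some i)

lemma bunP_pool (ha : 0 < I.a) (σ : Alloc n m) :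
    bunP.ap2 (I.encAlloc σ) (0 : ℝ) = I.encSet (pool σ) := bunP_f' ha σ none

lemma valP_f (ha : 0 < I.a) (i : Fin n) (S : Finset (Fin m)) :
    valP.ap2 (I.encRow i) (I.encSet S) = I.val i S := by
  change List.sum (α := ℝ) ((I.encRow i).map fun p =>
    if memP.ap2 p.1 (I.encSet S) = true then p.2 else (0 : ℝ)) = _
  simp only [encRow, List.map_map, Function.comp_def, memP_f ha, decide_eq_true_eq]
  rw [← List.ofFn_eq_map, List.sum_ofFn, val, Finset.sum_ite_mem, Finset.univ_inter]

lemma ownP_f (ha : 0 < I.a) (σ : Alloc n m) (i : Fin n) :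
    ownP.ap2 (I.encAgent i) (I.encAlloc σ) = I.own σ i := by
  change valP.ap2 (I.encRow i) (bunP.ap2 (I.encAlloc σ) (I.tok i)) = _
  rw [bunP_f ha, valP_f ha, own]

lemma encAlloc_congr {p : TAlloc.Data} {σ' : Alloc n m}
    {F : ℝ × ℝ → ℝ × ℝ} {σ : Alloc n m} (hp : p = (I.encAlloc σ).map F)
    (h : ∀ g, F (I.tok g, I.otok (σ g)) = (I.tok g, I.otok (σ' g))) : p = I.encAlloc σ' := by
  rw [hp, encAlloc, List.map_map, encAlloc]
  exact List.map_congr_left fun g _ => h g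

lemma dropP_f (ha : 0 < I.a) (σ : Alloc n m) (j : Fin n) :
    dropP.ap2 (I.encAlloc σ) (I.tok j) = I.encAlloc (dropAll σ j) :=
  encAlloc_congr (F := fun p => if eqP.ap2 p.2 (I.tok j) = true then (p.1, (0 : ℝ)) else p) rfl
    fun g => by
      simp only [eqP_f, ← otok_some, otok_inj ha, decide_eq_true_eq, dropAll]
      split_ifs <;> rfl

lemma handP_f (ha : 0 < I.a) (σ : Alloc n m) (i l : Fin n) :
    handP.ap3 (I.encAlloc σ) (I.tok i) (I.tok l) = I.encAlloc (handOver σ i l) :=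
  encAlloc_congr (F := fun p => if eqP.ap2 p.2 (I.tok i) = true then (p.1, I.tok l) else p) rfl
    fun g => by
      simp only [eqP_f, ← otok_some, otok_inj ha, decide_eq_true_eq, handOver]
      split_ifs <;> rfl

lemma giveP_f (ha : 0 < I.a) (σ : Alloc n m) (u : Fin n) (Z : Finset (Fin m)) :
    giveP.ap3 (I.encAlloc σ) (I.tok u) (I.encSet Z) = I.encAlloc (give σ u Z) :=
  encAlloc_congr (F := fun p => if memP.ap2 p.1 (I.encSet Z) = true then (p.1, I.tok u) else p) rfl
    fun g => by
      simp only [memP_f ha, ← otok_some, decide_eq_true_eq, give]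
      split_ifs <;> rfl

lemma shedP_f (ha : 0 < I.a) (σ : Alloc n m) (P : Finset (Fin m)) (i : Fin n) :
    shedP.ap3 (I.encAlloc σ) (I.encSet P) (I.tok i) = I.encAlloc (shed σ P i) :=
  encAlloc_congr (F := fun p => if (eqP.ap2 p.2 (I.tok i) && memP.ap2 p.1 (I.encSet P)) = true
      then (p.1, (0 : ℝ)) else p) rfl
    fun g => by
      simp only [memP_f ha, eqP_f, ← otok_some, otok_inj ha, decide_eq_true_eq, shed,
        Bool.and_eq_true]
      split_ifs <;> rfl

lemma length_encSet (S : Finset (Fin m)) : (I.encSet S).length = S.card := by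
  rw [encSet, List.length_map, ← List.toFinset_card_of_nodup ((List.nodup_finRange m).filter _)]
  congr 1
  ext g
  simp

section quantifiers
open Classical

lemma all_encAgents (F : TAgent.Data → Bool) :
    allIn I.encAgents F = decide (∀ i, F (I.encAgent i) = true) := by
  rw [Bool.eq_iff_iff]; simp [encAgents, allIn]

lemma any_encRow (i : Fin n) (F : ℝ × ℝ → Bool) :
    (I.encRow i).any F = decide (∃ g, F (I.tok g, I.v i g) = true) := by
  rw [Bool.eq_iff_iff]; simp [encRow]

lemma all_encSet (S : Finset (Fin m)) (F : ℝ → Bool) :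
    allIn (A := .real) (I.encSet S) F = decide (∀ g ∈ S, F (I.tok g) = true) := by
  rw [Bool.eq_iff_iff]
  simp [encSet, allIn, imp_iff_not_or]

end quantifiers

end Inst

/-! ### Breadth-first search for chains -/

section search
open Classical

/-- One step of the search: the agent `i` is appended to the first chain to which this is
possible, unless she has been reached before. The list holds the end and the allocation of the
chains found so far. -/
noncomputable def searchStep (E : Fin n → Fin n → Prop) (L : List (Fin n × Alloc n m))
    (i : Fin n) : List (Fin n × Alloc n m) :=
  if ∃ e ∈ L, e.1 = i then L
  else match L.filter fun e => E e.1 i with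
    | [] => L
    | e :: _ => (i, handOver e.2 i e.1) :: L

/-- The search for chains from the agents of a list: `n` rounds through all agents. -/
noncomputable def search (σ : Alloc n m) (E : Fin n → Fin n → Prop) (starts : List (Fin n)) :
    List (Fin n × Alloc n m) :=
  ((List.finRange n).flatMap fun _ => List.finRange n).foldl (searchStep E)
    (starts.map fun j => (j, dropAll σ j))

variable {E : Fin n → Fin n → Prop} {L : List (Fin n × Alloc n m)} {σ : Alloc n m}

/-- The agents reached so far. -/
noncomputable def reached (L : List (Fin n × Alloc n m)) : Finset (Fin n) :=
  (L.map Prod.fst).toFinset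

lemma mem_reached {i : Fin n} : i ∈ reached L ↔ ∃ e ∈ L, e.1 = i := by
  simp [reached]

lemma searchStep_of_mem {i : Fin n} (h : i ∈ reached L) : searchStep E L i = L := by
  rw [searchStep, if_pos (mem_reached.1 h)]

lemma searchStep_cases (E : Fin n → Fin n → Prop) (L : List (Fin n × Alloc n m)) (i : Fin n) :
    (searchStep E L i = L ∧ ((∃ l ∈ reached L, E l i) → i ∈ reached L)) ∨
    (i ∉ reached L ∧ ∃ e ∈ L, E e.1 i ∧ searchStep E L i = (i, handOver e.2 i e.1) :: L) := by
  by_cases hi : i ∈ reached L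
  · exact Or.inl ⟨searchStep_of_mem hi, fun _ => hi⟩
  · have hi' := fun h => hi (mem_reached.2 h)
    rw [searchStep, if_neg hi']
    rcases hf : L.filter (fun e => E e.1 i) with _ | ⟨e, t⟩
    · refine Or.inl ⟨by rw [hf], fun ⟨l, hl, hE⟩ => ?_⟩
      obtain ⟨e, he, rfl⟩ := mem_reached.1 hl
      have : e ∈ L.filter fun e => E e.1 i := by simpa using ⟨he, hE⟩
      rw [hf] at this
      simp at this
    · have : e ∈ L.filter fun e => E e.1 i := by rw [hf]; simp
      simp only [List.mem_filter, decide_eq_true_eq] at this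
      exact Or.inr ⟨hi, e, this.1, this.2, by rw [hf]⟩

lemma reached_subset_searchStep (i : Fin n) : reached L ⊆ reached (searchStep E L i) := by
  rcases searchStep_cases E L i with ⟨h, -⟩ | ⟨-, e, -, -, h⟩ <;> rw [h]
  intro k hk
  rw [mem_reached] at hk ⊢
  obtain ⟨e', he', h⟩ := hk
  exact ⟨e', by simp [he'], h⟩

lemma mem_reached_searchStep {i l : Fin n} (hl : l ∈ reached L) (hE : E l i) :
    i ∈ reached (searchStep E L i) := by
  rcases searchStep_cases E L i with ⟨h, h'⟩ | ⟨-, e, -, -, h⟩ <;> rw [h]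
  · exact h' ⟨l, hl, hE⟩
  · simp [reached]

lemma reached_subset_foldl (is : List (Fin n)) :
    reached L ⊆ reached (is.foldl (searchStep E) L) := by
  induction is generalizing L with
  | nil => exact subset_rfl
  | cons i is ih => exact (reached_subset_searchStep i).trans ih

lemma mem_reached_foldl {is : List (Fin n)} {i l : Fin n} (hi : i ∈ is) (hl : l ∈ reached L)
    (hE : E l i) : i ∈ reached (is.foldl (searchStep E) L) := by
  induction is generalizing L with
  | nil => simp at hi
  | cons k is ih =>
    rcases List.mem_cons.1 hi with rfl | hi
    · exact reached_subset_foldl is (mem_reached_searchStep hl hE)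
    · exact ih hi (reached_subset_searchStep k hl)

lemma foldl_searchStep_of_closed (h : ∀ l i, l ∈ reached L → E l i → i ∈ reached L)
    (is : List (Fin n)) : is.foldl (searchStep E) L = L := by
  induction is with
  | nil => rfl
  | cons i is ih =>
    rw [List.foldl_cons]
    rcases searchStep_cases E L i with ⟨h', -⟩ | ⟨hi, e, he, hE, -⟩
    · rw [h', ih]
    · exact absurd (h e.1 i (mem_reached.2 ⟨e, he, rfl⟩) hE) hi

/-- As long as the set of reached agents is not closed under `E`, it grows in each round. -/
lemma closed_or_card (is : List (Fin n)) (L : List (Fin n × Alloc n m)) :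
    (∀ l i, l ∈ reached ((is.flatMap fun _ => List.finRange n).foldl (searchStep E) L) → E l i →
      i ∈ reached ((is.flatMap fun _ => List.finRange n).foldl (searchStep E) L)) ∨
    is.length + (reached L).card ≤
      (reached ((is.flatMap fun _ => List.finRange n).foldl (searchStep E) L)).card := by
  induction is generalizing L with
  | nil => right; simp
  | cons k is ih =>
    rw [List.flatMap_cons, List.foldl_append]
    by_cases hcl : ∀ l i, l ∈ reached L → E l i → i ∈ reached L
    · left
      rw [foldl_searchStep_of_closed hcl, foldl_searchStep_of_closed hcl]
      exact hcl
    · rcases ih ((List.finRange n).foldl (searchStep E) L) with h | h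
      · exact Or.inl h
      · right
        push Not at hcl
        obtain ⟨l, i, hl, hE, hi⟩ := hcl
        have : (reached L).card < (reached ((List.finRange n).foldl (searchStep E) L)).card :=
          card_lt_card ⟨reached_subset_foldl _, fun hsub =>
            hi (hsub (mem_reached_foldl (List.mem_finRange i) hl hE))⟩
        rw [List.length_cons]
        omega

lemma mem_reached_search {starts : List (Fin n)} {i j : Fin n} (hj : j ∈ starts)
    (h : ReflTransGen E j i) : i ∈ reached (search σ E starts) := by
  have hj' : j ∈ reached (search σ E starts) := reached_subset_foldl _ (by simp [reached, hj])
  rcases closed_or_card (E := E) (List.finRange n) (starts.map fun j => (j, dropAll σ j))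
    with hcl | hcard
  · induction h with
    | refl => exact hj'
    | tail _ hE ih => exact hcl _ _ ih hE
  · have : (reached (search σ E starts)).card = Fintype.card (Fin n) := by
      refine le_antisymm (card_le_univ _) ?_
      rw [List.length_finRange] at hcard
      rw [Fintype.card_fin]
      exact (Nat.le_add_right _ _).trans hcard
    rw [(card_eq_iff_eq_univ _).1 this]
    exact mem_univ i

lemma chain_of_mem_search {starts : List (Fin n)} {e : Fin n × Alloc n m}
    (he : e ∈ search σ E starts) : ∃ D, Chain (· ∈ starts) E σ D e.1 e.2 := by
  have key : ∀ (is : List (Fin n)) (L : List (Fin n × Alloc n m)),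
      (∀ j ∈ starts, j ∈ reached L) →
      (∀ e ∈ L, ∃ D, Chain (· ∈ starts) E σ D e.1 e.2 ∧ ∀ k ∈ D, k ∈ reached L) →
      ∀ e ∈ is.foldl (searchStep E) L, ∃ D, Chain (· ∈ starts) E σ D e.1 e.2 := by
    intro is
    induction is with
    | nil =>
      intro L _ h2 e he
      obtain ⟨D, hD, -⟩ := h2 e he
      exact ⟨D, hD⟩
    | cons i is ih =>
      intro L h1 h2
      have hsub := reached_subset_searchStep (E := E) (L := L) i
      refine ih _ (fun j hj => hsub (h1 j hj)) fun e he => ?_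
      rcases searchStep_cases E L i with ⟨h, -⟩ | ⟨hi, e', he', hE, h⟩
      · rw [h] at he ⊢; exact h2 e he
      · rw [h] at he
        rcases List.mem_cons.1 he with rfl | he
        · obtain ⟨D, hD, hD'⟩ := h2 e' he'
          refine ⟨insert i D, .step i hD hE (fun hiD => hi (hD' i hiD)) (fun his => hi (h1 i his)),
            fun k hk => ?_⟩
          rcases mem_insert.1 hk with rfl | hk
          · rw [h]; simp [reached]
          · exact hsub (hD' k hk)
        · obtain ⟨D, hD, hD'⟩ := h2 e he
          exact ⟨D, hD, fun k hk => hsub (hD' k hk)⟩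
  refine key _ _ (fun j hj => by simp [reached, hj]) (fun e he => ?_) e he
  obtain ⟨j, hj, rfl⟩ := List.mem_map.1 he
  exact ⟨{j}, .start j hj, fun k hk => by simp_all [reached]⟩

end search

namespace PolyFun

variable {Γ A B C D : Ty}

/-- The agents of a state. -/
def agentsOf (s : PolyFun Γ TState) : PolyFun Γ (.list TAgent) := fstOf (fstOf s)

/-- The number `a` of a state. -/
def aOf (s : PolyFun Γ TState) : PolyFun Γ .real := fstOf (sndOf (fstOf s))

/-- The number `c` of a state. -/
def cOf (s : PolyFun Γ TState) : PolyFun Γ .real := fstOf (sndOf (sndOf (fstOf s)))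

/-- The truth value of `Inst.Narrow` of a state. -/
def narrowOf (s : PolyFun Γ TState) : PolyFun Γ .bool := sndOf (sndOf (sndOf (fstOf s)))

/-- The allocation of a state. -/
def allocOf (s : PolyFun Γ TState) : PolyFun Γ TAlloc := sndOf s

/-- The step of `search`. -/
noncomputable def searchStepP (E : PolyFun (.prod (.prod TState TAgent) TAgent) .bool) :
    PolyFun (.prod (.prod (.prod TState (.list TAgent)) (.list (.prod TAgent TAlloc))) TAgent)
      (.list (.prod TAgent TAlloc)) :=
  ite (any v1 (app2 eqP (fstOf (fstOf v0)) (fstOf v1))) v1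
    (listCase (filter v1 (app3 E (fstOf b3) (fstOf v0) v1)) v1
      (cons (pair v2 (app3 handP (sndOf v1) (fstOf v2) (fstOf (fstOf v1)))) v3))

lemma searchStepP_f (E : PolyFun (.prod (.prod TState TAgent) TAgent) .bool) (x : TState.Data)
    (y : List TAgent.Data) (s : List (TAgent.Data × TAlloc.Data)) (a : TAgent.Data) :
    (searchStepP E).f (((x, y), s), a) =
      if (s.any fun e => eqP.ap2 e.1.1 a.1) = true then s
      else match s.filter fun e => E.ap3 x e.1 a with
        | [] => s
        | e :: _ => (a, handP.ap3 e.2 a.1 e.1.1) :: s := by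
  change (if (s.any fun e => eqP.ap2 e.1.1 a.1) = true then s
      else (listCase (filter (v1 (Γ := .prod TState (.list TAgent))) (app3 E (fstOf b3) (fstOf v0)
        v1)) v1 (cons (pair v2 (app3 handP (sndOf v1) (fstOf v2) (fstOf (fstOf v1)))) v3)).f
        (((x, y), s), a)) = _
  have h : (filter (v1 (Γ := .prod TState (.list TAgent))) (app3 E (fstOf b3) (fstOf v0) v1)).f
      (((x, y), s), a) = s.filter fun e => E.ap3 x e.1 a := rfl
  unfold listCase
  dsimp only
  rw [h]
  cases s.filter fun e => E.ap3 x e.1 a <;> rfl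

lemma size_alloc (l : TAlloc.Data) : TAlloc.size l = 4 * List.length l + 1 := by
  induction l with
  | nil => rw [Ty.size_nil]; rfl
  | cons x l ih =>
    obtain ⟨x, y⟩ := x
    rw [Ty.size_cons, ih, Ty.size_prod, List.length_cons, Ty.size_real, Ty.size_real]; ring

lemma length_handP (l : TAlloc.Data) (x y : ℝ) :
    List.length (handP.ap3 l x y) = List.length l :=
  List.length_map _

lemma length_dropP (l : TAlloc.Data) (x : ℝ) : List.length (dropP.ap2 l x) = List.length l :=
  List.length_map _

/-- The function `search`. The arguments are the state and the list of starting agents. -/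
noncomputable def searchP (E : PolyFun (.prod (.prod TState TAgent) TAgent) .bool) :
    PolyFun (.prod TState (.list TAgent)) (.list (.prod TAgent TAlloc)) :=
  foldl (flatMap (agentsOf fst) (agentsOf (fstOf b1)))
    (map snd (pair v0 (app2 dropP (allocOf (fstOf b1)) (fstOf v0)))) (searchStepP E) <| by
  set l : PolyFun (.prod TState (.list TAgent)) (.list TAgent) :=
    flatMap (agentsOf fst) (agentsOf (fstOf b1))
  refine ⟨_, ((PolyBdd.size.add l.size).mul ((PolyBdd.size.add PolyBdd.size).add
    (.const 2))).add (.const 1), ?_⟩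
  rintro ⟨x, y⟩ l₁ l₂ hl
  set N := (TState.prod (.list TAgent)).size (x, y) with hN
  have hN' : N = TState.size x + (Ty.list TAgent).size y + 1 := by rw [hN, Ty.size_prod]
  have hx : TState.size x = TEnv.size x.1 + TAlloc.size x.2 + 1 := rfl
  have hx1 : TEnv.size x.1 = (Ty.list TAgent).size x.1.1 +
    (Ty.prod .real (.prod .real .bool)).size x.1.2 + 1 := rfl
  -- entries consist of an agent of the input and an allocation of the same length as the input
  have key : ∀ l₁ : List TAgent.Data, (∀ a ∈ l₁, TAgent.size a ≤ N) →
      ∀ s : List (TAgent.Data × TAlloc.Data),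
      (∀ e ∈ s, TAgent.size e.1 ≤ N ∧ TAlloc.size e.2 = TAlloc.size x.2) →
      let r : List (TAgent.Data × TAlloc.Data) :=
        l₁.foldl (fun s a => (searchStepP E).f (((x, y), s), a)) s
      r.length ≤ s.length + l₁.length ∧
        ∀ e ∈ r, TAgent.size e.1 ≤ N ∧ TAlloc.size e.2 = TAlloc.size x.2 := by
    intro l₁
    induction l₁ with
    | nil => intro _ s hs; exact ⟨by simp, hs⟩
    | cons a l₁ ih =>
      intro hl s hs
      have hstep : ((searchStepP E).f (((x, y), s), a) = s) ∨
          ∃ e ∈ s, (searchStepP E).f (((x, y), s), a) = (a, handP.ap3 e.2 a.1 e.1.1) :: s := by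
        rw [searchStepP_f]
        split_ifs
        · exact Or.inl rfl
        · rcases hf : s.filter (fun e => E.ap3 x e.1 a) with _ | ⟨e, t⟩
          · exact Or.inl (by rw [hf])
          · exact Or.inr ⟨e, List.mem_of_mem_filter (hf ▸ List.mem_cons_self), by rw [hf]⟩
      have hl' : ∀ b ∈ l₁, TAgent.size b ≤ N := fun b hb => hl b (by simp [hb])
      rcases hstep with h | ⟨e, he, h⟩
      · obtain ⟨h1, h2⟩ := ih hl' s hs
        rw [List.foldl_cons, h]
        exact ⟨by rw [List.length_cons]; omega, h2⟩
      · obtain ⟨h1, h2⟩ := ih hl' ((a, handP.ap3 e.2 a.1 e.1.1) :: s) fun e' he' => by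
          rcases List.mem_cons.1 he' with rfl | he'
          · refine ⟨hl a (by simp), ?_⟩
            have := (hs e he).2
            rw [size_alloc] at this ⊢
            rw [length_handP]; exact this
          · exact hs e' he'
        rw [List.foldl_cons, h]
        rw [List.length_cons] at h1
        exact ⟨by rw [List.length_cons]; omega, h2⟩
  have hmem : ∀ a ∈ l.f (x, y), TAgent.size a ≤ N := by
    intro a ha
    obtain ⟨b, -, hb⟩ := List.mem_flatMap.1 ha
    have : TAgent.size a ≤ (Ty.list TAgent).size x.1.1 := Ty.size_le_of_mem hb
    omega
  obtain ⟨h1, h2⟩ := key l₁ (fun a ha => hmem a (by rw [hl]; simp [ha]))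
    (y.map fun j => (j, dropP.ap2 x.2 j.1)) fun e he => by
      obtain ⟨j, hj, rfl⟩ := List.mem_map.1 he
      have : TAgent.size j ≤ (Ty.list TAgent).size y := Ty.size_le_of_mem hj
      refine ⟨by dsimp only; omega, ?_⟩
      rw [size_alloc, size_alloc, length_dropP]
  refine (Ty.size_le_of_forall (k := N + N + 1) fun e he => ?_).trans ?_
  · have h3 := h2 e he
    have : (Ty.prod TAgent TAlloc).size e = TAgent.size e.1 + TAlloc.size e.2 + 1 := rfl
    omega
  · refine Nat.add_le_add_right (Nat.mul_le_mul_right _ (h1.trans ?_)) 1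
    rw [List.length_map (as := y)]
    have h4 : y.length ≤ (Ty.list TAgent).size y := Ty.length_le_size y
    have h5 : (l.f (x, y)).length ≤ (Ty.list TAgent).size (l.f (x, y)) := Ty.length_le_size _
    have h6 : (l.f (x, y)).length = l₁.length + l₂.length := by rw [hl, List.length_append]
    change _ ≤ (Ty.prod TState (.list TAgent)).size (x, y) + (Ty.list TAgent).size (l.f (x, y))
    omega

end PolyFun

namespace Inst
open PolyFun Classical

variable {I : Inst n m}

/-- The encoding of the end of a chain and its allocation. -/
noncomputable def encHole (I : Inst n m) (e : Fin n × Alloc n m) : (Ty.prod TAgent TAlloc).Data :=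
  (I.encAgent e.1, I.encAlloc e.2)

/-- The encoding of a list of ends of chains with their allocations. -/
noncomputable def encHoles (I : Inst n m) (L : List (Fin n × Alloc n m)) :
    (Ty.list (.prod TAgent TAlloc)).Data := L.map I.encHole

lemma searchP_f (ha : 0 < I.a) (σ : Alloc n m)
    {Ep : PolyFun (.prod (.prod TState TAgent) TAgent) .bool} {E : Fin n → Fin n → Prop}
    (hE : ∀ l i, Ep.ap3 (I.encState σ) (I.encAgent l) (I.encAgent i) = decide (E l i))
    (starts : List (Fin n)) :
    (searchP Ep).ap2 (I.encState σ) (starts.map I.encAgent) =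
      I.encHoles (search σ E starts) := by
  have hstep : ∀ (L : List (Fin n × Alloc n m)) (i : Fin n),
      (searchStepP Ep).f (((I.encState σ, starts.map I.encAgent), L.map I.encHole), I.encAgent i) =
        (searchStep E L i).map I.encHole := by
    intro L i
    rw [searchStepP_f, searchStep]
    have h1 : ((L.map I.encHole).any fun e => eqP.ap2 e.1.1 (I.encAgent i).1) = true ↔
        ∃ e ∈ L, e.1 = i := by
      simp [encHole, encAgent, eqP_f, tok_inj ha]
    have h2 : ((L.map I.encHole).filter fun e => Ep.ap3 (I.encState σ) e.1 (I.encAgent i)) =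
        (L.filter fun e => E e.1 i).map I.encHole := by
      rw [List.filter_map]
      congr 1
      exact List.filter_congr fun e _ => hE e.1 i
    simp only [h1]
    split_ifs
    · rfl
    · rw [h2]
      rcases hf : L.filter (fun e => E e.1 i) with _ | ⟨e, t⟩
      · rw [hf]; rfl
      · rw [hf]
        change (I.encAgent i, handP.ap3 (I.encAlloc e.2) (I.tok i) (I.tok e.1)) :: _ = _
        rw [handP_f ha]; rfl
  have hfold : ∀ (is : List (Fin n)) (L : List (Fin n × Alloc n m)),
      (is.map I.encAgent).foldl (fun s a => (searchStepP Ep).f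
        (((I.encState σ, starts.map I.encAgent), s), a)) (L.map I.encHole) =
      (is.foldl (searchStep E) L).map I.encHole := by
    intro is
    induction is with
    | nil => intro L; rfl
    | cons i is ih => intro L; rw [List.map_cons, List.foldl_cons, hstep, ih, List.foldl_cons]
  change (I.encAgents.flatMap fun _ => I.encAgents).foldl (fun s a => (searchStepP Ep).f
        (((I.encState σ, starts.map I.encAgent), s), a)) ((starts.map I.encAgent).map
          fun j => (j, dropP.ap2 (I.encAlloc σ) j.1)) = _
  have h1 : (starts.map I.encAgent).map (fun j => (j, dropP.ap2 (I.encAlloc σ) j.1)) =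
      (starts.map fun j => (j, dropAll σ j)).map I.encHole := by
    rw [List.map_map, List.map_map]
    refine List.map_congr_left fun j _ => ?_
    change (I.encAgent j, dropP.ap2 (I.encAlloc σ) (I.tok j)) = _
    rw [dropP_f ha]; rfl
  have h2 : (I.encAgents.flatMap fun _ => I.encAgents) =
      ((List.finRange n).flatMap fun _ => List.finRange n).map I.encAgent := by
    rw [List.map_flatMap, encAgents, List.flatMap_map]
  rw [h1, h2, hfold, search, encHoles]

end Inst

/-! ### Programs for the conditions of the first phase -/

namespace PolyFun

variable {Γ A B C D : Ty}

/-- Whether an agent is low. -/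
noncomputable def lowP : PolyFun (.prod TState TAgent) .bool :=
  lt (tpl (app2 ownP v0 (allocOf b1))) (dbl (aOf b1))

/-- Whether an agent sees a good of a set. -/
noncomputable def seesP : PolyFun (.prod (.prod TState TAgent) TSet) .bool :=
  any (sndOf v1) (and (app2 memP (fstOf v0) v1)
    (or (lt (tpl (app2 ownP v2 (allocOf b3))) (dbl (sndOf v0)))
      (and (le (dbl (aOf b3)) (tpl (app2 ownP v2 (allocOf b3))))
        (le (app2 ownP v2 (allocOf b3)) (sndOf v0)))))

/-- Whether an agent sees a good of another agent. -/
noncomputable def seesAgentP : PolyFun (.prod (.prod TState TAgent) TAgent) .bool :=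
  app3 seesP b2 v1 (app2 bunP (allocOf b2) (fstOf v0))

/-- Whether an agent weakly envies another. -/
noncomputable def weakEnvyP : PolyFun (.prod (.prod TState TAgent) TAgent) .bool :=
  le (app2 ownP v1 (allocOf b2)) (app2 valP (sndOf v1) (app2 bunP (allocOf b2) (fstOf v0)))

/-- The chains to the contested agents. -/
noncomputable def contP : PolyFun TState (.list (.prod TAgent TAlloc)) :=
  app2 (searchP seesAgentP) id (filter (agentsOf id) lowP)

/-- The predicate `Inst.Acc` for two values and the number `a`. -/
noncomputable def accP : PolyFun (.prod (.prod .real .real) .real) .bool :=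
  and (le (dbl v1) (tpl b2)) (and (or (lt v0 b2) (le v1 v0)) (or (lt (dbl v0) b2) (le v1 (dbl v0))))

/-- The predicate `Inst.SizeOK`. -/
noncomputable def sizeP : PolyFun (.prod TState TSet) .bool :=
  or (not (nonempty (tail (tail v0)))) (and (narrowOf b1)
    (le (dbl (tpl (sub (sum (map v0 (cOf b2))) (cOf b1)))) (aOf b1)))

/-- Whether a set has exactly one element. -/
noncomputable def singleP : PolyFun TSet .bool := and (nonempty id) (not (nonempty (tail id)))

/-- The removal of a good from a set. -/
noncomputable def eraseP : PolyFun (.prod TSet .real) TSet := filter fst (not (app2 eqP v0 v1))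

/-- The first two clauses of `Inst.Valid` for a pair of agents and for a single agent, and the
third. -/
noncomputable def validP : PolyFun TState .bool :=
  and (all (agentsOf id) (all (agentsOf b1) (or (app2 eqP (fstOf v1) (fstOf v0))
    (all (app2 bunP (allocOf b2) (fstOf v0)) (app3 accP (app2 ownP v2 (allocOf b3))
      (app2 valP (sndOf v2) (app2 eraseP (app2 bunP (allocOf b3) (fstOf v1)) v0)) (aOf b3))))))
  (and (all (agentsOf id) (app2 sizeP b1 (app2 bunP (allocOf b1) (fstOf v0))))
    (all contP (all (agentsOf b1) (or (app2 eqP (fstOf v0) (fstOf (fstOf v1)))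
      (or (not (app3 seesAgentP b2 (fstOf v1) v0))
        (comp singleP (app2 bunP (allocOf b2) (fstOf v0))))))))

/-- The level of a value, given the number `a`. -/
noncomputable def levP : PolyFun (.prod .real .real) .real :=
  ite (le (dbl v0) (tpl b1)) (dbl v0) (ite (lt v0 (dbl b1)) v0 zero)

/-- Whether an agent is rich. -/
noncomputable def richP : PolyFun (.prod TState TAgent) .bool :=
  or (le (dbl (aOf b1)) (app2 ownP v0 (allocOf b1)))
    (any (sndOf v0) (and (app2 memP (fstOf v0) (app2 bunP (allocOf b2) (fstOf v1)))
      (le (aOf b2) (sndOf v0))))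

/-- The potential of the first phase. -/
noncomputable def potP : PolyFun TState (.prod .real (.prod .real .real)) :=
  pair (sum (map (agentsOf id) (app2 levP (app2 ownP v0 (allocOf b1)) (aOf b1))))
    (pair (sum (map (agentsOf id) (ite richP (aOf b1) zero)))
      (sum (map (agentsOf id) (app2 ownP v0 (allocOf b1)))))

/-- The lexicographic order of triples. -/
noncomputable def lexLt (x y : PolyFun Γ (.prod .real (.prod .real .real))) : PolyFun Γ .bool :=
  or (lt (fstOf x) (fstOf y)) (and (app2 eqP (fstOf x) (fstOf y))
    (or (lt (fstOf (sndOf x)) (fstOf (sndOf y))) (and (app2 eqP (fstOf (sndOf x)) (fstOf (sndOf y)))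
      (lt (sndOf (sndOf x)) (sndOf (sndOf y))))))

/-- The predicate `Inst.Improves`. -/
noncomputable def improvesP : PolyFun (.prod TState TAlloc) .bool :=
  and (comp validP (pair (fstOf b1) v0)) (lexLt (comp potP b1) (comp potP (pair (fstOf b1) v0)))

end PolyFun

namespace Inst
open PolyFun Classical

variable {I : Inst n m}

lemma decide_le_not (x y : ℝ) : (!(decide (x ≤ y))) = decide (y < x) := by
  rw [← decide_not]; simp

lemma lowP_f (ha : 0 < I.a) (σ : Alloc n m) (i : Fin n) :
    lowP.ap2 (I.encState σ) (I.encAgent i) = decide (I.Low σ i) := by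
  set x := ownP.ap2 (I.encAgent i) (I.encAlloc σ) with hx
  change (!(decide (I.a + I.a ≤ x + x + x))) = _
  rw [decide_le_not, hx, ownP_f ha, decide_eq_decide, Low]
  ring_nf

lemma seesP_f (ha : 0 < I.a) (σ : Alloc n m) (l : Fin n) (S : Finset (Fin m)) :
    seesP.ap3 (I.encState σ) (I.encAgent l) (I.encSet S) = decide (∃ p ∈ S, I.Sees σ l p) := by
  set x := ownP.ap2 (I.encAgent l) (I.encAlloc σ) with hx
  change ((I.encRow l).any fun p => memP.ap2 p.1 (I.encSet S) &&
    (!(decide (p.2 + p.2 ≤ x + x + x)) || (decide (I.a + I.a ≤ x + x + x) &&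
      decide (x ≤ p.2)))) = _
  rw [any_encRow, hx, ownP_f ha, decide_eq_decide]
  simp only [memP_f ha, Bool.and_eq_true, Bool.or_eq_true, decide_eq_true_eq, decide_le_not, Sees]
  ring_nf

lemma seesAgentP_f (ha : 0 < I.a) (σ : Alloc n m) (l i : Fin n) :
    seesAgentP.ap3 (I.encState σ) (I.encAgent l) (I.encAgent i) =
      decide (I.SeesAgent σ l i) := by
  change seesP.ap3 (I.encState σ) (I.encAgent l) (bunP.ap2 (I.encAlloc σ) (I.tok i)) = _
  rw [bunP_f ha, seesP_f ha, decide_eq_decide, SeesAgent]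

lemma weakEnvyP_f (ha : 0 < I.a) (σ : Alloc n m) (l i : Fin n) :
    weakEnvyP.ap3 (I.encState σ) (I.encAgent l) (I.encAgent i) =
      decide (I.WeakEnvy σ l i) := by
  change decide (ownP.ap2 (I.encAgent l) (I.encAlloc σ) ≤
    valP.ap2 (I.encRow l) (bunP.ap2 (I.encAlloc σ) (I.tok i))) = _
  rw [bunP_f ha, ownP_f ha, valP_f ha, decide_eq_decide, WeakEnvy]

/-- The chains to the contested agents found by the search. -/
noncomputable def conts (I : Inst n m) (σ : Alloc n m) : List (Fin n × Alloc n m) :=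
  search σ (I.SeesAgent σ) ((List.finRange n).filter fun i => I.Low σ i)

lemma contP_f (ha : 0 < I.a) (σ : Alloc n m) :
    contP.f (I.encState σ) = I.encHoles (I.conts σ) := by
  change (searchP seesAgentP).ap2 (I.encState σ)
    (I.encAgents.filter fun i => lowP.ap2 (I.encState σ) i) = _
  have : (I.encAgents.filter fun i => lowP.ap2 (I.encState σ) i) =
      ((List.finRange n).filter fun i => I.Low σ i).map I.encAgent := by
    rw [encAgents, List.filter_map]
    congr 1
    exact List.filter_congr fun i _ => lowP_f ha σ i
  rw [this, searchP_f ha σ (seesAgentP_f ha σ), conts]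

lemma chain_of_mem_conts {σ : Alloc n m} {e : Fin n × Alloc n m} (he : e ∈ I.conts σ) :
    ∃ D, Chain (I.Low σ) (I.SeesAgent σ) σ D e.1 e.2 := by
  have := chain_of_mem_search he
  simpa using this

lemma exists_mem_conts {σ : Alloc n m} {i : Fin n} : (∃ e ∈ I.conts σ, e.1 = i) ↔
    I.Contested σ i := by
  constructor
  · rintro ⟨e, he, rfl⟩
    obtain ⟨D, hD⟩ := chain_of_mem_conts he
    exact chain_contested hD hD.mem
  · rintro ⟨j, hj, hr⟩
    exact mem_reached.1 (mem_reached_search (by simpa using hj) hr)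

lemma accP_f (x y : ℝ) : accP.ap3 x y I.a = decide (I.Acc x y) := by
  change (decide (y + y ≤ x + x + x) && ((!(decide (x ≤ I.a)) || decide (y ≤ I.a)) &&
    (!(decide (x ≤ I.a + I.a)) || decide (y ≤ I.a + I.a)))) = _
  rw [Bool.eq_iff_iff]
  simp only [Bool.and_eq_true, Bool.or_eq_true, decide_eq_true_eq, Bool.not_eq_true',
    decide_eq_false_iff_not, Acc, imp_iff_not_or]
  ring_nf

lemma sizeP_f (σ : Alloc n m) (S : Finset (Fin m)) :
    sizeP.ap2 (I.encState σ) (I.encSet S) = decide (I.SizeOK S) := by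
  set x : ℝ := List.sum (α := ℝ) ((I.encSet S).map fun _ => I.c) - I.c with hx
  change ((!(!(I.encSet S).tail.tail.isEmpty)) || (decide I.Narrow &&
    decide (x + x + x + (x + x + x) ≤ I.a))) = _
  have h1 : List.sum (α := ℝ) ((I.encSet S).map fun _ => I.c) = S.card * I.c := by
    rw [List.map_const', length_encSet, List.sum_replicate, nsmul_eq_mul]
  have h2 : (I.encSet S).tail.tail.isEmpty = decide (S.card ≤ 2) := by
    rw [← length_encSet (I := I)]
    rcases I.encSet S with _ | ⟨_, _ | ⟨_, _ | ⟨_, _⟩⟩⟩ <;> simp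
  rw [h2, hx, h1, Bool.not_not, Bool.eq_iff_iff]
  simp only [Bool.and_eq_true, Bool.or_eq_true, decide_eq_true_eq]
  have h3 : ∀ y : ℝ, y - I.c + (y - I.c) + (y - I.c) + (y - I.c + (y - I.c) + (y - I.c)) =
      6 * (y - I.c) := fun y => by ring
  rw [h3, SizeOK, sub_mul, one_mul]

lemma singleP_f (S : Finset (Fin m)) : singleP.f (I.encSet S) = decide (S.card = 1) := by
  change ((!(I.encSet S).isEmpty) && (!(!(I.encSet S).tail.isEmpty))) = _
  rw [← length_encSet (I := I)]
  rcases I.encSet S with _ | ⟨_, _ | ⟨_, _⟩⟩ <;> simp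

lemma eraseP_f (ha : 0 < I.a) (S : Finset (Fin m)) (g : Fin m) :
    eraseP.ap2 (I.encSet S) (I.tok g) = I.encSet (S.erase g) := by
  change ((I.encSet S).filter fun t => !(eqP.ap2 t (I.tok g))) = _
  simp only [encSet, List.filter_map, List.filter_filter, Function.comp_def, eqP_f, tok_inj ha]
  congr 1
  refine List.filter_congr fun h _ => ?_
  rw [Bool.eq_iff_iff]
  simp

lemma all_encHoles (L : List (Fin n × Alloc n m))
    (F : (Ty.prod TAgent TAlloc).Data → Bool) :
    allIn (I.encHoles L) F = decide (∀ e ∈ L, F (I.encHole e) = true) := by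
  rw [Bool.eq_iff_iff]; simp [allIn, encHoles]

lemma validP_f (ha : 0 < I.a) (σ : Alloc n m) :
    validP.f (I.encState σ) = decide (I.Valid σ) := by
  change ((allIn I.encAgents fun i => allIn I.encAgents fun k => eqP.ap2 i.1 k.1 ||
      allIn (bunP.ap2 (I.encAlloc σ) k.1) fun g => accP.ap3 (ownP.ap2 i (I.encAlloc σ))
        (valP.ap2 i.2 (eraseP.ap2 (bunP.ap2 (I.encAlloc σ) k.1) g)) I.a) &&
    ((allIn I.encAgents fun k => sizeP.ap2 (I.encState σ) (bunP.ap2 (I.encAlloc σ) k.1)) &&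
    (allIn (contP.f (I.encState σ)) fun e => allIn I.encAgents fun k => eqP.ap2 k.1 e.1.1 ||
      (!(seesAgentP.ap3 (I.encState σ) e.1 k) ||
        singleP.f (bunP.ap2 (I.encAlloc σ) k.1))))) = _
  rw [Bool.eq_iff_iff]
  simp only [contP_f ha, all_encHoles, all_encAgents]
  simp only [encHole, seesAgentP_f ha]
  simp only [encAgent, bunP_f ha, all_encSet, eraseP_f ha, valP_f ha, sizeP_f, singleP_f, eqP_f,
    tok_inj ha]
  have hown : ∀ i, ownP.ap2 (I.tok i, I.encRow i) (I.encAlloc σ) = I.own σ i := ownP_f ha σ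
  simp only [hown, accP_f, Bool.and_eq_true, decide_eq_true_eq, Bool.or_eq_true,
    Bool.not_eq_true', decide_eq_false_iff_not]
  constructor
  · rintro ⟨h1, h2, h3⟩
    refine ⟨fun i k hik g hg => (h1 i k).resolve_left hik g hg, h2, fun l k hl hkl p hp hs => ?_⟩
    obtain ⟨e, he, rfl⟩ := exists_mem_conts.2 hl
    exact ((h3 e he k).resolve_left hkl).resolve_left fun h => h ⟨p, hp, hs⟩
  · rintro ⟨h1, h2, h3⟩
    refine ⟨fun i k => or_iff_not_imp_left.2 (h1 i k), h2, fun e he k => ?_⟩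
    by_cases hk : k = e.1
    · exact Or.inl hk
    · refine Or.inr (or_iff_not_imp_left.2 fun h => ?_)
      rw [not_not] at h
      obtain ⟨p, hp, hs⟩ := h
      exact h3 e.1 k (exists_mem_conts.1 ⟨e, he, rfl⟩) hk p hp hs

lemma levP_f (x : ℝ) : levP.ap2 x I.a = I.lev x := by
  change (if decide (I.a + I.a ≤ x + x + x) = true then I.a + I.a
    else if (!(decide (x + x ≤ I.a))) = true then I.a else (0 : ℝ)) = _
  simp only [decide_eq_true_eq, decide_le_not, lev]
  ring_nf

lemma richP_f (ha : 0 < I.a) (σ : Alloc n m) (i : Fin n) :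
    richP.ap2 (I.encState σ) (I.encAgent i) = decide (I.Rich σ i) := by
  change (decide (I.a + I.a ≤ ownP.ap2 (I.encAgent i) (I.encAlloc σ)) ||
    (I.encRow i).any fun p => memP.ap2 p.1 (bunP.ap2 (I.encAlloc σ) (I.tok i)) &&
      decide (I.a ≤ p.2)) = _
  rw [any_encRow, ownP_f ha, bunP_f ha, Bool.eq_iff_iff]
  simp only [memP_f ha, Bool.and_eq_true, Bool.or_eq_true, decide_eq_true_eq, Rich, two_mul]
  have : ∀ g, I.a ≤ I.v i g ↔ I.v i g = I.a := fun g =>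
    ⟨fun h => le_antisymm (I.v_le i g) h, fun h => h.ge⟩
  simp only [this]

lemma sum_encAgents (F : TAgent.Data → ℝ) :
    List.sum (α := ℝ) (I.encAgents.map F) = ∑ i, F (I.encAgent i) := by
  rw [encAgents, List.map_map, ← List.ofFn_eq_map, List.sum_ofFn]; rfl

lemma potP_f (ha : 0 < I.a) (σ : Alloc n m) :
    potP.f (I.encState σ) = (∑ i, I.lev (I.own σ i),
      (∑ i, (if I.Rich σ i then I.a else 0), ∑ i, I.own σ i)) := by
  change (List.sum (α := ℝ) (I.encAgents.map fun i => levP.ap2 (ownP.ap2 i (I.encAlloc σ)) I.a),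
    (List.sum (α := ℝ) (I.encAgents.map fun i =>
      if richP.ap2 (I.encState σ) i = true then I.a else (0 : ℝ)),
    List.sum (α := ℝ) (I.encAgents.map fun i => ownP.ap2 i (I.encAlloc σ)))) = _
  rw [sum_encAgents, sum_encAgents, sum_encAgents]
  simp only [ownP_f ha, levP_f, richP_f ha, decide_eq_true_eq]

lemma improvesP_f (ha : 0 < I.a) (σ σ' : Alloc n m) :
    improvesP.ap2 (I.encState σ) (I.encAlloc σ') = decide (I.Improves σ σ') := by
  set p : ℝ × ℝ × ℝ := potP.f (I.encState σ) with hp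
  set q : ℝ × ℝ × ℝ := potP.f (I.encState σ') with hq
  change (validP.f (I.encState σ') && (!(decide (q.1 ≤ p.1)) || (eqP.ap2 p.1 q.1 &&
    (!(decide (q.2.1 ≤ p.2.1)) || (eqP.ap2 p.2.1 q.2.1 && !(decide (q.2.2 ≤ p.2.2))))))) = _
  rw [hp, hq, potP_f ha, potP_f ha, validP_f ha, Bool.eq_iff_iff]
  simp only [decide_le_not, eqP_f, Bool.and_eq_true, Bool.or_eq_true, decide_eq_true_eq, Improves,
    pot, Prod.Lex.toLex_lt_toLex]

end Inst

/-! ### Programs for the steps of the first phase -/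

namespace PolyFun

variable {Γ A B C D E F : Ty}

/-- The bottom of a context with five variables above it. -/
def b5 : PolyFun (.prod (.prod (.prod (.prod (.prod A B) C) D) E) F) A := comp b4 fst

/-- All goods. -/
def goodsP : PolyFun TState TSet := map (allocOf id) (fstOf v0)

/-- The pool. -/
noncomputable def poolP : PolyFun TState TSet := app2 bunP (allocOf id) zero

/-- The set of the pool goods `p` whose name does not exceed a threshold, which is the first, second
or third of the given numbers according to whether the agent values `p` at `a`, `b` or `c`. -/
noncomputable def classSetP :
    PolyFun (.prod (.prod (.prod (.prod TState TAgent) .real) .real) .real) TSet :=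
  map (filter (sndOf v3) (and (app2 memP (fstOf v0) (comp poolP b5))
    (ite (le (aOf b5) (sndOf v0)) (le (fstOf v0) v3)
      (ite (le (sndOf v0) (cOf b5)) (le (fstOf v0) v1) (le (fstOf v0) v2))))) (fstOf v0)

/-- The thresholds for `classSetP`. -/
def thresholdsP : PolyFun TState TSet := cons zero goodsP

/-- The ways in which an agent without goods may take goods. -/
noncomputable def fillsP : PolyFun (.prod (.prod TState TAgent) TAlloc) (.list TAlloc) :=
  append
    (flatMap (comp goodsP b2) (map (comp goodsP b3)
      (app3 giveP v2 (fstOf v3) (cons v1 (cons v0 nil)))))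
    (flatMap (comp thresholdsP b2) (flatMap (comp thresholdsP b3) (map (comp thresholdsP b4)
      (app3 giveP v3 (fstOf v4) (comp classSetP (pair (pair (pair (pair b5 v4) v2) v1) v0))))))

/-- The agents and allocations to which `fillsP` is applied. -/
noncomputable def holesP : PolyFun TState (.list (.prod TAgent TAlloc)) :=
  append (map (agentsOf id) (pair v0 (app2 dropP (allocOf b1) (fstOf v0))))
    (flatMap contP (cons v0 (map (agentsOf b1)
      (pair v0 (app3 handP (sndOf v1) (fstOf v0) (fstOf (fstOf v1)))))))

/-- The improvements found in the first phase. -/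
noncomputable def improvementsP : PolyFun TState (.list TAlloc) :=
  filter (flatMap holesP (app3 fillsP b1 (fstOf v0) (sndOf v0))) improvesP

lemma mem_filter_f {l : PolyFun Γ (.list A)} {b : PolyFun (.prod Γ A) .bool} {x : Γ.Data}
    {y : A.Data} : y ∈ (filter l b).f x ↔ y ∈ l.f x ∧ b.ap2 x y = true := List.mem_filter

lemma mem_flatMap_f {l : PolyFun Γ (.list A)} {b : PolyFun (.prod Γ A) (.list B)} {x : Γ.Data}
    {y : B.Data} : y ∈ (flatMap l b).f x ↔ ∃ a ∈ l.f x, y ∈ b.ap2 x a := List.mem_flatMap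

end PolyFun

/-- Every size up to that of `S` is attained by an initial segment of `S`. -/
lemma exists_card_filter_lt (S : Finset (Fin m)) {j : ℕ} (hj : j ≤ S.card) :
    ∃ k ≤ m, (S.filter fun p : Fin m => (p : ℕ) < k).card = j := by
  classical
  have hm : (S.filter fun p : Fin m => (p : ℕ) < m) = S := filter_true_of_mem fun p _ => p.2
  have hex : ∃ k, j ≤ (S.filter fun p : Fin m => (p : ℕ) < k).card := ⟨m, by rwa [hm]⟩
  have hle : Nat.find hex ≤ m := Nat.find_min' hex (by rwa [hm])
  refine ⟨Nat.find hex, hle, le_antisymm ?_ (Nat.find_spec hex)⟩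
  rcases hk : Nat.find hex with _ | k
  · simp
  · have h1 := Nat.find_min hex (m := k) (by omega)
    have h2 : (S.filter fun p : Fin m => (p : ℕ) < k + 1) ⊆
        (S.filter fun p : Fin m => (p : ℕ) < k) ∪ S.filter fun p : Fin m => (p : ℕ) = k := by
      intro p hp
      simp only [mem_union, mem_filter] at hp ⊢
      rcases Nat.lt_succ_iff_lt_or_eq.1 hp.2 with h | h
      · exact Or.inl ⟨hp.1, h⟩
      · exact Or.inr ⟨hp.1, h⟩
    have h3 : (S.filter fun p : Fin m => (p : ℕ) = k).card ≤ 1 := by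
      refine card_le_one.2 fun p hp q hq => ?_
      simp only [mem_filter] at hp hq
      exact Fin.ext (hp.2.trans hq.2.symm)
    have h4 := (card_le_card h2).trans (card_union_le _ _)
    omega

namespace Inst
open PolyFun Classical

variable {I : Inst n m}

/-- The class of a good for an agent: `0`, `1` or `2` for the values `a`, `b`, `c`. -/
noncomputable def cls (I : Inst n m) (u : Fin n) (p : Fin m) : Fin 3 :=
  if I.v u p = I.a then 0 else if I.v u p = I.c then 2 else 1

lemma v_eq_cls (u : Fin n) (p : Fin m) : I.v u p = ![I.a, I.b, I.c] (I.cls u p) := by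
  unfold cls
  split_ifs with h1 h2
  · simpa using h1
  · simpa using h2
  · rcases I.hv u p with h | h | h
    · exact absurd h h1
    · simpa using h
    · exact absurd h h2

/-- The goods of the pool with index below the threshold for their class. -/
noncomputable def classSet (I : Inst n m) (σ : Alloc n m) (u : Fin n) (k : Fin 3 → ℕ) :
    Finset (Fin m) := (pool σ).filter fun p => (p : ℕ) < k (I.cls u p)

/-- To `u`, every set of pool goods is equivalent to a set that is given by three thresholds. -/
lemma exists_classSet (σ : Alloc n m) (u : Fin n) {Z : Finset (Fin m)} (hZ : Z ⊆ pool σ) :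
    ∃ k : Fin 3 → ℕ, (∀ j, k j ≤ m) ∧ (I.classSet σ u k).card = Z.card ∧
      I.val u (I.classSet σ u k) = I.val u Z := by
  have h1 : ∀ j, ∃ k ≤ m, (((pool σ).filter fun p => I.cls u p = j).filter
      fun p : Fin m => (p : ℕ) < k).card = (Z.filter fun p => I.cls u p = j).card := fun j =>
    exists_card_filter_lt _ (card_le_card (filter_subset_filter _ hZ))
  choose k hk hk' using h1
  have h2 : ∀ j, ((I.classSet σ u k).filter fun p => I.cls u p = j).card =
      (Z.filter fun p => I.cls u p = j).card := fun j => by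
    rw [← hk' j]
    congr 1
    ext p
    simp only [classSet, mem_filter]
    constructor
    · rintro ⟨⟨h3, h4⟩, rfl⟩; exact ⟨⟨h3, rfl⟩, h4⟩
    · rintro ⟨⟨h3, rfl⟩, h4⟩; exact ⟨⟨h3, h4⟩, rfl⟩
  have h3 : ∀ S : Finset (Fin m), S.card = ∑ j, (S.filter fun p => I.cls u p = j).card :=
    fun S => card_eq_sum_card_fiberwise fun p _ => mem_univ _
  have h4 : ∀ S : Finset (Fin m), I.val u S =
      ∑ j, (S.filter fun p => I.cls u p = j).card * ![I.a, I.b, I.c] j := fun S => by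
    rw [val, ← Finset.sum_fiberwise S (I.cls u)]
    refine Finset.sum_congr rfl fun j _ => ?_
    rw [Finset.sum_congr rfl (g := fun _ => ![I.a, I.b, I.c] j), sum_const, nsmul_eq_mul]
    intro p hp
    rw [v_eq_cls, (mem_filter.1 hp).2]
  refine ⟨k, hk, ?_, ?_⟩
  · rw [h3, h3 Z]; exact Finset.sum_congr rfl fun j _ => h2 j
  · rw [h4, h4 Z]; exact Finset.sum_congr rfl fun j _ => by rw [h2 j]

lemma goodsP_f (σ : Alloc n m) : goodsP.f (I.encState σ) = (List.finRange m).map I.tok := by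
  change (I.encAlloc σ).map (fun p => p.1) = _
  rw [encAlloc, List.map_map]; rfl

lemma mem_goodsP (σ : Alloc n m) (g : Fin m) : I.tok g ∈ goodsP.f (I.encState σ) := by
  rw [goodsP_f]
  exact List.mem_map.2 ⟨g, List.mem_finRange g, rfl⟩

lemma poolP_f (ha : 0 < I.a) (σ : Alloc n m) : poolP.f (I.encState σ) = I.encSet (pool σ) :=
  bunP_pool ha σ

lemma mem_thresholdsP (σ : Alloc n m) (t : ℝ) :
    t ∈ thresholdsP.f (I.encState σ) ↔ ∃ k : ℕ, k ≤ m ∧ t = k * I.a := by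
  change t ∈ (0 : ℝ) :: goodsP.f (I.encState σ) ↔ _
  rw [goodsP_f, List.mem_cons, List.mem_map]
  constructor
  · rintro (rfl | ⟨g, -, rfl⟩)
    · exact ⟨0, by simp⟩
    · exact ⟨g + 1, by omega, by rw [tok]; push_cast; rfl⟩
  · rintro ⟨_ | k, hk, rfl⟩
    · left; simp
    · exact Or.inr ⟨⟨k, hk⟩, List.mem_finRange _, by rw [tok]; push_cast; rfl⟩

lemma classSetP_f (ha : 0 < I.a) (σ : Alloc n m) (u : Fin n) (k : Fin 3 → ℕ) :
    classSetP.f ((((I.encState σ, I.encAgent u), (k 0 : ℝ) * I.a), (k 1 : ℝ) * I.a),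
      (k 2 : ℝ) * I.a) = I.encSet (I.classSet σ u k) := by
  have htok : ∀ (p : Fin m) (j : Fin 3), I.tok p ≤ (k j : ℝ) * I.a ↔ (p : ℕ) < k j := fun p j => by
    rw [tok, mul_le_mul_iff_left₀ ha]
    exact_mod_cast Iff.rfl
  change ((I.encRow u).filter fun p => memP.ap2 p.1 (poolP.f (I.encState σ)) &&
    (if decide (I.a ≤ p.2) = true then decide (p.1 ≤ (k 0 : ℝ) * I.a)
    else if decide (p.2 ≤ I.c) = true then decide (p.1 ≤ (k 2 : ℝ) * I.a)
    else decide (p.1 ≤ (k 1 : ℝ) * I.a))).map (fun p => p.1) = _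
  rw [encRow, List.filter_map, List.map_map, encSet, poolP_f ha]
  change List.map I.tok _ = _
  congr 1
  refine List.filter_congr fun p _ => ?_
  have h1 : I.a ≤ I.v u p ↔ I.v u p = I.a :=
    ⟨fun h => le_antisymm (I.v_le u p) h, fun h => h.ge⟩
  have h2 : I.v u p ≤ I.c ↔ I.v u p = I.c :=
    ⟨fun h => le_antisymm h (I.le_v u p), fun h => h.le⟩
  rw [Bool.eq_iff_iff]
  simp only [Function.comp_apply, memP_f ha, Bool.and_eq_true, decide_eq_true_eq, htok, h1, h2]
  rw [classSet, mem_filter, mem_pool, cls]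
  split_ifs <;> simp

lemma giveP_f' (σ : Alloc n m) (u : Fin n) {z : TSet.Data} {Z : Finset (Fin m)}
    (hz : ∀ g : Fin m, memP.ap2 (I.tok g) z = decide (g ∈ Z)) :
    giveP.ap3 (I.encAlloc σ) (I.tok u) z = I.encAlloc (give σ u Z) :=
  encAlloc_congr (F := fun p => if memP.ap2 p.1 z = true then (p.1, I.tok u) else p) rfl
    fun g => by
      simp only [hz, ← otok_some, decide_eq_true_eq, give]
      split_ifs <;> rfl

lemma giveP_pair (ha : 0 < I.a) (σ : Alloc n m) (u : Fin n) (g g' : Fin m) :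
    giveP.ap3 (I.encAlloc σ) (I.tok u) ([I.tok g, I.tok g'] : List ℝ) =
      I.encAlloc (give σ u {g, g'}) :=
  giveP_f' σ u fun h => by
    change (eqP.ap2 (I.tok h) (I.tok g) || (eqP.ap2 (I.tok h) (I.tok g') || false)) = _
    rw [eqP_f, eqP_f, Bool.eq_iff_iff]
    simp [tok_inj ha]

lemma giveP_single (ha : 0 < I.a) (σ : Alloc n m) (u : Fin n) (g : Fin m) :
    giveP.ap3 (I.encAlloc σ) (I.tok u) ([I.tok g] : List ℝ) = I.encAlloc (give σ u {g}) :=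
  giveP_f' σ u fun h => by
    change (eqP.ap2 (I.tok h) (I.tok g) || false) = _
    rw [eqP_f, Bool.eq_iff_iff]
    simp [tok_inj ha]

lemma mem_fillsP (ha : 0 < I.a) (σ Y : Alloc n m) (u : Fin n) (y : TAlloc.Data) :
    y ∈ fillsP.ap3 (I.encState σ) (I.encAgent u) (I.encAlloc Y) ↔
      (∃ g g', y = I.encAlloc (give Y u {g, g'})) ∨
      ∃ k : Fin 3 → ℕ, (∀ j, k j ≤ m) ∧ y = I.encAlloc (give Y u (I.classSet σ u k)) := by
  change y ∈ ((goodsP.f (I.encState σ)).flatMap fun t => (goodsP.f (I.encState σ)).map fun t' =>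
      giveP.ap3 (I.encAlloc Y) (I.tok u) [t, t']) ++
    ((thresholdsP.f (I.encState σ)).flatMap fun t₁ => (thresholdsP.f (I.encState σ)).flatMap
      fun t₂ => (thresholdsP.f (I.encState σ)).map fun t₃ => giveP.ap3 (I.encAlloc Y) (I.tok u)
        (classSetP.f ((((I.encState σ, I.encAgent u), t₁), t₂), t₃))) ↔ _
  rw [List.mem_append]
  refine or_congr ⟨fun h => ?_, fun h => ?_⟩ ⟨fun h => ?_, fun h => ?_⟩
  · obtain ⟨t, ht, h⟩ := List.mem_flatMap.1 h
    obtain ⟨t', ht', rfl⟩ := List.mem_map.1 h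
    rw [goodsP_f] at ht ht'
    obtain ⟨g, -, rfl⟩ := List.mem_map.1 ht
    obtain ⟨g', -, rfl⟩ := List.mem_map.1 ht'
    exact ⟨g, g', giveP_pair ha Y u g g'⟩
  · obtain ⟨g, g', rfl⟩ := h
    exact List.mem_flatMap.2 ⟨_, mem_goodsP σ g, List.mem_map.2 ⟨_, mem_goodsP σ g',
      giveP_pair ha Y u g g'⟩⟩
  · obtain ⟨t₁, h1, h⟩ := List.mem_flatMap.1 h
    obtain ⟨t₂, h2, h⟩ := List.mem_flatMap.1 h
    obtain ⟨t₃, h3, rfl⟩ := List.mem_map.1 h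
    obtain ⟨k₁, hk₁, rfl⟩ := (mem_thresholdsP σ t₁).1 h1
    obtain ⟨k₂, hk₂, rfl⟩ := (mem_thresholdsP σ t₂).1 h2
    obtain ⟨k₃, hk₃, rfl⟩ := (mem_thresholdsP σ t₃).1 h3
    refine ⟨![k₁, k₂, k₃], fun j => by fin_cases j <;> assumption, ?_⟩
    have := classSetP_f ha σ u ![k₁, k₂, k₃]
    rw [← giveP_f ha, ← this]; rfl
  · obtain ⟨k, hk, rfl⟩ := h
    refine List.mem_flatMap.2 ⟨(k 0 : ℝ) * I.a, (mem_thresholdsP σ _).2 ⟨_, hk 0, rfl⟩,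
      List.mem_flatMap.2 ⟨(k 1 : ℝ) * I.a, (mem_thresholdsP σ _).2 ⟨_, hk 1, rfl⟩,
      List.mem_map.2 ⟨(k 2 : ℝ) * I.a, (mem_thresholdsP σ _).2 ⟨_, hk 2, rfl⟩, ?_⟩⟩⟩
    rw [classSetP_f ha, giveP_f ha]

lemma mem_holesP (ha : 0 < I.a) (σ : Alloc n m) (x : (Ty.prod TAgent TAlloc).Data) :
    x ∈ holesP.f (I.encState σ) ↔ (∃ i, x = I.encHole (i, dropAll σ i)) ∨
      ∃ e ∈ I.conts σ, x = I.encHole e ∨ ∃ i, x = I.encHole (i, handOver e.2 i e.1) := by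
  change x ∈ (I.encAgents.map fun i => (i, dropP.ap2 (I.encAlloc σ) i.1)) ++
    ((contP.f (I.encState σ)).flatMap fun e => e ::
      I.encAgents.map fun i => (i, handP.ap3 e.2 i.1 e.1.1)) ↔ _
  rw [List.mem_append, contP_f ha]
  have hd : ∀ i, (I.encAgent i, dropP.ap2 (I.encAlloc σ) (I.encAgent i).1) =
      I.encHole (i, dropAll σ i) := fun i => by
    rw [encHole, ← dropP_f ha]; rfl
  have hh : ∀ (e : Fin n × Alloc n m) i, (I.encAgent i,
      handP.ap3 (I.encHole e).2 (I.encAgent i).1 (I.encHole e).1.1) =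
      I.encHole (i, handOver e.2 i e.1) := fun e i => by
    change (I.encAgent i, handP.ap3 (I.encAlloc e.2) (I.tok i) (I.tok e.1)) = _
    rw [handP_f ha]; rfl
  refine or_congr ⟨fun h => ?_, fun ⟨i, h⟩ => ?_⟩ ⟨fun h => ?_, fun ⟨e, he, h⟩ => ?_⟩
  · obtain ⟨j, hj, rfl⟩ := List.mem_map.1 h
    obtain ⟨i, -, rfl⟩ := List.mem_map.1 hj
    exact ⟨i, hd i⟩
  · exact List.mem_map.2 ⟨I.encAgent i, List.mem_map.2 ⟨i, List.mem_finRange i, rfl⟩,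
      (hd i).trans h.symm⟩
  · obtain ⟨e', he', h⟩ := List.mem_flatMap.1 h
    obtain ⟨e, he, rfl⟩ := List.mem_map.1 he'
    refine ⟨e, he, ?_⟩
    rcases List.mem_cons.1 h with h | h
    · exact Or.inl h
    · obtain ⟨j, hj, rfl⟩ := List.mem_map.1 h
      obtain ⟨i, -, rfl⟩ := List.mem_map.1 hj
      exact Or.inr ⟨i, hh e i⟩
  · refine List.mem_flatMap.2 ⟨I.encHole e, List.mem_map.2 ⟨e, he, rfl⟩, ?_⟩
    rcases h with h | ⟨i, h⟩
    · exact List.mem_cons.2 (Or.inl h)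
    · exact List.mem_cons.2 (Or.inr (List.mem_map.2 ⟨I.encAgent i,
        List.mem_map.2 ⟨i, List.mem_finRange i, rfl⟩, (hh e i).trans h.symm⟩))

lemma mem_improvementsP (ha : 0 < I.a) (σ : Alloc n m) (y : TAlloc.Data) :
    y ∈ improvementsP.f (I.encState σ) ↔ ∃ (u : Fin n) (Y : Alloc n m),
      I.encHole (u, Y) ∈ holesP.f (I.encState σ) ∧
      y ∈ fillsP.ap3 (I.encState σ) (I.encAgent u) (I.encAlloc Y) ∧
      improvesP.ap2 (I.encState σ) y = true := by
  rw [improvementsP, mem_filter_f, mem_flatMap_f]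
  constructor
  · rintro ⟨⟨x, hx, h⟩, hy⟩
    have : ∃ e, x = I.encHole e := by
      rcases (mem_holesP ha σ x).1 hx with ⟨i, h⟩ | ⟨e, -, h | ⟨i, h⟩⟩ <;> exact ⟨_, h⟩
    obtain ⟨⟨u, Y⟩, rfl⟩ := this
    exact ⟨u, Y, hx, h, hy⟩
  · rintro ⟨u, Y, hx, h, hy⟩
    exact ⟨⟨_, hx, h⟩, hy⟩

lemma improves_of_mem_improvementsP (ha : 0 < I.a) {σ : Alloc n m} {y : TAlloc.Data}
    (hy : y ∈ improvementsP.f (I.encState σ)) : ∃ σ', y = I.encAlloc σ' ∧ I.Improves σ σ' := by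
  obtain ⟨u, Y, -, h, hy⟩ := (mem_improvementsP ha σ y).1 hy
  rcases (mem_fillsP ha σ Y u y).1 h with ⟨g, g', rfl⟩ | ⟨k, -, rfl⟩ <;>
  · rw [improvesP_f ha, decide_eq_true_eq] at hy
    exact ⟨_, rfl, hy⟩

lemma localOpt_of_improvementsP_eq_nil (ha : 0 < I.a) {σ : Alloc n m} (hσ : I.Valid σ)
    (h : improvementsP.f (I.encState σ) = []) : I.LocalOpt σ := by
  have key : ∀ u Y, I.encHole (u, Y) ∈ holesP.f (I.encState σ) → I.NoFill σ u Y := by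
    intro u Y hx
    have hno : ∀ σ', I.encAlloc σ' ∈ fillsP.ap3 (I.encState σ) (I.encAgent u) (I.encAlloc Y) →
        ¬ I.Improves σ σ' := fun σ' hσ' himp => by
      have : I.encAlloc σ' ∈ improvementsP.f (I.encState σ) :=
        (mem_improvementsP ha σ _).2 ⟨u, Y, hx, hσ', by rw [improvesP_f ha]; simpa using himp⟩
      rw [h] at this
      exact List.not_mem_nil this
    refine ⟨fun g g' => hno _ ((mem_fillsP ha σ Y u _).2 (Or.inl ⟨g, g', rfl⟩)), fun Z hZ => ?_⟩
    obtain ⟨k, hk, h1, h2⟩ := exists_classSet (I := I) σ u hZ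
    exact ⟨_, filter_subset _ _, h1, h2,
      hno _ ((mem_fillsP ha σ Y u _).2 (Or.inr ⟨k, hk, rfl⟩))⟩
  refine ⟨hσ, fun i => key i _ ((mem_holesP ha σ _).2 (Or.inl ⟨i, rfl⟩)), fun u hu => ?_⟩
  obtain ⟨⟨u', Y⟩, he, rfl⟩ := exists_mem_conts.2 hu
  obtain ⟨D, hD⟩ := chain_of_mem_conts he
  exact ⟨D, Y, hD, key _ _ ((mem_holesP ha σ _).2 (Or.inr ⟨_, he, Or.inl rfl⟩)), fun i _ =>
    key _ _ ((mem_holesP ha σ _).2 (Or.inr ⟨_, he, Or.inr ⟨i, rfl⟩⟩))⟩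

end Inst

/-! ### Programs for the steps of the second phase -/

namespace PolyFun

/-- The predicate `Inst.EFX`. -/
noncomputable def efxP : PolyFun TState .bool :=
  all (agentsOf id) (all (agentsOf b1) (or (app2 eqP (fstOf v1) (fstOf v0))
    (all (app2 bunP (allocOf b2) (fstOf v0)) (le
      (dbl (app2 valP (sndOf v2) (app2 eraseP (app2 bunP (allocOf b3) (fstOf v1)) v0)))
      (tpl (app2 ownP v2 (allocOf b3)))))))

/-- The predicate `Inst.Better`. -/
noncomputable def betterP : PolyFun (.prod TState TAlloc) .bool :=
  and (comp efxP (pair (fstOf b1) v0))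
    (and (all (agentsOf b1) (le (app2 ownP v0 (allocOf b2)) (app2 ownP v0 v1)))
      (lt (sum (map (agentsOf b1) (app2 ownP v0 (allocOf b2))))
        (sum (map (agentsOf b1) (app2 ownP v0 v1)))))

/-- The ways to add a pool good to a bundle. -/
noncomputable def addsP : PolyFun TState (.list TAlloc) :=
  flatMap (agentsOf id) (map (comp poolP b1) (app3 giveP (allocOf b2) (fstOf v1) (cons v0 nil)))

/-- The ways to exchange the goods of a set in a bundle for a pool good. -/
noncomputable def swapsP : PolyFun (.prod TState TSet) (.list TAlloc) :=
  flatMap (agentsOf b1) (map (comp poolP b2) (app3 giveP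
    (app3 shedP (allocOf b3) v2 (fstOf v1)) (fstOf v1) (cons v0 nil)))

/-- The cyclic exchanges along weak envy. -/
noncomputable def cyclesP : PolyFun TState (.list TAlloc) :=
  flatMap (agentsOf id) (map (app2 (searchP weakEnvyP) b1 (cons v0 nil))
    (app3 giveP (sndOf v0) (fstOf (fstOf v0)) (app2 bunP (allocOf b2) (fstOf v1))))

/-- The steps found in the second phase. The second argument is the initial pool. -/
noncomputable def exchangesP : PolyFun (.prod TState TSet) (.list TAlloc) :=
  append (filter (comp addsP b1) (comp efxP (pair (fstOf b2) v0)))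
    (filter (append swapsP (comp cyclesP b1)) (app2 betterP b2 v0))

end PolyFun

namespace Inst
open PolyFun Classical

variable {I : Inst n m}

lemma efxP_f (ha : 0 < I.a) (σ : Alloc n m) : efxP.f (I.encState σ) = decide (I.EFX σ) := by
  change (allIn I.encAgents fun i => allIn I.encAgents fun k => eqP.ap2 i.1 k.1 ||
      allIn (bunP.ap2 (I.encAlloc σ) k.1) fun g => decide (
        valP.ap2 i.2 (eraseP.ap2 (bunP.ap2 (I.encAlloc σ) k.1) g) +
        valP.ap2 i.2 (eraseP.ap2 (bunP.ap2 (I.encAlloc σ) k.1) g) ≤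
        ownP.ap2 i (I.encAlloc σ) + ownP.ap2 i (I.encAlloc σ) + ownP.ap2 i (I.encAlloc σ))) = _
  rw [Bool.eq_iff_iff]
  simp only [all_encAgents, ownP_f ha]
  simp only [encAgent, bunP_f ha, all_encSet, eraseP_f ha, valP_f ha, eqP_f, tok_inj ha]
  simp only [decide_eq_true_eq, Bool.or_eq_true, or_iff_not_imp_left, ← two_mul]
  refine forall₂_congr fun i k => imp_congr_right fun _ => forall₂_congr fun g _ => ?_
  rw [show 2 * I.own σ i + I.own σ i = 3 * I.own σ i by ring]

lemma betterP_f (ha : 0 < I.a) (σ σ' : Alloc n m) :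
    betterP.ap2 (I.encState σ) (I.encAlloc σ') = decide (I.Better σ σ') := by
  change (efxP.f (I.encState σ') && ((allIn I.encAgents fun i => decide
      (ownP.ap2 i (I.encAlloc σ) ≤ ownP.ap2 i (I.encAlloc σ'))) &&
    !(decide (List.sum (α := ℝ) (I.encAgents.map fun i => ownP.ap2 i (I.encAlloc σ')) ≤
      List.sum (α := ℝ) (I.encAgents.map fun i => ownP.ap2 i (I.encAlloc σ)))))) = _
  rw [efxP_f ha, sum_encAgents, sum_encAgents, decide_le_not, Bool.eq_iff_iff]
  simp only [all_encAgents, ownP_f ha, Bool.and_eq_true, decide_eq_true_eq]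
  rfl

lemma mem_poolP (ha : 0 < I.a) (σ : Alloc n m) (t : ℝ) :
    t ∈ poolP.f (I.encState σ) ↔ ∃ g ∈ pool σ, t = I.tok g := by
  rw [poolP_f ha, encSet, List.mem_map]
  constructor
  · rintro ⟨g, hg, rfl⟩
    exact ⟨g, by simpa using hg, rfl⟩
  · rintro ⟨g, hg, rfl⟩
    exact ⟨g, by simpa using hg, rfl⟩

lemma mem_encAgents (i : Fin n) : I.encAgent i ∈ I.encAgents :=
  List.mem_map.2 ⟨i, List.mem_finRange i, rfl⟩

lemma mem_addsP (ha : 0 < I.a) (σ : Alloc n m) (y : TAlloc.Data) :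
    y ∈ addsP.f (I.encState σ) ↔ ∃ s, ∃ g ∈ pool σ, y = I.encAlloc (give σ s {g}) := by
  change y ∈ (I.encAgents.flatMap fun i => (poolP.f (I.encState σ)).map fun t =>
    giveP.ap3 (I.encAlloc σ) i.1 [t]) ↔ _
  constructor
  · intro h
    obtain ⟨x, hx, h⟩ := List.mem_flatMap.1 h
    obtain ⟨s, -, rfl⟩ := List.mem_map.1 hx
    obtain ⟨t, ht, rfl⟩ := List.mem_map.1 h
    obtain ⟨g, hg, rfl⟩ := (mem_poolP ha σ t).1 ht
    exact ⟨s, g, hg, giveP_single ha σ s g⟩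
  · rintro ⟨s, g, hg, rfl⟩
    exact List.mem_flatMap.2 ⟨_, mem_encAgents s, List.mem_map.2
      ⟨_, (mem_poolP ha σ _).2 ⟨g, hg, rfl⟩, giveP_single ha σ s g⟩⟩

lemma mem_swapsP (ha : 0 < I.a) (σ : Alloc n m) (P : Finset (Fin m)) (y : TAlloc.Data) :
    y ∈ swapsP.ap2 (I.encState σ) (I.encSet P) ↔
      ∃ i, ∃ g ∈ pool σ, y = I.encAlloc (give (shed σ P i) i {g}) := by
  rw [ap2, swapsP, mem_flatMap_f]
  change (∃ i ∈ I.encAgents, y ∈ (poolP.f (I.encState σ)).map fun t =>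
    giveP.ap3 (shedP.ap3 (I.encAlloc σ) (I.encSet P) i.1) i.1 [t]) ↔ _
  have key : ∀ i g, giveP.ap3 (shedP.ap3 (I.encAlloc σ) (I.encSet P) (I.encAgent i).1)
      (I.encAgent i).1 ([I.tok g] : List ℝ) = I.encAlloc (give (shed σ P i) i {g}) :=
    fun i g => by
      change giveP.ap3 (shedP.ap3 (I.encAlloc σ) (I.encSet P) (I.tok i)) (I.tok i) _ = _
      rw [shedP_f ha]
      exact giveP_single ha _ i g
  constructor
  · rintro ⟨x, hx, h⟩
    obtain ⟨s, -, rfl⟩ := List.mem_map.1 hx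
    obtain ⟨t, ht, rfl⟩ := List.mem_map.1 h
    obtain ⟨g, hg, rfl⟩ := (mem_poolP ha σ t).1 ht
    exact ⟨s, g, hg, key s g⟩
  · rintro ⟨s, g, hg, rfl⟩
    exact ⟨_, mem_encAgents s, List.mem_map.2
      ⟨_, (mem_poolP ha σ _).2 ⟨g, hg, rfl⟩, key s g⟩⟩

lemma mem_cyclesP (ha : 0 < I.a) (σ : Alloc n m) (y : TAlloc.Data) :
    y ∈ cyclesP.f (I.encState σ) ↔ ∃ s, ∃ e ∈ search σ (I.WeakEnvy σ) [s],
      y = I.encAlloc (give e.2 e.1 (bun σ s)) := by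
  change y ∈ (I.encAgents.flatMap fun i => ((searchP weakEnvyP).ap2 (I.encState σ) [i]).map
    fun e => giveP.ap3 e.2 e.1.1 (bunP.ap2 (I.encAlloc σ) i.1)) ↔ _
  have key : ∀ s (e : Fin n × Alloc n m), giveP.ap3 (I.encHole e).2 (I.encHole e).1.1
      (bunP.ap2 (I.encAlloc σ) (I.encAgent s).1) = I.encAlloc (give e.2 e.1 (bun σ s)) :=
    fun s e => by
      change giveP.ap3 (I.encAlloc e.2) (I.tok e.1) (bunP.ap2 (I.encAlloc σ) (I.tok s)) = _
      rw [bunP_f ha, giveP_f ha]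
  have hs : ∀ s, (searchP weakEnvyP).ap2 (I.encState σ) ([I.encAgent s] : List TAgent.Data) =
      I.encHoles (search σ (I.WeakEnvy σ) [s]) := fun s =>
    searchP_f ha σ (weakEnvyP_f ha σ) [s]
  constructor
  · intro h
    obtain ⟨x, hx, h⟩ := List.mem_flatMap.1 h
    obtain ⟨s, -, rfl⟩ := List.mem_map.1 hx
    rw [hs] at h
    obtain ⟨e', he', rfl⟩ := List.mem_map.1 h
    obtain ⟨e, he, rfl⟩ := List.mem_map.1 he'
    exact ⟨s, e, he, key s e⟩
  · rintro ⟨s, e, he, rfl⟩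
    refine List.mem_flatMap.2 ⟨_, mem_encAgents s, ?_⟩
    rw [hs]
    exact List.mem_map.2 ⟨_, List.mem_map.2 ⟨e, he, rfl⟩, key s e⟩

lemma mem_exchangesP (ha : 0 < I.a) (σ : Alloc n m) (P : Finset (Fin m)) (y : TAlloc.Data) :
    y ∈ exchangesP.ap2 (I.encState σ) (I.encSet P) ↔ ∃ σ', y = I.encAlloc σ' ∧
      ((I.EFX σ' ∧ ∃ s, ∃ g ∈ pool σ, σ' = give σ s {g}) ∨
      (I.Better σ σ' ∧ ((∃ i, ∃ g ∈ pool σ, σ' = give (shed σ P i) i {g}) ∨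
        ∃ s, ∃ e ∈ search σ (I.WeakEnvy σ) [s], σ' = give e.2 e.1 (bun σ s)))) := by
  change y ∈ ((addsP.f (I.encState σ)).filter fun y => efxP.f (I.encEnv, y)) ++
    ((swapsP.ap2 (I.encState σ) (I.encSet P) ++ cyclesP.f (I.encState σ)).filter fun y =>
      betterP.ap2 (I.encState σ) y) ↔ _
  have he : ∀ σ', efxP.f (I.encEnv, I.encAlloc σ') = decide (I.EFX σ') := efxP_f ha
  rw [List.mem_append, List.mem_filter, List.mem_filter, List.mem_append, mem_addsP ha,
    mem_swapsP ha, mem_cyclesP ha]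
  constructor
  · rintro (⟨⟨s, g, hg, rfl⟩, h⟩ | ⟨⟨i, g, hg, rfl⟩ | ⟨s, e, hse, rfl⟩, h⟩)
    · rw [he, decide_eq_true_eq] at h
      exact ⟨_, rfl, Or.inl ⟨h, s, g, hg, rfl⟩⟩
    · rw [betterP_f ha, decide_eq_true_eq] at h
      exact ⟨_, rfl, Or.inr ⟨h, Or.inl ⟨i, g, hg, rfl⟩⟩⟩
    · rw [betterP_f ha, decide_eq_true_eq] at h
      exact ⟨_, rfl, Or.inr ⟨h, Or.inr ⟨s, e, hse, rfl⟩⟩⟩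
  · rintro ⟨σ', rfl, ⟨h, s, g, hg, rfl⟩ | ⟨h, ⟨i, g, hg, rfl⟩ | ⟨s, e, hse, rfl⟩⟩⟩
    · exact Or.inl ⟨⟨s, g, hg, rfl⟩, by rw [he]; simpa using h⟩
    · exact Or.inr ⟨Or.inl ⟨i, g, hg, rfl⟩, by rw [betterP_f ha]; simpa using h⟩
    · exact Or.inr ⟨Or.inr ⟨s, e, hse, rfl⟩, by rw [betterP_f ha]; simpa using h⟩

lemma exchangeOpt_of_exchangesP_eq_nil (ha : 0 < I.a) {σ₀ σ : Alloc n m}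
    (h : exchangesP.ap2 (I.encState σ) (I.encSet (pool σ₀)) = []) : I.ExchangeOpt σ₀ σ := by
  have hno : ∀ σ', ¬ I.encAlloc σ' ∈ exchangesP.ap2 (I.encState σ) (I.encSet (pool σ₀)) := by
    intro σ'
    rw [h]; exact List.not_mem_nil
  refine ⟨fun s g hg hE => ?_, fun i g hg hB => ?_, fun s k hk => ?_⟩
  · exact hno _ ((mem_exchangesP ha σ _ _).2 ⟨_, rfl, Or.inl ⟨hE, s, g, hg, rfl⟩⟩)
  · exact hno _ ((mem_exchangesP ha σ _ _).2 ⟨_, rfl, Or.inr ⟨hB, Or.inl ⟨i, g, hg, rfl⟩⟩⟩)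
  · obtain ⟨⟨k', Y⟩, he, rfl⟩ := mem_reached.1
      (mem_reached_search (σ := σ) (starts := [s]) (by simp) hk)
    obtain ⟨D, hD⟩ := chain_of_mem_search he
    simp only [List.mem_singleton] at hD
    exact ⟨D, Y, hD, fun hB => hno _ ((mem_exchangesP ha σ _ _).2
      ⟨_, rfl, Or.inr ⟨hB, Or.inr ⟨s, _, he, rfl⟩⟩⟩)⟩

/-- A step of the second phase preserves the invariant; it increases the total value, or it leaves
fewer goods in the pool and does not decrease the total value. -/
lemma step_of_mem_exchangesP (ha : 0 < I.a) {σ₀ σ : Alloc n m} (hσ : I.Descends σ₀ σ)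
    {y : TAlloc.Data} (hy : y ∈ exchangesP.ap2 (I.encState σ) (I.encSet (pool σ₀))) :
    ∃ σ', y = I.encAlloc σ' ∧ I.EFX σ' ∧ I.Descends σ₀ σ' ∧
      (∑ k, I.own σ k < ∑ k, I.own σ' k ∨
        (∑ k, I.own σ k ≤ ∑ k, I.own σ' k ∧ (pool σ').card < (pool σ).card)) := by
  obtain ⟨σ', rfl, ⟨h, s, g, hg, rfl⟩ | ⟨h, h'⟩⟩ := (mem_exchangesP ha σ _ y).1 hy
  · refine ⟨_, rfl, h, hσ.add s hg, Or.inr ⟨sum_le_sum fun k _ => own_le_give s hg k, ?_⟩⟩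
    rw [pool_give]
    exact card_lt_card (sdiff_ssubset (by simpa using mem_pool.1 hg) (by simp))
  · refine ⟨σ', rfl, h.1, ?_, Or.inl h.2.2⟩
    rcases h' with ⟨i, g, hg, rfl⟩ | ⟨s, e, he, rfl⟩
    · exact hσ.swap i hg h.2.1
    · obtain ⟨D, hD⟩ := chain_of_mem_search he
      simp only [List.mem_singleton] at hD
      exact hσ.cycle hD h.2.1

end Inst

/-! ### Iteration -/

/-- If each step that is not idle decreases the rank of the represented object, then a number of
steps not less than the rank leads to an object at which the step is idle. -/
lemma exists_iterate_idle {α ι : Type*} {F : α → α} {enc : ι → α} {Inv Idle : ι → Prop}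
    {rank : ι → ℕ} (h : ∀ i, Inv i → (Idle i ∧ F (enc i) = enc i) ∨
      ∃ j, F (enc i) = enc j ∧ Inv j ∧ rank j < rank i) (N : ℕ) :
    ∀ i, Inv i → rank i ≤ N → ∃ j, F^[N] (enc i) = enc j ∧ Inv j ∧ Idle j := by
  induction N with
  | zero =>
    intro i hi hr
    rcases h i hi with ⟨h1, -⟩ | ⟨j, -, -, h1⟩
    · exact ⟨i, rfl, hi, h1⟩
    · omega
  | succ N ih =>
    intro i hi hr
    rcases h i hi with ⟨h1, h2⟩ | ⟨j, h1, h2, h3⟩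
    · exact ⟨i, Function.iterate_fixed h2 _, hi, h1⟩
    · obtain ⟨k, hk⟩ := ih j h2 (by omega)
      exact ⟨k, by rw [Function.iterate_succ_apply, h1]; exact hk.1, hk.2⟩

/-- The number of values of `K` above the value at `σ`. -/
noncomputable def rankAbove {α β : Type*} [Fintype α] [LinearOrder β] (K : α → β) (σ : α) : ℕ :=
  ((univ.image K).filter (K σ < ·)).card

lemma rankAbove_lt {α β : Type*} [Fintype α] [LinearOrder β] {K : α → β} {σ σ' : α}
    (h : K σ < K σ') : rankAbove K σ' < rankAbove K σ := by
  refine card_lt_card ((ssubset_iff_of_subset fun x hx => ?_).2 ⟨K σ', ?_, ?_⟩)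
  · simp only [mem_filter] at hx ⊢
    exact ⟨hx.1, h.trans hx.2⟩
  · simp [h]
  · simp

lemma rankAbove_le {α β γ : Type*} [Fintype α] [LinearOrder β] {K : α → β} (S : Finset γ)
    (F : γ → β) (h : ∀ σ, ∃ s ∈ S, F s = K σ) (σ : α) : rankAbove K σ ≤ S.card := by
  refine (card_filter_le _ _).trans ((card_le_card (t := S.image F) fun x hx => ?_).trans
    card_image_le)
  obtain ⟨σ', -, rfl⟩ := mem_image.1 hx
  exact mem_image.2 (h σ')

namespace PolyFun

variable {Γ A B S : Ty}

/-- Iteration of a step, once for each element of a list, if the size of the result of the step is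
polynomially bounded independently of the state. -/
def iterate (l : PolyFun Γ (.list A)) (init : PolyFun Γ S) (step : PolyFun (.prod Γ S) S)
    (hb : ∃ h : Γ.Data → ℕ, PolyBdd h ∧ ∀ x s, S.size (step.f (x, s)) ≤ h x) : PolyFun Γ S :=
  (foldl l init (comp step b1) <| by
    obtain ⟨h, hh, hb⟩ := hb
    refine ⟨_, init.size.add hh, fun x l₁ l₂ _ => ?_⟩
    rcases List.eq_nil_or_concat l₁ with rfl | ⟨l, a, rfl⟩
    · exact Nat.le_add_right _ _
    · rw [List.concat_eq_append, List.foldl_append]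
      exact (hb x _).trans (Nat.le_add_left _ _)).congr
    (fun x => (fun s => step.f (x, s))^[(l.f x).length] (init.f x)) fun x => by
      change List.foldl (fun s _ => step.f (x, s)) (init.f x) (l.f x) = _
      exact List.foldl_const _ _ _

/-- All pairs of numbers from two lists, represented by their first components. -/
def prodList (l l' : PolyFun Γ (.list .real)) : PolyFun Γ (.list .real) :=
  flatMap l (map (comp l' b1) v1)

lemma length_prodList (l l' : PolyFun Γ (.list .real)) (x : Γ.Data) :
    ((prodList l l').f x).length = (l.f x).length * (l'.f x).length := by
  change (List.flatMap (fun r : ℝ => (l'.f x).map fun _ => r) (l.f x)).length = _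
  simp [List.length_flatMap]

/-- The names of agents and goods, and more. -/
def namesP : PolyFun TState (.list .real) :=
  append (map (agentsOf id) (fstOf v0)) (append (map (agentsOf id) (fstOf v0)) thresholdsP)

/-- A list whose length bounds the number of steps of either phase. -/
def budgetP : PolyFun TState (.list .real) :=
  prodList namesP (prodList namesP (prodList namesP (prodList namesP namesP)))

/-- The allocation of the second argument, restricted to the goods of the first argument. On
encodings of allocations this is the second argument; in general it serves to bound the size. -/
noncomputable def normP : PolyFun (.prod TAlloc TAlloc) TAlloc :=
  map fst (pair (fstOf v0) (sum (map (comp snd b1)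
    (ite (app2 eqP (fstOf v0) (fstOf v1)) (sndOf v0) zero))))

lemma normP_size (x y : TAlloc.Data) : TAlloc.size (normP.f (x, y)) ≤ TAlloc.size x * 4 + 1 := by
  refine (Ty.size_le_of_forall (k := 3) fun p _ => le_of_eq rfl).trans ?_
  have : (normP.f (x, y)).length = x.length := List.length_map _
  rw [this]
  have : x.length ≤ TAlloc.size x := Ty.length_le_size (A := .prod .real .real) x
  omega

/-- Iteration of the replacement of the allocation by the first element of a list. -/
noncomputable def climb (p : PolyFun (.prod TState TAlloc) (.list TAlloc)) :
    PolyFun TState TAlloc :=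
  iterate budgetP (allocOf id) (app2 normP (allocOf b1) (headD p v0))
    ⟨fun x => TAlloc.size x.2 * 4 + 1, (snd.size.mul (.const 4)).add (.const 1),
      fun x _ => normP_size x.2 _⟩

/-- The allocation at which the first phase stops. -/
noncomputable def seedP : PolyFun TState TAlloc := climb (comp improvementsP (pair (fstOf b1) v0))

/-- The allocation at which the second phase stops. -/
noncomputable def completeP : PolyFun TState TAlloc :=
  climb (app2 exchangesP (pair (fstOf b1) v0) (comp poolP b1))

end PolyFun

namespace Inst
open PolyFun Classical

variable {I : Inst n m}

lemma length_budgetP (σ : Alloc n m) :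
    (budgetP.f (I.encState σ)).length = (n + n + (m + 1)) ^ 5 := by
  have h : (namesP.f (I.encState σ)).length = n + n + (m + 1) := by
    change (I.encAgents.map (fun i => i.1) ++ (I.encAgents.map (fun i => i.1) ++
      thresholdsP.f (I.encState σ))).length = _
    have h1 : (thresholdsP.f (I.encState σ)).length = m + 1 := by
      change ((0 : ℝ) :: goodsP.f (I.encState σ)).length = _
      rw [goodsP_f]; simp
    rw [List.length_append, List.length_append, h1, List.length_map, encAgents]
    simp [add_assoc]
  rw [budgetP, length_prodList, length_prodList, length_prodList, length_prodList, h]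
  ring

lemma normP_f (ha : 0 < I.a) (σ₀ σ : Alloc n m) :
    normP.f (I.encAlloc σ₀, I.encAlloc σ) = I.encAlloc σ := by
  change (I.encAlloc σ₀).map (fun p => (p.1, List.sum (α := ℝ) ((I.encAlloc σ).map fun q =>
    if eqP.ap2 q.1 p.1 = true then q.2 else (0 : ℝ)))) = _
  simp only [encAlloc, List.map_map, Function.comp_def, eqP_f, tok_inj ha, decide_eq_true_eq]
  refine List.map_congr_left fun g _ => Prod.ext rfl ?_
  dsimp only
  rw [← List.ofFn_eq_map, List.sum_ofFn]
  simp

/-- What `climb` computes, if each step increases a key. -/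
lemma climb_f (ha : 0 < I.a) {p : PolyFun (.prod TState TAlloc) (.list TAlloc)} {β : Type*}
    [LinearOrder β] {K : Alloc n m → β} {Inv : Alloc n m → Prop} {σ₀ : Alloc n m}
    (hK : ∀ σ, rankAbove K σ ≤ (n + n + (m + 1)) ^ 5)
    (hp : ∀ σ, Inv σ → ∀ y ∈ p.f (I.encState σ₀, I.encAlloc σ),
      ∃ σ', y = I.encAlloc σ' ∧ Inv σ' ∧ K σ < K σ') (h₀ : Inv σ₀) :
    ∃ σ, (climb p).f (I.encState σ₀) = I.encAlloc σ ∧ Inv σ ∧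
      p.f (I.encState σ₀, I.encAlloc σ) = [] := by
  have := exists_iterate_idle (F := fun s : TAlloc.Data => normP.f (I.encAlloc σ₀,
      (p.f (I.encState σ₀, s)).headD s)) (enc := I.encAlloc) (Inv := Inv) (rank := rankAbove K)
    (Idle := fun σ => p.f (I.encState σ₀, I.encAlloc σ) = []) (fun σ hσ => by
      rcases hl : p.f (I.encState σ₀, I.encAlloc σ) with _ | ⟨y, l⟩
      · exact Or.inl ⟨rfl, normP_f ha _ _⟩
      · obtain ⟨σ', rfl, h1, h2⟩ := hp σ hσ y (by rw [hl]; simp)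
        exact Or.inr ⟨σ', normP_f ha _ _, h1, rankAbove_lt h2⟩)
    (budgetP.f (I.encState σ₀)).length σ₀ h₀ (by rw [length_budgetP]; exact hK σ₀)
  exact this

/-- The total value is a combination of `a`, `b`, `c` with coefficients up to `m`. -/
lemma exists_sum_own (σ : Alloc n m) : ∃ k ∈ (range (m + 1) ×ˢ range (m + 1) ×ˢ range (m + 1)),
    k.1 * I.a + (k.2.1 * I.b + k.2.2 * I.c) = ∑ i, I.own σ i := by
  have h1 : ∑ i, I.own σ i = ∑ g, ∑ i, if σ g = some i then I.v i g else 0 := by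
    rw [sum_comm]
    refine sum_congr rfl fun i _ => ?_
    rw [own, val, bun, sum_filter]
  have h2 : ∀ g, ∃ k : ℕ × ℕ × ℕ, (k.1 ≤ 1 ∧ k.2.1 ≤ 1 ∧ k.2.2 ≤ 1) ∧
      k.1 * I.a + (k.2.1 * I.b + k.2.2 * I.c) = ∑ i, if σ g = some i then I.v i g else 0 := by
    intro g
    rcases hg : σ g with _ | i
    · exact ⟨(0, 0, 0), by simp, by simp⟩
    · have : (∑ j, if some i = some j then I.v j g else 0) = I.v i g := by simp
      rw [this]
      rcases I.hv i g with h | h | h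
      · exact ⟨(1, 0, 0), by simp, by simp [h]⟩
      · exact ⟨(0, 1, 0), by simp, by simp [h]⟩
      · exact ⟨(0, 0, 1), by simp, by simp [h]⟩
  choose k hk hk' using h2
  have h3 : ∀ f : Fin m → ℕ, (∀ g, f g ≤ 1) → ∑ g, f g < m + 1 := fun f hf => by
    have h : ∑ g, f g ≤ m := by simpa using sum_le_card_nsmul univ f 1 fun g _ => hf g
    exact Nat.lt_succ_of_le h
  refine ⟨(∑ g, (k g).1, ∑ g, (k g).2.1, ∑ g, (k g).2.2), ?_, ?_⟩
  · simp only [mem_product, mem_range]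
    exact ⟨h3 _ fun g => (hk g).1, h3 _ fun g => (hk g).2.1, h3 _ fun g => (hk g).2.2⟩
  · rw [h1, ← sum_congr rfl fun g _ => hk' g]
    push_cast
    rw [sum_add_distrib, sum_add_distrib, sum_mul, sum_mul, sum_mul]

lemma exists_sum_eq_mul {f : Fin n → ℝ} {N : ℕ} {a : ℝ} (h : ∀ i, ∃ k ≤ N, f i = (k : ℕ) * a) :
    ∃ k ∈ range (n * N + 1), (k : ℕ) * a = ∑ i, f i := by
  choose k hk hk' using h
  refine ⟨∑ i, k i, ?_, ?_⟩
  · have h : ∑ i, k i ≤ n * N := by simpa using sum_le_card_nsmul univ k N fun i _ => hk i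
    exact mem_range.2 (Nat.lt_succ_of_le h)
  · rw [sum_congr rfl fun i _ => hk' i]
    push_cast
    rw [sum_mul]

lemma rankAbove_pot_le (σ : Alloc n m) : rankAbove I.pot σ ≤ (n + n + (m + 1)) ^ 5 := by
  refine (rankAbove_le (range (n * 2 + 1) ×ˢ range (n * 1 + 1) ×ˢ
    (range (m + 1) ×ˢ range (m + 1) ×ˢ range (m + 1)))
    (fun k => toLex ((k.1 : ℝ) * I.a, toLex ((k.2.1 : ℝ) * I.a,
      k.2.2.1 * I.a + (k.2.2.2.1 * I.b + k.2.2.2.2 * I.c)))) (fun σ => ?_) σ).trans ?_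
  · obtain ⟨k₁, h1, h1'⟩ := exists_sum_eq_mul (f := fun i => I.lev (I.own σ i)) (N := 2)
      (a := I.a) fun i => by
        unfold lev
        split_ifs
        · exact ⟨2, le_rfl, by norm_num⟩
        · exact ⟨1, by norm_num, by norm_num⟩
        · exact ⟨0, by norm_num, by norm_num⟩
    obtain ⟨k₂, h2, h2'⟩ := exists_sum_eq_mul (f := fun i => if I.Rich σ i then I.a else 0)
      (N := 1) (a := I.a) fun i => by
        split_ifs
        · exact ⟨1, le_rfl, by norm_num⟩
        · exact ⟨0, by norm_num, by norm_num⟩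
    obtain ⟨k₃, h3, h3'⟩ := I.exists_sum_own σ
    refine ⟨(k₁, k₂, k₃), mem_product.2 ⟨h1, mem_product.2 ⟨h2, h3⟩⟩, ?_⟩
    simp only [pot, h1', h2', h3']
  · simp only [card_product, card_range]
    obtain ⟨N, hN⟩ : ∃ N, N = n + n + (m + 1) := ⟨_, rfl⟩
    rw [← hN]
    calc _ ≤ N * (N * (N * (N * N))) := by gcongr <;> omega
      _ = _ := by ring

/-- The key of the second phase: total value and number of allocated goods. -/
noncomputable def key (I : Inst n m) (σ : Alloc n m) : ℝ ×ₗ ℕ :=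
  toLex (∑ i, I.own σ i, m - (pool σ).card)

lemma rankAbove_key_le (σ : Alloc n m) : rankAbove I.key σ ≤ (n + n + (m + 1)) ^ 5 := by
  refine (rankAbove_le ((range (m + 1) ×ˢ range (m + 1) ×ˢ range (m + 1)) ×ˢ range (m + 1))
    (fun k => toLex ((k.1.1 : ℝ) * I.a + (k.1.2.1 * I.b + k.1.2.2 * I.c), k.2))
    (fun σ => ?_) σ).trans ?_
  · obtain ⟨k, h, h'⟩ := I.exists_sum_own σ
    exact ⟨(k, m - (pool σ).card), mem_product.2 ⟨h, mem_range.2 (by omega)⟩, by rw [key, ← h']⟩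
  · simp only [card_product, card_range]
    obtain ⟨N, hN⟩ : ∃ N, N = n + n + (m + 1) := ⟨_, rfl⟩
    rw [← hN]
    calc _ ≤ N * (N * N) * N := by gcongr <;> omega
      _ ≤ N * (N * N) * N * N := Nat.le_mul_of_pos_right _ (by omega)
      _ = _ := by ring

lemma seedP_f (ha : 0 < I.a) {σ₀ : Alloc n m} (h₀ : I.Valid σ₀) :
    ∃ σ, seedP.f (I.encState σ₀) = I.encAlloc σ ∧ I.LocalOpt σ := by
  obtain ⟨σ, h1, h2, h3⟩ := climb_f ha (p := comp improvementsP (pair (fstOf b1) v0)) (σ₀ := σ₀)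
    (Inv := I.Valid) I.rankAbove_pot_le (fun σ _ y hy => by
      obtain ⟨σ', h1, h2⟩ := improves_of_mem_improvementsP ha (σ := σ) hy
      exact ⟨σ', h1, h2⟩) h₀
  exact ⟨σ, h1, localOpt_of_improvementsP_eq_nil ha h2 h3⟩

lemma completeP_f (hn : 0 < n) (ha : 0 < I.a) {σ₀ : Alloc n m} (h₀ : I.LocalOpt σ₀) :
    ∃ σ, completeP.f (I.encState σ₀) = I.encAlloc σ ∧ I.EFX σ ∧ pool σ = ∅ := by
  have hp : ∀ σ, (app2 exchangesP (pair (fstOf b1) v0) (comp poolP b1)).f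
      (I.encState σ₀, I.encAlloc σ) = exchangesP.ap2 (I.encState σ) (I.encSet (pool σ₀)) := by
    intro σ
    rw [← poolP_f ha]; rfl
  obtain ⟨σ, h1, h2, h3⟩ := climb_f ha (p := app2 exchangesP (pair (fstOf b1) v0) (comp poolP b1))
    (σ₀ := σ₀) (Inv := fun σ => I.EFX σ ∧ I.Descends σ₀ σ) I.rankAbove_key_le
    (fun σ hσ y hy => by
      rw [hp] at hy
      obtain ⟨σ', h1, h2, h3, h4⟩ := step_of_mem_exchangesP ha hσ.2 hy
      refine ⟨σ', h1, ⟨h2, h3⟩, Prod.Lex.toLex_lt_toLex.2 ?_⟩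
      rcases h4 with h4 | ⟨h4, h5⟩
      · exact Or.inl h4
      · rcases h4.lt_or_eq with h4 | h4
        · exact Or.inl h4
        · have : (pool σ).card ≤ m := by simpa using card_le_univ (pool σ)
          exact Or.inr ⟨h4, by dsimp only; omega⟩) ⟨h₀.valid.efx, .refl I σ₀⟩
  rw [hp] at h3
  exact ⟨σ, h1, h2.1, (exchangeOpt_of_exchangesP_eq_nil ha h3).pool_eq_empty hn h₀ h2.2 h2.1⟩

end Inst

/-! ### Input and output -/

/-- The elements of a list, paired with the numbers `c + a`, `c + 2 a`, and so on. -/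
noncomputable def numbered {α : Type*} (a : ℝ) : ℝ → List α → List (ℝ × α)
  | _, [] => []
  | c, x :: l => (c + a, x) :: numbered a (c + a) l

lemma numbered_ofFn {α : Type*} (a c : ℝ) {N : ℕ} (f : Fin N → α) :
    numbered a c (List.ofFn f) = List.ofFn fun k : Fin N => (c + ((k : ℕ) + 1) * a, f k) := by
  induction N generalizing c with
  | zero => simp [numbered]
  | succ N ih =>
    rw [List.ofFn_succ, List.ofFn_succ, numbered, ih]
    congr 1
    · simp
    · congr 1
      funext k
      simp only [Fin.val_succ]
      push_cast
      congr 1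
      ring

lemma headD_filter {α : Type*} {l : List α} {q : α → Bool} (d : α) (h : ∃ x ∈ l, q x = true) :
    (l.filter q).headD d ∈ l ∧ q ((l.filter q).headD d) = true := by
  obtain ⟨x, hx, hq⟩ := h
  have hm : x ∈ l.filter q := List.mem_filter.2 ⟨hx, hq⟩
  rcases hl : l.filter q with _ | ⟨y, t⟩
  · rw [hl] at hm; simp at hm
  · have : y ∈ l.filter q := by rw [hl]; simp
    simpa using List.mem_filter.1 this

namespace PolyFun

variable {Γ A B S : Ty}

/-- The elements of a list, paired with consecutive multiples of a number. -/
noncomputable def number (a : PolyFun Γ .real) (l : PolyFun Γ (.list A)) :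
    PolyFun Γ (.list (.prod .real A)) :=
  (reverse (sndOf (foldlAdd (S := .prod .real (.list (.prod .real A))) l (pair zero nil)
    (pair (add (fstOf v1) (comp a b2)) (cons (pair (add (fstOf v1) (comp a b2)) v0) (sndOf v1)))
    ⟨fun x => A.size x.2 + 3, (snd.size).add (.const 3), fun x s y => by
      obtain ⟨c, acc⟩ := s
      change (Ty.prod .real (.list (.prod .real A))).size
        ((c + a.f x : ℝ), ((c + a.f x : ℝ), y) :: acc) ≤ _
      rw [Ty.size_prod, Ty.size_cons, Ty.size_prod, Ty.size_prod, Ty.size_real, Ty.size_real]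
      dsimp only
      omega⟩))).congr (fun x => numbered (a.f x) (0 : ℝ) (l.f x)) fun x => by
    change ((l.f x).foldl (fun (s : ℝ × List (ℝ × A.Data)) y =>
      (s.1 + a.f x, (s.1 + a.f x, y) :: s.2)) ((0 : ℝ), [])).2.reverse = _
    have key : ∀ (l : List A.Data) (c : ℝ) (acc : List (ℝ × A.Data)),
        (l.foldl (fun (s : ℝ × List (ℝ × A.Data)) y =>
          (s.1 + a.f x, (s.1 + a.f x, y) :: s.2)) (c, acc)).2.reverse =
        acc.reverse ++ numbered (a.f x) c l := by
      intro l
      induction l with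
      | nil => simp [numbered]
      | cons y l ih => intro c acc; rw [List.foldl_cons, ih, numbered]; simp
    exact key _ _ _

/-- All values of the table. -/
def valuesP : PolyFun (.list (.list .real)) (.list .real) := flatMap id v0

/-- The greatest value of the table. -/
noncomputable def maxP : PolyFun (.list (.list .real)) .real :=
  headD (filter valuesP (all (comp valuesP b1) (le v0 v1))) zero

/-- The least value of the table. -/
noncomputable def minP : PolyFun (.list (.list .real)) .real :=
  headD (filter valuesP (all (comp valuesP b1) (le v1 v0))) zero

/-- The predicate `Inst.Narrow`. -/
noncomputable def narrowP : PolyFun (.list (.list .real)) .bool :=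
  any valuesP (and (lt (tpl v0) (dbl (comp maxP b1)))
    (lt (comp maxP b1) (dbl (sub v0 (comp minP b1)))))

/-- The encoding of the agents. -/
noncomputable def readAgentsP : PolyFun (.list (.list .real)) (.list TAgent) :=
  number maxP (map id (number (comp maxP b1) v0))

/-- The encoding of the instance, with the allocation that leaves all goods in the pool. -/
noncomputable def readP : PolyFun (.list (.list .real)) TState :=
  pair (pair readAgentsP (pair maxP (pair minP narrowP)))
    (map (sndOf (headD readAgentsP (pair zero nil))) (pair (fstOf v0) zero))

/-- The table of an allocation. -/
noncomputable def writeP : PolyFun TState (.list (.list .bool)) :=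
  map (agentsOf id) (map (allocOf b1) (app2 eqP (sndOf v0) (fstOf v1)))

/-- The allocation that gives all goods to the first agent. -/
def giveAllP : PolyFun (.list (.list .real)) (.list (.list .bool)) :=
  listCase id nil (cons (map v1 (const true)) (map v0 (map v0 (const false))))

/-- The algorithm. If the greatest value is not positive, then all values are `0`, and every
allocation will do. -/
noncomputable def algorithm : PolyFun (.list (.list .real)) (.list (.list .bool)) :=
  ite (le maxP zero) giveAllP
    (comp (comp writeP (pair fst completeP)) (comp (pair fst seedP) readP))

lemma mem_valuesP (v : Fin n → Fin m → ℝ) (w : ℝ) :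
    w ∈ valuesP.f (encodeValues v) ↔ ∃ i g, v i g = w := by
  change w ∈ (List.ofFn fun i => List.ofFn fun g => v i g).flatMap (fun r => r) ↔ _
  simp [List.mem_ofFn]

lemma maxP_f (v : Fin n → Fin m → ℝ) (i : Fin n) (g : Fin m) :
    (∀ j h, v j h ≤ maxP.f (encodeValues v)) ∧ ∃ j h, v j h = maxP.f (encodeValues v) := by
  have hmem := (mem_valuesP v _).2 ⟨i, g, rfl⟩
  obtain ⟨w, hw, hmax⟩ := (List.toFinset (α := ℝ) (valuesP.f (encodeValues v))).exists_max_image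
    (fun w => w) ⟨_, List.mem_toFinset.2 hmem⟩
  have := headD_filter (l := valuesP.f (encodeValues v)) (q := fun y =>
    (valuesP.f (encodeValues v)).all fun z => decide ((z : ℝ) ≤ y)) (0 : ℝ)
    ⟨w, List.mem_toFinset.1 hw, List.all_eq_true.2 fun z hz =>
      decide_eq_true (hmax z (List.mem_toFinset.2 hz))⟩
  change maxP.f (encodeValues v) ∈ _ ∧ List.all _ (fun z => decide (z ≤ _)) = true at this
  refine ⟨fun j h => ?_, (mem_valuesP v _).1 this.1⟩
  exact of_decide_eq_true (List.all_eq_true.1 this.2 _ ((mem_valuesP v _).2 ⟨j, h, rfl⟩))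

lemma minP_f (v : Fin n → Fin m → ℝ) (i : Fin n) (g : Fin m) :
    (∀ j h, minP.f (encodeValues v) ≤ v j h) ∧ ∃ j h, v j h = minP.f (encodeValues v) := by
  have hmem := (mem_valuesP v _).2 ⟨i, g, rfl⟩
  obtain ⟨w, hw, hmin⟩ := (List.toFinset (α := ℝ) (valuesP.f (encodeValues v))).exists_min_image
    (fun w => w) ⟨_, List.mem_toFinset.2 hmem⟩
  have := headD_filter (l := valuesP.f (encodeValues v)) (q := fun y =>
    (valuesP.f (encodeValues v)).all fun z => decide ((y : ℝ) ≤ z)) (0 : ℝ)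
    ⟨w, List.mem_toFinset.1 hw, List.all_eq_true.2 fun z hz =>
      decide_eq_true (hmin z (List.mem_toFinset.2 hz))⟩
  change minP.f (encodeValues v) ∈ _ ∧ List.all _ (fun z => decide (_ ≤ z)) = true at this
  refine ⟨fun j h => ?_, (mem_valuesP v _).1 this.1⟩
  exact of_decide_eq_true (List.all_eq_true.1 this.2 _ ((mem_valuesP v _).2 ⟨j, h, rfl⟩))

end PolyFun

open PolyFun

/-- An instance in terms of the greatest and the least value of the table. -/
lemma IsThreeValue.exists_inst {v : Fin n → Fin m → ℝ} (hv : IsThreeValue v) (i : Fin n)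
    (g : Fin m) : ∃ I : Inst n m, I.v = v ∧ I.a = maxP.f (encodeValues v) ∧
      I.c = minP.f (encodeValues v) := by
  obtain ⟨h1, i₁, g₁, h1'⟩ := maxP_f v i g
  obtain ⟨h2, i₂, g₂, h2'⟩ := minP_f v i g
  obtain ⟨a, b, c, hba, hcb, hc, h⟩ := hv
  generalize maxP.f (encodeValues v) = x at *
  generalize minP.f (encodeValues v) = y at *
  change ℝ at x y
  have hy : 0 ≤ y := by rcases h i₂ g₂ with h | h | h <;> linarith
  by_cases hw : ∃ j p, v j p ≠ x ∧ v j p ≠ y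
  · obtain ⟨j, p, hx', hy'⟩ := hw
    refine ⟨⟨v, x, v j p, y, h1 j p, h2 j p, hy, fun k q => ?_⟩, rfl, rfl, rfl⟩
    have := h i₁ g₁; have := h i₂ g₂; have := h j p; have := h k q
    grind
  · push Not at hw
    refine ⟨⟨v, x, x, y, le_rfl, (h2 i g).trans (h1 i g), hy, fun k q => ?_⟩, rfl, rfl, rfl⟩
    have := hw k q
    tauto

namespace Inst

variable {I : Inst n m}

lemma readAgentsP_f (ha : I.a = maxP.f (encodeValues I.v)) :
    readAgentsP.f (encodeValues I.v) = I.encAgents := by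
  change numbered (maxP.f (encodeValues I.v)) 0 ((List.ofFn fun i => List.ofFn fun g =>
    I.v i g).map fun r => numbered (maxP.f (encodeValues I.v)) 0 r) = _
  rw [← ha, List.map_ofFn, numbered_ofFn, encAgents, ← List.ofFn_eq_map]
  congr 1
  funext i
  rw [encAgent, tok, encRow, ← List.ofFn_eq_map, Function.comp_apply, numbered_ofFn]
  simp [tok]

open Classical in
lemma narrowP_f (ha : I.a = maxP.f (encodeValues I.v)) (hc : I.c = minP.f (encodeValues I.v)) :
    narrowP.f (encodeValues I.v) = decide I.Narrow := by
  change ((valuesP.f (encodeValues I.v)).any fun w =>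
    !decide ((maxP.f (encodeValues I.v) + maxP.f (encodeValues I.v) : ℝ) ≤ w + w + w) &&
    !decide ((w - minP.f (encodeValues I.v) + (w - minP.f (encodeValues I.v)) : ℝ) ≤
      maxP.f (encodeValues I.v))) = _
  rw [← ha, ← hc, Bool.eq_iff_iff, List.any_eq_true]
  simp only [Bool.and_eq_true, decide_le_not, decide_eq_true_eq]
  rw [Narrow]
  constructor
  · rintro ⟨w, hw, h1, h2⟩
    obtain ⟨i, g, rfl⟩ := (mem_valuesP _ _).1 hw
    exact ⟨i, g, by linarith, by linarith⟩
  · rintro ⟨i, g, h1, h2⟩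
    exact ⟨_, (mem_valuesP _ _).2 ⟨i, g, rfl⟩, by linarith, by linarith⟩

lemma readP_f (hn : 0 < n) (ha : I.a = maxP.f (encodeValues I.v))
    (hc : I.c = minP.f (encodeValues I.v)) :
    readP.f (encodeValues I.v) = I.encState fun _ => none := by
  have h1 : (readAgentsP.f (encodeValues I.v)).headD ((0 : ℝ), []) = I.encAgent ⟨0, hn⟩ := by
    rw [readAgentsP_f ha, encAgents]
    obtain ⟨k, rfl⟩ := Nat.exists_eq_succ_of_ne_zero hn.ne'
    rw [List.finRange_succ]; rfl
  change ((readAgentsP.f (encodeValues I.v), (maxP.f (encodeValues I.v),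
    (minP.f (encodeValues I.v), narrowP.f (encodeValues I.v)))),
    ((readAgentsP.f (encodeValues I.v)).headD ((0 : ℝ), [])).2.map fun p => (p.1, (0 : ℝ))) = _
  rw [h1, readAgentsP_f ha, narrowP_f ha hc, ← ha, ← hc, encAgent, encRow, List.map_map]
  rfl

lemma writeP_f (ha : 0 < I.a) (σ : Alloc n m) :
    writeP.f (I.encState σ) = encodeAllocation (bun σ) := by
  change (I.encAgents.map fun i => (I.encAlloc σ).map fun p => eqP.ap2 p.2 i.1) = _
  rw [encAgents, List.map_map, ← List.ofFn_eq_map, encodeAllocation]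
  congr 1
  funext i
  rw [Function.comp_apply, encAlloc, List.map_map, ← List.ofFn_eq_map]
  congr 1
  funext g
  simp only [Function.comp_apply, encAgent, eqP_f, ← otok_some, otok_inj ha, mem_bun]

lemma valid_none (I : Inst n m) : I.Valid fun _ => none :=
  ⟨fun i k _ g hg => by simp at hg, fun k => Or.inl (by simp [bun]),
    fun l k _ _ p hp => by simp at hp⟩

lemma algorithm_f (hn : 0 < n) (ha : 0 < I.a) (ha' : I.a = maxP.f (encodeValues I.v))
    (hc : I.c = minP.f (encodeValues I.v)) : ∃ σ, I.EFX σ ∧ pool σ = ∅ ∧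
      algorithm.f (encodeValues I.v) = encodeAllocation (bun σ) := by
  obtain ⟨σ₁, h1, h1'⟩ := seedP_f ha I.valid_none
  obtain ⟨σ₂, h2, h2', h2''⟩ := completeP_f hn ha h1'
  refine ⟨σ₂, h2', h2'', ?_⟩
  change (if decide (maxP.f (encodeValues I.v) ≤ (0 : ℝ)) = true then giveAllP.f _ else
    writeP.f (((readP.f (encodeValues I.v)).1, seedP.f (readP.f (encodeValues I.v))).1,
      completeP.f ((readP.f (encodeValues I.v)).1, seedP.f (readP.f (encodeValues I.v))))) = _
  rw [readP_f hn ha' hc, h1, ← ha', if_neg (by simpa using ha)]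
  change writeP.f (I.encEnv, completeP.f (I.encState σ₁)) = _
  rw [h2]
  exact writeP_f ha σ₂

end Inst

lemma size_encodeValues_le (v : Fin n → Fin m → ℝ) :
    (Ty.list (.list .real)).size (encodeValues v) ≤
      (2 * (Polynomial.X + 1) ^ 2 : Polynomial ℕ).eval (n + m) := by
  have h1 : ∀ r ∈ encodeValues v, (Ty.list .real).size r ≤ m * 2 + 1 := fun r hr => by
    obtain ⟨i, rfl⟩ := List.mem_ofFn.1 hr
    refine (Ty.size_le_of_forall (k := 1) fun _ _ => le_rfl).trans ?_
    rw [List.length_ofFn]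
  refine (Ty.size_le_of_forall h1).trans ?_
  have h2 : (encodeValues v).length = n := List.length_ofFn
  rw [h2]
  simp only [Polynomial.eval_mul, Polynomial.eval_pow, Polynomial.eval_add, Polynomial.eval_X,
    Polynomial.eval_one, Polynomial.eval_ofNat]
  nlinarith [Nat.zero_le (n * m), Nat.zero_le (n * n), Nat.zero_le (m * m)]

theorem mainTheorem1 :
    ∃ (p : Prog (.list (.list .real)) (.list (.list .bool))) (T : Polynomial ℕ),
      ∀ (n m : ℕ) (v : Fin n → Fin m → ℝ), 0 < n → IsThreeValue v →
        ∃ (X : Fin n → Finset (Fin m)) (t : ℕ),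
          p.Runs (encodeValues v) (encodeAllocation X) t ∧ t ≤ T.eval (n + m) ∧
          IsCompleteAllocation X ∧ IsApproxEFX (2 / 3) v X := by
  obtain ⟨h, ⟨T, hT⟩, hrun⟩ := algorithm.runs
  refine ⟨algorithm.prog, T.comp (2 * (Polynomial.X + 1) ^ 2), fun n m v hn hv => ?_⟩
  obtain ⟨t, ht, hr⟩ := hrun (encodeValues v)
  have ht' : t ≤ (T.comp (2 * (Polynomial.X + 1) ^ 2)).eval (n + m) := by
    rw [Polynomial.eval_comp]
    exact ht.trans ((hT _).trans (T.eval_nat_mono (size_encodeValues_le v)))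
  suffices ∃ X : Fin n → Finset (Fin m), algorithm.f (encodeValues v) = encodeAllocation X ∧
      IsCompleteAllocation X ∧ IsApproxEFX (2 / 3) v X by
    obtain ⟨X, h1, h2⟩ := this
    exact ⟨X, t, h1 ▸ hr, ht', h2⟩
  by_cases ha : maxP.f (encodeValues v) ≤ (0 : ℝ)
  · obtain ⟨k, rfl⟩ := Nat.exists_eq_succ_of_ne_zero hn.ne'
    refine ⟨fun i => if i = 0 then univ else ∅, ?_, ⟨fun i j hij => ?_, fun g => ⟨0, by simp⟩⟩, ?_⟩
    · change (if decide (maxP.f (encodeValues v) ≤ (0 : ℝ)) = true then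
        giveAllP.f (encodeValues v) else _) = _
      rw [if_pos (by simpa using ha), encodeValues, encodeAllocation, List.ofFn_succ,
        List.ofFn_succ]
      change ((List.ofFn fun g => v 0 g).map fun _ => true) ::
        ((List.ofFn fun i : Fin k => List.ofFn fun g => v i.succ g).map fun r =>
          r.map fun _ => false) = _
      simp only [List.map_ofFn, Function.comp_def]
      congr 1
      simp
    · by_cases hi : i = 0
      · have hj : j ≠ 0 := fun hj => hij (hi.trans hj.symm)
        simp [hj]
      · simp [hi]
    · have h0 : ∀ i g, v i g = 0 := fun i g => by
        obtain ⟨a, b, c, hba, hcb, hc, h⟩ := hv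
        have := ((maxP_f v i g).1 i g).trans ha
        rcases h i g with h | h | h <;> linarith
      intro i j _ g _
      simp [bundleValue, h0]
  · have ha : (0 : ℝ) < maxP.f (encodeValues v) := not_le.1 ha
    have hne : ∃ i g, v i g = maxP.f (encodeValues v) := by
      by_contra hno
      have h0 : valuesP.f (encodeValues v) = [] := List.eq_nil_iff_forall_not_mem.2 fun w hw => by
        obtain ⟨i, g, -⟩ := (mem_valuesP v w).1 hw
        exact hno (maxP_f v i g).2
      have h1 : maxP.f (encodeValues v) = (0 : ℝ) := by
        change ((valuesP.f (encodeValues v)).filter _).headD (0 : ℝ) = 0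
        rw [h0]; rfl
      exact ha.ne' h1
    obtain ⟨i, g, -⟩ := hne
    obtain ⟨I, rfl, h1, h2⟩ := hv.exists_inst i g
    obtain ⟨σ, h3, h4, h5⟩ := I.algorithm_f hn (by rw [h1]; exact ha) h1 h2
    refine ⟨bun σ, h5, ⟨fun i j hij => disjoint_bun σ hij, fun g => ?_⟩, fun i j hij g hg => ?_⟩
    · rcases hg : σ g with _ | i
      · have : g ∈ pool σ := mem_pool.2 hg
        rw [h4] at this
        simp at this
      · exact ⟨i, mem_bun.2 hg⟩
    · have := h3 i j hij g hg
      rw [Inst.own, Inst.val, Inst.val] at this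
      rw [sdiff_singleton_eq_erase, bundleValue, bundleValue]
      linarith
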